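/- **Conventions.** For $n\ge 1$, $NC(n)$ is the set of non-crossing partitions of $[n]=\{1,\dots,n\}$. For $t,s\ge 1$ let $\gamma_{t,s}=(1,\dots,t)(t+1,\dots,t+s)\in S_{t+s}$, and let $S_{NC}(t,s)$ be the set of annular non-crossing permutations, i.e. of all $\sigma\in S_{t+s}$ such that the subgroup $\langle\sigma,\gamma_{t,s}\rangle$ acts transitively on $[t+s]$ and $|\sigma|+|\sigma^{-1}\gamma_{t,s}|=t+s$, where $|\cdot|$ is the number of cycles, fixed points included. For a sequence $(u_n)_{n\ge1}$ put $u_\pi=\prod_{V\in\pi}u_{|V|}$ (product over the blocks of a partition) and $u_\sigma=\prod_{c\in\sigma}u_{|c|}$ (product over the cycles of a permutation, fixed points included). Let $\mu$ be a probability measure on $\mathbb R$ with finite moments $m_n(\mu)=\int x^n\,d\mu$ of all orders. Its free cumulants $(r_n(\mu))_{n\ge1}$ are defined recursively by $m_n(\mu)=\sum_{\pi\in NC(n)}r_\pi(\mu)$, $n\ge1$. Let $p$ be a monic real polynomial of degree $d\ge1$ with only real roots $\lambda_1,\dots,\lambda_d$ (with multiplicity). Put $m_n(p)=\frac1d\sum_{i=1}^d\lambda_i^n$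 and write $p(x)=\sum_{k=0}^d(-1)^k\binom dk a_k\,x^{d-k}$. For $1\le n\le d$ the finite-free cumulants of $p$ are $$\kappa_n(p)=\frac{(-d)^{n-1}}{(n-1)!}\sum_{\pi\in P(n)}(-1)^{|\pi|-1}(|\pi|-1)!\prod_{V\in\pi}a_{|V|},$$ where $P(n)$ is the set of all partitions of $[n]$ and $|\pi|$ is the number of blocks of $\pi$. A sequence $\mathfrak p=(p_d)_{d\ge1}$ of monic real-rooted polynomials with $\deg p_d=d$ has *infinitesimal distribution* $(\mu,\mu')$, where $\mu$ is a probability measure on $\mathbb R$ with finite moments of all orders and $\mu':\mathbb R[x]\to\mathbb R$ is linear, if for every $n\ge0$, as $d\to\infty$, $$m_n(p_d)\to m_n(\mu)\qquad\text{and}\qquad d\,\bigl(m_n(p_d)-m_n(\mu)\bigr)\to\mu'(x^n)$$ (so $\mu'(1)=0$). **Lemma.** Let $\mathfrak p=(p_d)_{d\ge1}$ have infinitesimal distribution $(\mu,\mu')$. Then for each $n\ge1$ the cumulant fluctuation $\widehat r_n(\mathfrak p)=\lim_{d\to\infty}d\,(\kappa_n(p_d)-r_n(\mu))$ exists, i.e.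 $$\kappa_n(p_d)=r_n(\mu)+\tfrac1d\,\widehat r_n(\mathfrak p)+o(1/d)\qquad(d\to\infty),$$ and the formal power series $$G_\mu(z)=\sum_{n\ge0}m_n(\mu)z^{-n-1},\qquad G_{\mu'}(z)=\sum_{n\ge0}\mu'(x^n)z^{-n-1},\qquad \widehat R_{\mathfrak p}(z)=\sum_{n\ge1}\widehat r_n(\mathfrak p)z^{n-1},$$ $$H_\mu(z)=\sum_{n\ge2}h_n(\mu)z^{-n-1},\qquad h_n(\mu)=\frac n2\sum_{\substack{t+s=n\\ t,s\ge1}}\ \sum_{\sigma\in S_{NC}(t,s)}\frac{r_\sigma(\mu)}{ts},$$ satisfy, as formal power series in $z^{-1}$ with $'$ denoting $d/dz$ on $G_\mu$, $$G_{\mu'}=-(\widehat R_{\mathfrak p}\circ G_\mu)\cdot G_\mu'-H_\mu .$$ -/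

import Mathlib

open Filter Topology Asymptotics MeasureTheory

namespace FiniteFree

/-! ### Non-crossing partitions and free cumulants -/

/-- Set partitions of `[n]`; `π.parts` is the set of blocks (all of them non-empty). -/
abbrev SetPartition (n : ℕ) : Type := Finpartition (Finset.univ : Finset (Fin n))

/-- A partition is non-crossing if `a < b < c < d` with `a, c ∈ V` and `b, d ∈ W` forces
`V = W`. -/
def IsNonCrossing {n : ℕ} (π : SetPartition n) : Prop :=
  ∀ a b c d : Fin n, a < b → b < c → c < d →
    ∀ V ∈ π.parts, ∀ W ∈ π.parts, a ∈ V → c ∈ V → b ∈ W → d ∈ W → V = W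

open scoped Classical in
/-- The set `NC(n)` of non-crossing partitions of `[n]`. -/
noncomputable def NC (n : ℕ) : Finset (SetPartition n) :=
  Finset.univ.filter IsNonCrossing

/-- A partition of `[n]` other than the one-block partition has only blocks with fewer than `n`
elements. -/
theorem card_lt_of_parts_ne {n : ℕ} {π : SetPartition n}
    (h : π.parts ≠ {Finset.univ}) {V : Finset (Fin n)} (hV : V ∈ π.parts) : V.card < n := by
  by_contra hlt
  have hVu : V = Finset.univ := by
    apply Finset.eq_univ_of_card
    have := Finset.card_le_univ V
    simp only [Fintype.card_fin] at this ⊢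
    omega
  apply h
  ext W
  rw [Finset.mem_singleton]
  constructor
  · intro hW
    by_contra hne
    have hdis : Disjoint W V := π.disjoint hW hV (by rw [hVu]; exact hne)
    rw [hVu] at hdis
    exact π.ne_bot hW (Finset.disjoint_self_iff_empty W |>.mp (hdis.mono_right (Finset.subset_univ W)))
  · rintro rfl
    exact hVu ▸ hV

open scoped Classical in
/-- The free cumulants `r_n` of a moment sequence `m`, defined recursively by the moment-cumulant
formula `m_n = ∑_{π ∈ NC(n)} ∏_{V ∈ π} r_{|V|}`, in which `r_n` itself occurs only in the term of
the one-block partition. -/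
noncomputable def freeCumulantSeq (m : ℕ → ℝ) (n : ℕ) : ℝ :=
  m n - ∑ π ∈ ((NC n).filter fun π => π.parts ≠ {Finset.univ}).attach,
    ∏ V ∈ π.1.parts.attach, freeCumulantSeq m V.1.card
  termination_by n
  decreasing_by exact card_lt_of_parts_ne (Finset.mem_filter.mp π.2).2 V.2

/-- The moment-cumulant formula. -/
theorem moment_eq_sum_freeCumulantSeq (m : ℕ → ℝ) (n : ℕ) (hn : 1 ≤ n) :
    m n = ∑ π ∈ NC n, ∏ V ∈ π.parts, freeCumulantSeq m V.card := by
  classical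
  have hne : (Finset.univ : Finset (Fin n)) ≠ ⊥ := by
    intro h
    have h2 := congrArg Finset.card h
    simp at h2
    omega
  have hmem : Finpartition.indiscrete hne ∈ NC n := by
    simp only [NC, Finset.mem_filter, Finset.mem_univ, true_and, IsNonCrossing,
      Finpartition.indiscrete_parts, Finset.mem_singleton]
    rintro a b c d - - - V rfl W rfl - - - -
    rfl
  have hfil : (NC n).filter (fun π => ¬ π.parts ≠ {Finset.univ})
      = {Finpartition.indiscrete hne} := by
    ext π
    simp only [Finset.mem_filter, not_not, Finset.mem_singleton]
    constructor
    · rintro ⟨-, h⟩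
      exact Finpartition.ext (by simpa using h)
    · rintro rfl
      exact ⟨hmem, by simp⟩
  rw [← Finset.sum_filter_add_sum_filter_not (NC n) (fun π => π.parts ≠ {Finset.univ}), hfil,
    Finset.sum_singleton]
  simp only [Finpartition.indiscrete_parts, Finset.prod_singleton, Finset.card_univ,
    Fintype.card_fin]
  conv_rhs => rw [freeCumulantSeq]
  rw [Finset.sum_attach ((NC n).filter fun π => π.parts ≠ {Finset.univ})
    (fun π => ∏ V ∈ π.parts.attach, freeCumulantSeq m V.1.card)]
  simp only [fun π : SetPartition n =>
    Finset.prod_attach π.parts (fun V => freeCumulantSeq m V.card)]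
  ring

/-- The `n`-th moment `m_n(μ)`. -/
noncomputable def measMoment (μ : Measure ℝ) (n : ℕ) : ℝ := ∫ x, x ^ n ∂μ

/-- The `n`-th free cumulant `r_n(μ)` (`n ≥ 1`). -/
noncomputable def freeCumulant (μ : Measure ℝ) (n : ℕ) : ℝ :=
  freeCumulantSeq (measMoment μ) n

/-! ### Annular non-crossing permutations -/

/-- The permutation `γ_{t,s} = (1,…,t)(t+1,…,t+s)` of `[t+s]`. -/
def annularGamma (t s : ℕ) : Equiv.Perm (Fin (t + s)) :=
  finSumFinEquiv.permCongr (Equiv.Perm.sumCongr (finRotate t) (finRotate s))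

/-- The number of cycles of a permutation, fixed points included. -/
def numCycles {n : ℕ} (σ : Equiv.Perm (Fin n)) : ℕ := Multiset.card σ.partition.parts

/-- The product `u_σ` of `u_{|c|}` over all cycles `c` of `σ`, fixed points included. -/
def cycleProd (u : ℕ → ℝ) {n : ℕ} (σ : Equiv.Perm (Fin n)) : ℝ := (σ.partition.parts.map u).prod

/-- Non-crossing permutations of the `(t,s)`-annulus: `⟨σ, γ_{t,s}⟩` acts transitively on `[t+s]`
and `|σ| + |σ⁻¹ γ_{t,s}| = t + s`. -/
def IsAnnularNonCrossing (t s : ℕ) (σ : Equiv.Perm (Fin (t + s))) : Prop :=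
  MulAction.IsPretransitive
      (Subgroup.closure ({σ, annularGamma t s} : Set (Equiv.Perm (Fin (t + s))))) (Fin (t + s)) ∧
    numCycles σ + numCycles (σ⁻¹ * annularGamma t s) = t + s

open scoped Classical in
/-- The set `S_NC(t,s)`. -/
noncomputable def annularNC (t s : ℕ) : Finset (Equiv.Perm (Fin (t + s))) :=
  Finset.univ.filter (IsAnnularNonCrossing t s)

/-- `h_n(μ) = (n/2) ∑_{t+s=n, t,s≥1} ∑_{σ ∈ S_NC(t,s)} r_σ(μ)/(t s)`. -/
noncomputable def hCoeff (μ : Measure ℝ) (n : ℕ) : ℝ :=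
  (n : ℝ) / 2 * ∑ ts ∈ (Finset.HasAntidiagonal.antidiagonal n).filter (fun ts => 1 ≤ ts.1 ∧ 1 ≤ ts.2),
    ∑ σ ∈ annularNC ts.1 ts.2, cycleProd (freeCumulant μ) σ / ((ts.1 : ℝ) * (ts.2 : ℝ))

/-! ### Real-rooted polynomials and finite-free cumulants -/

/-- `p` belongs to `𝒫_d(ℝ)`: it is monic of degree `d` and all its roots are real. -/
def IsMonicRealRooted (d : ℕ) (p : Polynomial ℝ) : Prop :=
  p.Monic ∧ p.natDegree = d ∧ p.Splits

/-- The `n`-th moment of the root distribution: `(1/d) ∑ λ_i(p)^n`, roots with multiplicity,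
where `d` is the degree of `p`. -/
noncomputable def rootMoment (p : Polynomial ℝ) (n : ℕ) : ℝ :=
  (1 / (p.natDegree : ℝ)) * (p.roots.map fun x => x ^ n).sum

/-- The normalized coefficients `a_k` in `p = ∑_{k ≤ d} (-1)^k (d choose k) a_k x^{d-k}`
(used for `k ≤ d`), where `d` is the degree of `p`. -/
noncomputable def normCoeff (p : Polynomial ℝ) (k : ℕ) : ℝ :=
  (-1) ^ k * p.coeff (p.natDegree - k) / (p.natDegree.choose k : ℝ)

/-- The finite-free cumulants (used for `1 ≤ n ≤ d`)
`κ_n(p) = (-d)^{n-1}/(n-1)! ∑_{π ∈ P(n)} (-1)^{|π|-1} (|π|-1)! ∏_{V ∈ π} a_{|V|}`. -/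
noncomputable def finiteFreeCumulant (p : Polynomial ℝ) (n : ℕ) : ℝ :=
  (-(p.natDegree : ℝ)) ^ (n - 1) / ((n - 1).factorial : ℝ) *
    ∑ π : SetPartition n, (-1) ^ (π.parts.card - 1) * ((π.parts.card - 1).factorial : ℝ) *
      ∏ V ∈ π.parts, normCoeff p V.card

/-! ### Infinitesimal distributions and cumulant fluctuations -/

/-- The sequence of real-rooted polynomials `(p_d)_{d ≥ 1}` has infinitesimal distribution
`(μ, μ')` (the value `p 0` plays no role). -/
structure HasInfinitesimalDistribution (p : ℕ → Polynomial ℝ) (μ : Measure ℝ)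
    (μ' : Polynomial ℝ →ₗ[ℝ] ℝ) : Prop where
  realRooted : ∀ d, 1 ≤ d → IsMonicRealRooted d (p d)
  isProbabilityMeasure : IsProbabilityMeasure μ
  finite_moments : ∀ n : ℕ, Integrable (fun x : ℝ => x ^ n) μ
  tendsto_moment : ∀ n : ℕ, Tendsto (fun d => rootMoment (p d) n) atTop (𝓝 (measMoment μ n))
  tendsto_infinitesimal : ∀ n : ℕ,
    Tendsto (fun d : ℕ => (d : ℝ) * (rootMoment (p d) n - measMoment μ n)) atTop
      (𝓝 (μ' (Polynomial.X ^ n)))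

/-- The cumulant fluctuation `r̂_n(p) = lim_d d (κ_n(p_d) - r_n(μ))`, `n ≥ 1`. -/
noncomputable def cumulantFluctuation (p : ℕ → Polynomial ℝ) (μ : Measure ℝ) (n : ℕ) : ℝ :=
  limUnder atTop fun d : ℕ => (d : ℝ) * (finiteFreeCumulant (p d) n - freeCumulant μ n)

/-! ### Formal power series

Formal power series in `w = z⁻¹` are elements of `PowerSeries ℝ` with `PowerSeries.X` playing the
role of `w`; formal power series in `z` are elements of `PowerSeries ℝ` with `PowerSeries.X`
playing the role of `z`. -/

/-- The series `∑_{n ≥ 0} a_n z^{-n-1}`, as a power series in `z⁻¹`. -/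
noncomputable def cauchySeries (a : ℕ → ℝ) : PowerSeries ℝ :=
  PowerSeries.X * PowerSeries.mk a

/-- The formal derivative with respect to `z` of a power series in `w = z⁻¹`:
`d/dz = -w² d/dw`. -/
noncomputable def derivZ (f : PowerSeries ℝ) : PowerSeries ℝ :=
  -(PowerSeries.X ^ 2 * PowerSeries.derivative ℝ f)

/-- `d/dz ∑ a_n z^{-n} = ∑ (-n) a_n z^{-n-1}`. -/
theorem coeff_succ_derivZ (f : PowerSeries ℝ) (n : ℕ) :
    PowerSeries.coeff (n + 1) (derivZ f) = -(n : ℝ) * PowerSeries.coeff n f := by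
  cases n with
  | zero => simp [derivZ, PowerSeries.coeff_X_pow_mul']
  | succ k =>
    simp only [derivZ, map_neg, show k + 1 + 1 = k + 2 from rfl, PowerSeries.coeff_X_pow_mul,
      PowerSeries.coeff_derivative]
    push_cast
    ring

/-- The Cauchy transform `G_μ(z) = ∑_{n ≥ 0} m_n(μ) z^{-n-1}`, a power series in `z⁻¹`. -/
noncomputable def cauchyTransform (μ : Measure ℝ) : PowerSeries ℝ := cauchySeries (measMoment μ)

/-- The infinitesimal Cauchy transform `G_{μ'}(z) = ∑_{n ≥ 0} μ'(x^n) z^{-n-1}`, a power series in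
`z⁻¹` (its term `n = 0` vanishes when `μ'(1) = 0`). -/
noncomputable def infCauchyTransform (μ' : Polynomial ℝ →ₗ[ℝ] ℝ) : PowerSeries ℝ :=
  cauchySeries fun n => μ' (Polynomial.X ^ n)

/-- The transform `R̂_p(z) = ∑_{n ≥ 1} r̂_n(p) z^{n-1}`, a power series in `z`. -/
noncomputable def fluctuationTransform (p : ℕ → Polynomial ℝ) (μ : Measure ℝ) : PowerSeries ℝ :=
  PowerSeries.mk fun n => cumulantFluctuation p μ (n + 1)

/-- The `H`-transform `H_μ(z) = ∑_{n ≥ 2} h_n(μ) z^{-n-1}`, a power series in `z⁻¹`. -/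
noncomputable def hTransform (μ : Measure ℝ) : PowerSeries ℝ :=
  cauchySeries fun n => if 2 ≤ n then hCoeff μ n else 0

/-- `G_μ` has no constant term in `z⁻¹`, so it can be substituted into any power series. -/
theorem hasSubst_cauchyTransform (μ : Measure ℝ) : PowerSeries.HasSubst (cauchyTransform μ) :=
  PowerSeries.HasSubst.of_constantCoeff_zero' (by simp [cauchyTransform, cauchySeries])

end FiniteFree

/-! Put N = -d, let F(x) = x^d p(1/x) = ∏ (1 - λ_i x), and let M be the generating series of the
root moments. Newton's identities say x F' = N (M - 1) F up to degree d. The finite-free cumulants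
are defined by a logarithm over all set partitions. Inverted, the definition reads N^n a_n = ∑_σ ∏_c
N κ_{|c|}, with σ in S_n and c running over the cycles of σ (`permSum_finiteFreeCumulant`). Also
(-1)^k d(d-1)⋯(d-k+1) is the rising factorial N(N+1)⋯(N+k-1) = ∑_τ N^{|τ|}. So the coefficients of F
are sums over pairs (σ, τ). The exponential formula `pairSum_succ` turns the logarithmic derivative
into a sum over pairs that generate a transitive group: for 1 ≤ n ≤ d, (n-1)! m_n(p) = ∑
(1/N)^{n+1-|σ|-|τ|} κ_σ (`rootMoment_eq_coeff_momentSeries`). The exponent is non-negative by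
`genus_inequality`.

Only exponents 0 and 1 matter at order 1/d. The terms of exponent 0 sum to (n-1)! times the
non-crossing sum. This is proved without a bijection: for every N the moments solve a deformed
functional equation (`isCumulantSystem_momentSeries`), which for 1/N = 0 becomes the equation M = 1
+ ∑ κ_j (xM)^j of the non-crossing sums (`transPoly_zero`). In the terms of exponent 1, genus and
parity force γ = στ to have exactly two cycles, so σ is annular non-crossing relative to γ. Counting
the permutations with cycle lengths t, s gives (n-1)! h_n (`sum_transitivePair_eq_annularCoeff`).

Sequences a + b/d + o(1/d), each paired with the dual number a + bε, form a ring
(`expansionSubring`), so the asymptotics become algebra over the dual numbers with 1/N replaced by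
-ε. The deformed equation is triangular in the cumulants, which therefore inherit expansions from
the moments. Substituting these gives m_n + μ'(x^n) ε = (non-crossing sum of the expanded cumulants)
- h_n ε (`moment_expansion_eq`). The real part identifies the leading terms as the free cumulants.
The ε-part is the derivative of M = 1 + ∑ κ_j (xM)^j in the direction of the fluctuations, which
`ncSeries_derivative` puts in closed form; this is the claimed identity. -/

namespace FiniteFree

/-! ### Set partitions as finite sets of blocks -/

/-- `P` is the set of blocks of a set partition of `S`. -/
def IsBlocks {α : Type*} (S : Finset α) (P : Finset (Finset α)) : Prop :=
  ∅ ∉ P ∧ (∀ V ∈ P, V ⊆ S) ∧ ∀ x ∈ S, ∃! V, V ∈ P ∧ x ∈ V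

open scoped Classical in
/-- All set partitions of `S`, as sets of blocks. -/
noncomputable def blocksOf {α : Type*} (S : Finset α) : Finset (Finset (Finset α)) :=
  S.powerset.powerset.filter (IsBlocks S)

theorem mem_blocksOf {α : Type*} {S : Finset α} {P : Finset (Finset α)} :
    P ∈ blocksOf S ↔ IsBlocks S P := by
  classical
  simp only [blocksOf, Finset.mem_filter, Finset.mem_powerset, and_iff_right_iff_imp]
  intro h V hV
  exact Finset.mem_powerset.2 (h.2.1 V hV)

theorem IsBlocks.eq_of_mem {α : Type*} {S : Finset α} {P : Finset (Finset α)} (h : IsBlocks S P)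
    {V W : Finset α} {x : α} (hV : V ∈ P) (hW : W ∈ P) (hxV : x ∈ V) (hxW : x ∈ W) : V = W :=
  (h.2.2 x (h.2.1 V hV hxV)).unique ⟨hV, hxV⟩ ⟨hW, hxW⟩

theorem blocksOf_empty {α : Type*} : blocksOf (∅ : Finset α) = {∅} := by
  ext P
  rw [mem_blocksOf, Finset.mem_singleton]
  constructor
  · rintro ⟨h1, h2, -⟩
    refine Finset.eq_empty_of_forall_notMem fun V hV => h1 ?_
    rwa [← Finset.subset_empty.1 (h2 V hV)]
  · rintro rfl
    exact ⟨by simp, by simp, by simp⟩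

theorem isBlocks_parts {α : Type*} [DecidableEq α] {S : Finset α} (π : Finpartition S) :
    IsBlocks S π.parts :=
  ⟨π.bot_notMem, fun _ hV => π.le hV, fun _ hx => π.existsUnique_mem hx⟩

/-- Sets of blocks do not carry the ground set in their type, so blocks can be removed, glued and
relabelled without transport. -/
theorem sum_finpartition {α M : Type*} [DecidableEq α] [AddCommMonoid M] {S : Finset α}
    (f : Finset (Finset α) → M) :
    ∑ π : Finpartition S, f π.parts = ∑ P ∈ blocksOf S, f P := by
  classical
  refine Finset.sum_bij (fun π _ => π.parts) (fun π _ => mem_blocksOf.2 (isBlocks_parts π))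
    (fun π _ ρ _ h => Finpartition.ext h) ?_ fun _ _ => rfl
  intro P hP
  have h := mem_blocksOf.1 hP
  exact ⟨Finpartition.ofExistsUnique P h.2.1 h.2.2 h.1, Finset.mem_univ _, rfl⟩

theorem IsBlocks.insert {α : Type*} [DecidableEq α] {S V : Finset α} {Q : Finset (Finset α)}
    (hV : V.Nonempty) (hVS : V ⊆ S) (h : IsBlocks (S \ V) Q) : IsBlocks S (insert V Q) := by
  refine ⟨?_, ?_, ?_⟩
  · rw [Finset.mem_insert, not_or]
    exact ⟨fun h' => hV.ne_empty h'.symm, h.1⟩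
  · intro W hW
    rcases Finset.mem_insert.1 hW with rfl | hW
    · exact hVS
    · exact (h.2.1 W hW).trans Finset.sdiff_subset
  · intro x hx
    by_cases hxV : x ∈ V
    · refine ⟨V, ⟨Finset.mem_insert_self _ _, hxV⟩, ?_⟩
      rintro W ⟨hW, hxW⟩
      rcases Finset.mem_insert.1 hW with rfl | hW
      · rfl
      · exact absurd hxV (Finset.mem_sdiff.1 (h.2.1 W hW hxW)).2
    · obtain ⟨W, ⟨hW, hxW⟩, hu⟩ := h.2.2 x (Finset.mem_sdiff.2 ⟨hx, hxV⟩)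
      refine ⟨W, ⟨Finset.mem_insert_of_mem hW, hxW⟩, ?_⟩
      rintro U ⟨hU, hxU⟩
      rcases Finset.mem_insert.1 hU with rfl | hU
      · exact absurd hxU hxV
      · exact hu U ⟨hU, hxU⟩

theorem IsBlocks.erase {α : Type*} [DecidableEq α] {S V : Finset α} {P : Finset (Finset α)}
    (h : IsBlocks S P) (hV : V ∈ P) : IsBlocks (S \ V) (P.erase V) := by
  refine ⟨fun h' => h.1 (Finset.mem_of_mem_erase h'), ?_, ?_⟩
  · intro W hW
    obtain ⟨hne, hW⟩ := Finset.mem_erase.1 hW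
    intro x hx
    exact Finset.mem_sdiff.2 ⟨h.2.1 W hW hx, fun hxV => hne (h.eq_of_mem hW hV hx hxV)⟩
  · intro x hx
    obtain ⟨hxS, hxV⟩ := Finset.mem_sdiff.1 hx
    obtain ⟨W, ⟨hW, hxW⟩, hu⟩ := h.2.2 x hxS
    refine ⟨W, ⟨Finset.mem_erase.2 ⟨fun e => hxV (e ▸ hxW), hW⟩, hxW⟩, ?_⟩
    rintro U ⟨hU, hxU⟩
    exact hu U ⟨Finset.mem_of_mem_erase hU, hxU⟩

theorem IsBlocks.notMem_of_sdiff {α : Type*} [DecidableEq α] {S V : Finset α}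
    {Q : Finset (Finset α)} (hV : V.Nonempty) (h : IsBlocks (S \ V) Q) : V ∉ Q := by
  intro hVQ
  obtain ⟨x, hx⟩ := hV
  exact (Finset.mem_sdiff.1 (h.2.1 V hVQ hx)).2 hx

/-- Summation over set partitions according to the block that contains a given point. -/
theorem sum_blocksOf_eq {α M : Type*} [DecidableEq α] [AddCommMonoid M] {S : Finset α} {x : α}
    (hx : x ∈ S) (f : Finset (Finset α) → M) :
    ∑ P ∈ blocksOf S, f P
      = ∑ T ∈ (S.erase x).powerset, ∑ Q ∈ blocksOf (S \ insert x T), f (insert (insert x T) Q) := by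
  rw [Finset.sum_sigma']
  symm
  have key : ∀ T ∈ (S.erase x).powerset, insert x T ⊆ S ∧ x ∉ T := by
    intro T hT
    rw [Finset.mem_powerset] at hT
    exact ⟨Finset.insert_subset hx (hT.trans (Finset.erase_subset _ _)),
      fun h => Finset.notMem_erase x S (hT h)⟩
  refine Finset.sum_bij (fun p _ => insert (insert x p.1) p.2) ?_ ?_ ?_ fun _ _ => rfl
  · rintro ⟨T, Q⟩ h
    obtain ⟨hT, hQ⟩ := Finset.mem_sigma.1 h
    exact mem_blocksOf.2 ((mem_blocksOf.1 hQ).insert (Finset.insert_nonempty x T) (key T hT).1)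
  · rintro ⟨T, Q⟩ h ⟨T', Q'⟩ h' e
    obtain ⟨hT, hQ⟩ := Finset.mem_sigma.1 h
    obtain ⟨hT', hQ'⟩ := Finset.mem_sigma.1 h'
    simp only at e hT hQ hT' hQ'
    have hQ := mem_blocksOf.1 hQ
    have hQ' := mem_blocksOf.1 hQ'
    have hP := hQ.insert (Finset.insert_nonempty x T) (key T hT).1
    have hV : insert x T = insert x T' := by
      refine hP.eq_of_mem (x := x) (Finset.mem_insert_self _ _) ?_ (Finset.mem_insert_self _ _)
        (Finset.mem_insert_self _ _)
      rw [e]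
      exact Finset.mem_insert_self _ _
    have hTT : T = T' := by
      rw [← Finset.erase_insert (key T hT).2, hV, Finset.erase_insert (key T' hT').2]
    subst hTT
    have hQQ : Q = Q' := by
      rw [← Finset.erase_insert (hQ.notMem_of_sdiff (Finset.insert_nonempty x T)), e,
        Finset.erase_insert (hQ'.notMem_of_sdiff (Finset.insert_nonempty x T))]
    rw [hQQ]
  · intro P hP
    have h := mem_blocksOf.1 hP
    obtain ⟨V, ⟨hV, hxV⟩, -⟩ := h.2.2 x hx
    refine ⟨⟨V.erase x, P.erase V⟩, Finset.mem_sigma.2 ⟨?_, ?_⟩, ?_⟩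
    · exact Finset.mem_powerset.2 (Finset.erase_subset_erase _ (h.2.1 V hV))
    · simp only [Finset.insert_erase hxV]
      exact mem_blocksOf.2 (h.erase hV)
    · simp only [Finset.insert_erase hxV, Finset.insert_erase hV]

/-- The sum `∑ c_{|π|} ∏_{V ∈ π} a_{|V|}` over the set partitions of `S`. -/
noncomputable def blockSum (a : ℕ → ℝ) {α : Type*} (c : ℕ → ℝ) (S : Finset α) : ℝ :=
  ∑ P ∈ blocksOf S, c P.card * ∏ V ∈ P, a V.card

/-- Split off the block of `x`. The remaining partition has one block fewer, hence the shift of `c`;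
this mirrors the chain rule for `(egf c).subst (egf a)`. -/
theorem blockSum_rec (a c : ℕ → ℝ) {α : Type*} [DecidableEq α] {S : Finset α} {x : α}
    (hx : x ∈ S) :
    blockSum a c S = ∑ T ∈ (S.erase x).powerset,
      a (T.card + 1) * blockSum a (fun m => c (m + 1)) (S \ insert x T) := by
  rw [blockSum, sum_blocksOf_eq hx]
  refine Finset.sum_congr rfl fun T hT => ?_
  have hxT : x ∉ T := fun h => Finset.notMem_erase x S (Finset.mem_powerset.1 hT h)
  rw [blockSum, Finset.mul_sum]
  refine Finset.sum_congr rfl fun Q hQ => ?_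
  have h := (mem_blocksOf.1 hQ).notMem_of_sdiff (Finset.insert_nonempty x T)
  rw [Finset.card_insert_of_notMem h, Finset.prod_insert h, Finset.card_insert_of_notMem hxT]
  ring

/-! ### Exponential generating functions and inversion of the logarithm -/

/-- The exponential generating function of a sequence. -/
noncomputable def egf (a : ℕ → ℝ) : PowerSeries ℝ := PowerSeries.mk fun n => a n / n.factorial

theorem coeff_egf (a : ℕ → ℝ) (n : ℕ) : PowerSeries.coeff n (egf a) = a n / n.factorial :=
  PowerSeries.coeff_mk _ _

theorem derivative_egf (a : ℕ → ℝ) :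
    PowerSeries.derivative ℝ (egf a) = egf fun n => a (n + 1) := by
  ext n
  rw [PowerSeries.coeff_derivative, egf, egf, PowerSeries.coeff_mk, PowerSeries.coeff_mk,
    Nat.factorial_succ]
  push_cast
  have h1 : (n.factorial : ℝ) ≠ 0 := by positivity
  have h2 : (n : ℝ) + 1 ≠ 0 := by positivity
  field_simp

theorem egf_mul_egf_coeff (a b : ℕ → ℝ) (n : ℕ) :
    (n.factorial : ℝ) * PowerSeries.coeff n (egf a * egf b)
      = ∑ j ∈ Finset.range (n + 1), (n.choose j : ℝ) * a j * b (n - j) := by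
  rw [PowerSeries.coeff_mul, Finset.Nat.sum_antidiagonal_eq_sum_range_succ
    (fun i j => PowerSeries.coeff i (egf a) * PowerSeries.coeff j (egf b)), Finset.mul_sum]
  refine Finset.sum_congr rfl fun j hj => ?_
  have hj : j ≤ n := by simpa [Nat.lt_succ_iff] using hj
  simp only [egf, PowerSeries.coeff_mk]
  rw [Nat.cast_choose ℝ hj]
  have h1 : (j.factorial : ℝ) ≠ 0 := by positivity
  have h2 : ((n - j).factorial : ℝ) ≠ 0 := by positivity
  field_simp

/-- The generating function of the sums `blockSum`. -/
theorem blockSum_eq_coeff_subst (a : ℕ → ℝ) (ha : a 0 = 0) {α : Type*} :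
    ∀ (n : ℕ) (c : ℕ → ℝ) (S : Finset α), S.card = n →
      blockSum a c S = n.factorial * PowerSeries.coeff n ((egf c).subst (egf a)) := by
  classical
  have hA : PowerSeries.HasSubst (egf a) :=
    PowerSeries.HasSubst.of_constantCoeff_zero' (by simp [egf, ha])
  intro n
  induction n using Nat.strong_induction_on with
  | _ n ih =>
  intro c S hS
  cases n with
  | zero =>
    rw [Finset.card_eq_zero] at hS
    subst hS
    have h0 : PowerSeries.constantCoeff (egf a) = 0 := by simp [egf, ha]
    rw [blockSum, blocksOf_empty, PowerSeries.coeff_subst' hA, finsum_eq_single _ 0]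
    · simp [egf]
    · intro m hm
      rw [PowerSeries.coeff_zero_eq_constantCoeff_apply, map_pow, h0, zero_pow hm, smul_zero]
  | succ k =>
    obtain ⟨x, hx⟩ : S.Nonempty := Finset.card_pos.1 (by omega)
    have hcard : (S.erase x).card = k := by rw [Finset.card_erase_of_mem hx]; omega
    have step : ((k + 1).factorial : ℝ) * PowerSeries.coeff (k + 1) ((egf c).subst (egf a))
        = k.factorial * PowerSeries.coeff k
          (PowerSeries.derivative ℝ ((egf c).subst (egf a))) := by
      rw [PowerSeries.coeff_derivative, Nat.factorial_succ]
      push_cast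
      ring
    -- The chain rule gives the factor `c'` composed with `a`, known by induction, times `a'`, the
    -- contribution of the block of `x`.
    rw [step, PowerSeries.derivative_subst hA, derivative_egf, derivative_egf, blockSum_rec a c hx]
    have hb : ((egf fun n => c (n + 1)).subst (egf a) : PowerSeries ℝ)
        = egf fun i => i.factorial * PowerSeries.coeff i
          ((egf fun n => c (n + 1)).subst (egf a) : PowerSeries ℝ) := by
      ext i
      simp only [egf, PowerSeries.coeff_mk]
      have h1 : (i.factorial : ℝ) ≠ 0 := by positivity
      field_simp
    rw [mul_comm (PowerSeries.subst _ _), hb, egf_mul_egf_coeff]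
    have : ∀ T ∈ (S.erase x).powerset,
        a (T.card + 1) * blockSum a (fun m => c (m + 1)) (S \ insert x T)
        = (fun j => a (j + 1) * ((k - j).factorial * PowerSeries.coeff (k - j)
          ((egf fun n => c (n + 1)).subst (egf a) : PowerSeries ℝ))) T.card := by
      intro T hT
      have hT' := Finset.mem_powerset.1 hT
      have hxT : x ∉ T := fun h => Finset.notMem_erase x S (hT' h)
      have hc : (S \ insert x T).card = k - T.card := by
        rw [Finset.card_sdiff_of_subset (Finset.insert_subset hx
          (hT'.trans (Finset.erase_subset _ _))), Finset.card_insert_of_notMem hxT]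
        omega
      simp only
      rw [ih (k - T.card) (by omega) _ _ hc]
    rw [Finset.sum_congr rfl this, Finset.sum_powerset_apply_card (fun j => a (j + 1) *
      ((k - j).factorial * PowerSeries.coeff (k - j)
        ((egf fun n => c (n + 1)).subst (egf a) : PowerSeries ℝ))), hcard]
    refine Finset.sum_congr rfl fun j _ => ?_
    rw [nsmul_eq_mul]
    ring

/-- Inversion of the cumulant formula over all set partitions. -/
theorem blockSum_log_inversion (a : ℕ → ℝ) (c : ℕ → ℝ)
    (hc : ∀ m, c (m + 1) = (-1) ^ m * m.factorial) (a1 : ℕ → ℝ) (ha1 : a1 0 = 1)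
    (ha : ∀ n, 1 ≤ n → a1 n = a n) (n : ℕ) :
    a1 (n + 1) = ∑ j ∈ Finset.range (n + 1), (n.choose j : ℝ) *
      blockSum a c (Finset.univ : Finset (Fin (j + 1))) * a1 (n - j) := by
  classical
  -- Blocks are non-empty, so the value at 0 never enters; it is set to 0 to make substitution
  -- legitimate.
  set b : ℕ → ℝ := fun n => if n = 0 then 0 else a n with hb
  have hb0 : b 0 = 0 := by simp [hb]
  have hA : PowerSeries.HasSubst (egf b) :=
    PowerSeries.HasSubst.of_constantCoeff_zero' (by simp [egf, hb0])
  have hab : ∀ m, blockSum a c (Finset.univ : Finset (Fin m))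
      = blockSum b c (Finset.univ : Finset (Fin m)) := by
    intro m
    refine Finset.sum_congr rfl fun P hP => ?_
    congr 1
    refine Finset.prod_congr rfl fun V hV => ?_
    have : V ≠ ∅ := fun h => (mem_blocksOf.1 hP).1 (h ▸ hV)
    simp [hb, this]
  have hE : egf a1 = 1 + egf b := by
    ext i
    rcases Nat.eq_zero_or_pos i with rfl | hi
    · simp [egf, hb, ha1]
    · simp [egf, hb, PowerSeries.coeff_one, hi.ne', ha i hi]
  -- The shifted `c` has generating function 1/(1+x), the derivative of log(1+x). Since only
  -- derivatives are used, `c 0` is free.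
  have hinv : (egf fun n => c (n + 1)).subst (egf b) * (1 + egf b) = (1 : PowerSeries ℝ) := by
    have h1 : (egf fun n => c (n + 1)) * (1 + PowerSeries.X) = (1 : PowerSeries ℝ) := by
      ext i
      rw [mul_add, mul_one, map_add]
      have hf : ∀ i : ℕ, (i.factorial : ℝ) ≠ 0 := fun i => by positivity
      cases i with
      | zero => simp [egf, hc]
      | succ i =>
        rw [PowerSeries.coeff_succ_mul_X]
        simp only [egf, PowerSeries.coeff_mk, hc, PowerSeries.coeff_one]
        rw [mul_div_cancel_right₀ _ (hf _), mul_div_cancel_right₀ _ (hf _)]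
        simp [pow_succ]
    have h2 := congrArg (PowerSeries.substAlgHom hA) h1
    rw [map_mul, map_add, map_one, PowerSeries.substAlgHom_X, PowerSeries.coe_substAlgHom] at h2
    exact h2
  have hd : PowerSeries.derivative ℝ (egf a1)
      = PowerSeries.derivative ℝ ((egf c).subst (egf b)) * egf a1 := by
    rw [PowerSeries.derivative_subst hA, hE, derivative_egf c, map_add,
      PowerSeries.derivative_one, zero_add, mul_right_comm, hinv, one_mul]
  have hK : ((egf c).subst (egf b) : PowerSeries ℝ)
      = egf fun m => blockSum a c (Finset.univ : Finset (Fin m)) := by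
    ext i
    simp only [hab]
    rw [coeff_egf, blockSum_eq_coeff_subst b hb0 i c _ (by simp)]
    have h1 : (i.factorial : ℝ) ≠ 0 := by positivity
    field_simp
  rw [hK, derivative_egf, derivative_egf] at hd
  have := egf_mul_egf_coeff (fun m => blockSum a c (Finset.univ : Finset (Fin (m + 1)))) a1 n
  rw [← this, ← hd, egf, PowerSeries.coeff_mk]
  have h1 : (n.factorial : ℝ) ≠ 0 := by positivity
  field_simp

/-! ### The functional equation of the sums over non-crossing partitions -/

/-- The non-crossing condition for a family of blocks. -/
def NonCrossingBlocks {α : Type*} [LT α] (P : Finset (Finset α)) : Prop :=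
  ∀ a b c d : α, a < b → b < c → c < d →
    ∀ V ∈ P, ∀ W ∈ P, a ∈ V → c ∈ V → b ∈ W → d ∈ W → V = W

theorem NonCrossingBlocks.mono {α : Type*} [LT α] {P Q : Finset (Finset α)}
    (h : NonCrossingBlocks P) (hQ : Q ⊆ P) : NonCrossingBlocks Q :=
  fun a b c d hab hbc hcd V hV W hW => h a b c d hab hbc hcd V (hQ hV) W (hQ hW)

open scoped Classical in
/-- The non-crossing partitions of `S`. -/
noncomputable def ncBlocks {α : Type*} [LT α] (S : Finset α) : Finset (Finset (Finset α)) :=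
  (blocksOf S).filter NonCrossingBlocks

theorem mem_ncBlocks {α : Type*} [LT α] {S : Finset α} {P : Finset (Finset α)} :
    P ∈ ncBlocks S ↔ IsBlocks S P ∧ NonCrossingBlocks P := by
  classical
  rw [ncBlocks, Finset.mem_filter, mem_blocksOf]

/-- The sum `∑ u_π` over the non-crossing partitions of `S`. -/
noncomputable def ncSum {R : Type*} [CommRing R] (u : ℕ → R) {α : Type*} [LT α]
    (S : Finset α) : R :=
  ∑ P ∈ ncBlocks S, ∏ V ∈ P, u V.card

theorem ncSum_empty {R : Type*} [CommRing R] (u : ℕ → R) {α : Type*} [LT α] :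
    ncSum u (∅ : Finset α) = 1 := by
  classical
  have : ncBlocks (∅ : Finset α) = {∅} := by
    rw [ncBlocks, blocksOf_empty]
    refine Finset.filter_true_of_mem fun P hP => ?_
    rw [Finset.mem_singleton] at hP
    subst hP
    intro a b c d _ _ _ V hV
    simp at hV
  simp [ncSum, this]

theorem isBlocks_map {α β : Type*} (f : α ↪ β) {S : Finset α}
    {P : Finset (Finset α)} :
    IsBlocks (S.map f) (P.map (Finset.mapEmbedding f).toEmbedding) ↔ IsBlocks S P := by
  simp only [IsBlocks, Finset.mem_map, forall_exists_index, and_imp, forall_apply_eq_imp_iff₂,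
    RelEmbedding.coe_toEmbedding, Finset.mapEmbedding_apply, Finset.map_eq_empty,
    Finset.map_subset_map]
  refine and_congr (by simp) (and_congr Iff.rfl (forall₂_congr fun x _ => ?_))
  constructor
  · rintro ⟨_, ⟨⟨V, hV, rfl⟩, hx⟩, hu⟩
    refine ⟨V, ⟨hV, by simpa using hx⟩, ?_⟩
    rintro W ⟨hW, hxW⟩
    exact Finset.map_injective f (hu _ ⟨⟨W, hW, rfl⟩, by simpa using hxW⟩)
  · rintro ⟨V, ⟨hV, hx⟩, hu⟩
    refine ⟨V.map f, ⟨⟨V, hV, rfl⟩, by simpa using hx⟩, ?_⟩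
    rintro _ ⟨⟨W, hW, rfl⟩, hxW⟩
    rw [hu W ⟨hW, by simpa using hxW⟩]

theorem nonCrossingBlocks_map {α β : Type*} [LT α] [LT β] (f : α ↪ β)
    (hf : ∀ a b, f a < f b ↔ a < b) {P : Finset (Finset α)} :
    NonCrossingBlocks (P.map (Finset.mapEmbedding f).toEmbedding) ↔ NonCrossingBlocks P := by
  constructor
  · intro h a b c d hab hbc hcd V hV W hW ha hc hb hd
    refine Finset.map_injective f (h (f a) (f b) (f c) (f d) ((hf _ _).2 hab) ((hf _ _).2 hbc)
      ((hf _ _).2 hcd) _ (Finset.mem_map.2 ⟨V, hV, rfl⟩) _ (Finset.mem_map.2 ⟨W, hW, rfl⟩) ?_ ?_ ?_ ?_)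
    all_goals simpa
  · intro h a b c d hab hbc hcd V' hV' W' hW' ha hc hb hd
    obtain ⟨V, hV, rfl⟩ := Finset.mem_map.1 hV'
    obtain ⟨W, hW, rfl⟩ := Finset.mem_map.1 hW'
    simp only [RelEmbedding.coe_toEmbedding, Finset.mapEmbedding_apply, Finset.mem_map] at *
    obtain ⟨a, ha, rfl⟩ := ha
    obtain ⟨b, hb, rfl⟩ := hb
    obtain ⟨c, hc, rfl⟩ := hc
    obtain ⟨d, hd, rfl⟩ := hd
    rw [hf] at hab hbc hcd
    rw [h a b c d hab hbc hcd V hV W hW ha hc hb hd]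

/-- Crossings depend only on the order, so an order embedding carries non-crossing partitions to
non-crossing partitions. Applied to `Fin n` inside ℕ and to shifts of intervals. -/
theorem ncSum_map {R : Type*} [CommRing R] (u : ℕ → R) {α β : Type*} [LT α] [LT β] (f : α ↪ β)
    (hf : ∀ a b, f a < f b ↔ a < b) (S : Finset α) : ncSum u (S.map f) = ncSum u S := by
  classical
  symm
  refine Finset.sum_bij (fun P _ => P.map (Finset.mapEmbedding f).toEmbedding) ?_ ?_ ?_ ?_
  · intro P hP
    rw [mem_ncBlocks] at hP ⊢
    exact ⟨(isBlocks_map f).2 hP.1, (nonCrossingBlocks_map f hf).2 hP.2⟩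
  · intro P _ Q _ h
    exact Finset.map_injective _ h
  · intro P' hP'
    obtain ⟨h1, h2⟩ := mem_ncBlocks.1 hP'
    have : P' ⊆ S.powerset.map (Finset.mapEmbedding f).toEmbedding := by
      intro V hV
      obtain ⟨W, hW, rfl⟩ := Finset.subset_map_iff.1 (h1.2.1 V hV)
      exact Finset.mem_map.2 ⟨W, Finset.mem_powerset.2 hW, rfl⟩
    obtain ⟨P, -, rfl⟩ := Finset.subset_map_iff.1 this
    exact ⟨P, mem_ncBlocks.2 ⟨(isBlocks_map f).1 h1, (nonCrossingBlocks_map f hf).1 h2⟩, rfl⟩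
  · intro P _
    simp [Finset.prod_map]

theorem IsBlocks.union {α : Type*} [DecidableEq α] {S T : Finset α} {P Q : Finset (Finset α)}
    (hP : IsBlocks S P) (hQ : IsBlocks T Q) (hST : Disjoint S T) : IsBlocks (S ∪ T) (P ∪ Q) := by
  rw [Finset.disjoint_left] at hST
  refine ⟨by simp [hP.1, hQ.1], ?_, ?_⟩
  · intro V hV
    rcases Finset.mem_union.1 hV with h | h
    · exact (hP.2.1 V h).trans Finset.subset_union_left
    · exact (hQ.2.1 V h).trans Finset.subset_union_right
  · intro x hx
    rcases Finset.mem_union.1 hx with h | h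
    · obtain ⟨V, ⟨hV, hxV⟩, hu⟩ := hP.2.2 x h
      refine ⟨V, ⟨Finset.mem_union_left _ hV, hxV⟩, ?_⟩
      rintro W ⟨hW, hxW⟩
      rcases Finset.mem_union.1 hW with hW | hW
      · exact hu W ⟨hW, hxW⟩
      · exact absurd (hQ.2.1 W hW hxW) (hST h)
    · obtain ⟨V, ⟨hV, hxV⟩, hu⟩ := hQ.2.2 x h
      refine ⟨V, ⟨Finset.mem_union_right _ hV, hxV⟩, ?_⟩
      rintro W ⟨hW, hxW⟩
      rcases Finset.mem_union.1 hW with hW | hW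
      · exact absurd h (hST (hP.2.1 W hW hxW))
      · exact hu W ⟨hW, hxW⟩

theorem IsBlocks.filter {α : Type*} [DecidableEq α] {S T : Finset α} {P : Finset (Finset α)}
    {p : Finset α → Prop} [DecidablePred p] (hP : IsBlocks S P) (hT : T ⊆ S)
    (h1 : ∀ V ∈ P, p V → V ⊆ T) (h2 : ∀ V ∈ P, ∀ x ∈ V, x ∈ T → p V) :
    IsBlocks T (P.filter p) := by
  refine ⟨fun h => hP.1 (Finset.mem_filter.1 h).1, ?_, ?_⟩
  · intro V hV
    obtain ⟨hV, hp⟩ := Finset.mem_filter.1 hV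
    exact h1 V hV hp
  · intro x hx
    obtain ⟨V, ⟨hV, hxV⟩, hu⟩ := hP.2.2 x (hT hx)
    refine ⟨V, ⟨Finset.mem_filter.2 ⟨hV, h2 V hV x hxV hx⟩, hxV⟩, ?_⟩
    rintro W ⟨hW, hxW⟩
    exact hu W ⟨(Finset.mem_filter.1 hW).1, hxW⟩

/-! ### Recursion on the block of 0 -/

/-- `V` has `k` elements, contains `0` unless `n = 0`, and together with the blocks in `Q` it forms
a non-crossing partition of `{0, …, n-1}`. -/
def IsMarked (k n : ℕ) (p : Finset ℕ × Finset (Finset ℕ)) : Prop :=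
  p.1 ⊆ Finset.range n ∧ p.1.card = k ∧ (0 < n → 0 ∈ p.1) ∧
    IsBlocks (Finset.range n \ p.1) p.2 ∧ NonCrossingBlocks (insert p.1 p.2)

open scoped Classical in
/-- Non-crossing partitions of `{0, …, n-1}` whose block of `0` has `k` elements. -/
noncomputable def markedBlocks (k n : ℕ) : Finset (Finset ℕ × Finset (Finset ℕ)) :=
  ((Finset.range n).powerset ×ˢ (Finset.range n).powerset.powerset).filter (IsMarked k n)

theorem mem_markedBlocks {k n : ℕ} {p : Finset ℕ × Finset (Finset ℕ)} :
    p ∈ markedBlocks k n ↔ IsMarked k n p := by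
  classical
  simp only [markedBlocks, Finset.mem_filter, Finset.mem_product, Finset.mem_powerset,
    and_iff_right_iff_imp]
  intro h
  refine ⟨h.1, fun V hV => Finset.mem_powerset.2 ?_⟩
  exact (h.2.2.2.1.2.1 V hV).trans Finset.sdiff_subset

/-- The weighted number of non-crossing partitions whose block of `0` has `k` elements; this block
gets weight one. -/
noncomputable def markedSum {R : Type*} [CommRing R] (u : ℕ → R) (k n : ℕ) : R :=
  ∑ p ∈ markedBlocks k n, ∏ V ∈ p.2, u V.card

/-- A new largest element `v` of the marked block separates the old blocks, all below `v`, from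
those of `Q₂`, all above `v`. Only crossings that involve `v` itself need an argument. -/
theorem IsMarked.extend {k n v : ℕ} (hv : v < n) {V : Finset ℕ} {Q₁ Q₂ : Finset (Finset ℕ)}
    (h : IsMarked k v (V, Q₁)) (h₂ : IsBlocks (Finset.Ico (v + 1) n) Q₂)
    (hn₂ : NonCrossingBlocks Q₂) : IsMarked (k + 1) n (insert v V, Q₁ ∪ Q₂) := by
  obtain ⟨hV, hc, h0, h₁, hn₁⟩ := h
  simp only at hV hc h0 h₁ hn₁
  have hvV : v ∉ V := fun h => by simpa using hV h
  have hVlt : ∀ x ∈ V, x < v := fun x hx => Finset.mem_range.1 (hV hx)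
  have hQ1 : ∀ W ∈ Q₁, ∀ x ∈ W, x < v ∧ x ∉ V := fun W hW x hx => by
    have := h₁.2.1 W hW hx
    simpa using this
  have hQ2 : ∀ W ∈ Q₂, ∀ x ∈ W, v < x := fun W hW x hx => by
    have := Finset.mem_Ico.1 (h₂.2.1 W hW hx)
    omega
  refine ⟨?_, ?_, ?_, ?_, ?_⟩
  · refine Finset.insert_subset (Finset.mem_range.2 hv) fun x hx => Finset.mem_range.2 ?_
    exact (hVlt x hx).trans hv
  · simp only
    rw [Finset.card_insert_of_notMem hvV, hc]
  · intro _
    rcases Nat.eq_zero_or_pos v with rfl | h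
    · exact Finset.mem_insert_self _ _
    · exact Finset.mem_insert_of_mem (h0 h)
  · have hd : Disjoint (Finset.range v \ V) (Finset.Ico (v + 1) n) := by
      rw [Finset.disjoint_left]
      intro x hx hx'
      simp only [Finset.mem_sdiff, Finset.mem_range, Finset.mem_Ico] at hx hx'
      omega
    have := h₁.union h₂ hd
    convert this using 1
    ext x
    simp only [Finset.mem_sdiff, Finset.mem_range, Finset.mem_insert, Finset.mem_union,
      Finset.mem_Ico]
    constructor
    · rintro ⟨h1, h2⟩
      push Not at h2
      rcases lt_or_gt_of_ne h2.1 with h | h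
      · exact Or.inl ⟨h, h2.2⟩
      · exact Or.inr ⟨h, h1⟩
    · rintro (⟨h1, h2⟩ | ⟨h1, h2⟩)
      · exact ⟨h1.trans hv, by rintro (rfl | h) <;> [omega; exact h2 h]⟩
      · refine ⟨h2, ?_⟩
        rintro (rfl | h)
        · omega
        · have := hVlt x h
          omega
  · intro a b c d hab hbc hcd X hX Y hY ha hc' hb hd
    have mem1 : V ∈ insert V Q₁ := Finset.mem_insert_self _ _
    have mem2 : ∀ W ∈ Q₁, W ∈ insert V Q₁ := fun W hW => Finset.mem_insert_of_mem hW
    simp only [Finset.mem_insert, Finset.mem_union] at hX hY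
    rcases hX with rfl | hX | hX <;> rcases hY with rfl | hY | hY
    · rfl
    · exfalso
      have hdv := (hQ1 Y hY d hd).1
      have ha' : a ∈ V := (Finset.mem_insert.1 ha).resolve_left (by omega)
      have hc'' : c ∈ V := (Finset.mem_insert.1 hc').resolve_left (by omega)
      have := hn₁ a b c d hab hbc hcd V mem1 Y (mem2 Y hY) ha' hc'' hb hd
      exact (hQ1 Y hY b hb).2 (this ▸ hb)
    · exfalso
      have := hQ2 Y hY b hb
      rcases Finset.mem_insert.1 hc' with h | h
      · omega
      · have := hVlt c h
        omega
    · exfalso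
      have hcv := (hQ1 X hX c hc').1
      have hb' : b ∈ V := (Finset.mem_insert.1 hb).resolve_left (by omega)
      rcases Finset.mem_insert.1 hd with rfl | hd
      -- A crossing that ends at `v` is moved to the front: 0 lies in `V`, so 0 < a < b < c already
      -- crosses in the old partition.
      · have h0' := h0 (by omega)
        have haV := (hQ1 X hX a ha).2
        have ha0 : 0 < a := Nat.pos_of_ne_zero fun h => haV (h ▸ h0')
        have := hn₁ 0 a b c ha0 hab hbc V mem1 X (mem2 X hX) h0' hb' ha hc'
        exact haV (this ▸ ha)
      · have := hn₁ a b c d hab hbc hcd X (mem2 X hX) V mem1 ha hc' hb' hd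
        exact (hQ1 X hX a ha).2 (this ▸ ha)
    · exact hn₁ a b c d hab hbc hcd X (mem2 X hX) Y (mem2 Y hY) ha hc' hb hd
    · have := hQ2 Y hY b hb
      have := (hQ1 X hX c hc').1
      omega
    · exfalso
      have := hQ2 X hX a ha
      rcases Finset.mem_insert.1 hb with h | h
      · omega
      · have := hVlt b h
        omega
    · have := hQ2 X hX a ha
      have := (hQ1 Y hY b hb).1
      omega
    · exact hn₂ a b c d hab hbc hcd X hX Y hY ha hc' hb hd

/-- Inverse of `IsMarked.extend`: cut at the largest element of the marked block. -/
theorem IsMarked.exists_split {k n : ℕ} {V : Finset ℕ} {Q : Finset (Finset ℕ)}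
    (h : IsMarked (k + 1) n (V, Q)) : ∃ v < n, ∃ V' Q₁ Q₂, IsMarked k v (V', Q₁) ∧
      IsBlocks (Finset.Ico (v + 1) n) Q₂ ∧ NonCrossingBlocks Q₂ ∧
      V = insert v V' ∧ Q = Q₁ ∪ Q₂ := by
  classical
  obtain ⟨hV, hc, h0, hQ, hnc⟩ := h
  simp only at hV hc h0 hQ hnc
  have hne : V.Nonempty := Finset.card_pos.1 (by omega)
  set v := V.max' hne with hvdef
  have hvV : v ∈ V := V.max'_mem hne
  have hvn : v < n := Finset.mem_range.1 (hV hvV)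
  have hle : ∀ x ∈ V, x ≤ v := fun x hx => V.le_max' x hx
  have hQV : ∀ W ∈ Q, ∀ x ∈ W, x < n ∧ x ∉ V := fun W hW x hx => by
    have := hQ.2.1 W hW hx
    simpa using this
  have h0V := h0 (by omega)
  -- A block with points on both sides of `v` would cross `V` at 0 < b < v < d.
  have hsplit : ∀ W ∈ Q, ∀ b ∈ W, ∀ d ∈ W, b < v → v < d → False := by
    intro W hW b hb d hd hbv hvd
    have hbV := (hQV W hW b hb).2
    have hb0 : 0 < b := Nat.pos_of_ne_zero fun h => hbV (h ▸ h0V)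
    have := hnc 0 b v d hb0 hbv hvd V (Finset.mem_insert_self _ _) W
      (Finset.mem_insert_of_mem hW) h0V hvV hb hd
    exact hbV (this ▸ hb)
  have hvW : ∀ W ∈ Q, ∀ x ∈ W, x ≠ v := fun W hW x hx e => (hQV W hW x hx).2 (e ▸ hvV)
  refine ⟨v, hvn, V.erase v, Q.filter (· ⊆ Finset.range v), Q.filter (¬ · ⊆ Finset.range v),
    ⟨?_, ?_, ?_, ?_, ?_⟩, ?_, ?_, (Finset.insert_erase hvV).symm,
    (Finset.filter_union_filter_not_eq _ Q).symm⟩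
  · intro x hx
    obtain ⟨h1, h2⟩ := Finset.mem_erase.1 hx
    exact Finset.mem_range.2 (lt_of_le_of_ne (hle x h2) h1)
  · simp only
    rw [Finset.card_erase_of_mem hvV]
    omega
  · intro hv0
    exact Finset.mem_erase.2 ⟨hv0.ne, h0V⟩
  · refine hQ.filter ?_ ?_ ?_
    · intro x hx
      simp only [Finset.mem_sdiff, Finset.mem_range, Finset.mem_erase, not_and] at hx ⊢
      exact ⟨by omega, hx.2 (by omega)⟩
    · intro W hW hWv x hx
      simp only [Finset.mem_sdiff, Finset.mem_erase, not_and]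
      exact ⟨hWv hx, fun _ => (hQV W hW x hx).2⟩
    · intro W hW x hx hxT y hy
      have hxv : x < v := by simpa using (Finset.mem_sdiff.1 hxT).1
      refine Finset.mem_range.2 ?_
      by_contra hlt
      exact hsplit W hW x hx y hy hxv (lt_of_le_of_ne (not_lt.1 hlt) (hvW W hW y hy).symm)
  · intro a b c d hab hbc hcd X hX Y hY ha hc' hb hd
    simp only [Finset.mem_insert, Finset.mem_filter] at hX hY
    rcases hX with rfl | ⟨hX, -⟩ <;> rcases hY with rfl | ⟨hY, -⟩
    · rfl
    · exfalso
      have := hnc a b c d hab hbc hcd V (Finset.mem_insert_self _ _) Y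
        (Finset.mem_insert_of_mem hY) (Finset.mem_of_mem_erase ha) (Finset.mem_of_mem_erase hc')
        hb hd
      exact (hQV Y hY b hb).2 (this ▸ hb)
    · exfalso
      have := hnc a b c d hab hbc hcd X (Finset.mem_insert_of_mem hX) V
        (Finset.mem_insert_self _ _) ha hc' (Finset.mem_of_mem_erase hb)
        (Finset.mem_of_mem_erase hd)
      exact (hQV X hX a ha).2 (this ▸ ha)
    · exact hnc a b c d hab hbc hcd X (Finset.mem_insert_of_mem hX) Y
        (Finset.mem_insert_of_mem hY) ha hc' hb hd
  · refine hQ.filter ?_ ?_ ?_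
    · intro x hx
      simp only [Finset.mem_sdiff, Finset.mem_range, Finset.mem_Ico] at hx ⊢
      refine ⟨hx.2, fun h => ?_⟩
      have := hle x h
      omega
    · intro W hW hWv x hx
      obtain ⟨y, hy, hyv⟩ := Finset.not_subset.1 hWv
      rw [Finset.mem_range, not_lt] at hyv
      rw [Finset.mem_Ico]
      refine ⟨?_, (hQV W hW x hx).1⟩
      by_contra hlt
      exact hsplit W hW x hx y hy (lt_of_le_of_ne (by omega) (hvW W hW x hx))
        (lt_of_le_of_ne hyv (hvW W hW y hy).symm)
    · intro W hW x hx hxT hWv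
      have := Finset.mem_range.1 (hWv hx)
      have := Finset.mem_Ico.1 hxT
      omega
  · exact hnc.mono ((Finset.filter_subset _ _).trans (Finset.subset_insert _ _))

theorem ncSum_Ico {R : Type*} [CommRing R] (u : ℕ → R) (v n : ℕ) :
    ncSum u (Finset.Ico v n) = ncSum u (Finset.range (n - v)) := by
  rw [← ncSum_map u (addLeftEmbedding v) (by simp) (Finset.range (n - v)), Finset.range_eq_Ico]
  congr 1
  ext x
  simp only [Finset.mem_Ico, Finset.mem_map, addLeftEmbedding_apply]
  constructor
  · intro h
    exact ⟨x - v, by omega, by omega⟩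
  · rintro ⟨y, hy, rfl⟩
    omega

theorem disjoint_of_isBlocks {α : Type*} {S T : Finset α} {P Q : Finset (Finset α)}
    (hP : IsBlocks S P) (hQ : IsBlocks T Q) (hST : Disjoint S T) : Disjoint P Q := by
  rw [Finset.disjoint_left] at hST ⊢
  intro V hV hV'
  obtain ⟨x, hx⟩ : V.Nonempty := Finset.nonempty_iff_ne_empty.2 fun h => hP.1 (h ▸ hV)
  exact hST (hP.2.1 V hV hx) (hQ.2.1 V hV' hx)

theorem disjoint_range_sdiff_Ico (v n : ℕ) (V : Finset ℕ) :
    Disjoint (Finset.range v \ V) (Finset.Ico (v + 1) n) := by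
  rw [Finset.disjoint_left]
  intro x hx hx'
  simp only [Finset.mem_sdiff, Finset.mem_range, Finset.mem_Ico] at hx hx'
  omega

/-- Here `v` is the largest element of the block of 0: what lies above it is an arbitrary
non-crossing partition, and what lies below is marked with one element fewer. -/
theorem markedSum_succ {R : Type*} [CommRing R] (u : ℕ → R) (k n : ℕ) :
    markedSum u (k + 1) n
      = ∑ v ∈ Finset.range n, markedSum u k v * ncSum u (Finset.range (n - (v + 1))) := by
  classical
  rw [Finset.sum_congr rfl fun v _ => by rw [← ncSum_Ico]]
  simp only [markedSum, ncSum, Finset.sum_mul_sum, ← Finset.sum_product']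
  rw [Finset.sum_sigma']
  symm
  refine Finset.sum_bij (fun p _ => (insert p.1 p.2.1.1, p.2.1.2 ∪ p.2.2)) ?_ ?_ ?_ ?_
  · rintro ⟨v, ⟨V, Q₁⟩, Q₂⟩ h
    simp only [Finset.mem_sigma, Finset.mem_product, Finset.mem_range, mem_markedBlocks,
      mem_ncBlocks] at h ⊢
    exact h.2.1.extend h.1 h.2.2.1 h.2.2.2
  · rintro ⟨v, ⟨V, Q₁⟩, Q₂⟩ h ⟨w, ⟨W, Q₁'⟩, Q₂'⟩ h' e
    simp only [Finset.mem_sigma, Finset.mem_product, Finset.mem_range, mem_markedBlocks,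
      mem_ncBlocks] at h h'
    simp only [Prod.mk.injEq] at e
    obtain ⟨e1, e2⟩ := e
    have hV : ∀ x ∈ V, x < v := fun x hx => Finset.mem_range.1 (h.2.1.1 hx)
    have hW : ∀ x ∈ W, x < w := fun x hx => Finset.mem_range.1 (h'.2.1.1 hx)
    have hvw : v = w := by
      have h1 : v ∈ insert w W := e1 ▸ Finset.mem_insert_self v V
      have h2 : w ∈ insert v V := e1 ▸ Finset.mem_insert_self w W
      rcases Finset.mem_insert.1 h1 with h1 | h1
      · exact h1
      · rcases Finset.mem_insert.1 h2 with h2 | h2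
        · exact h2.symm
        · have := hV w h2
          have := hW v h1
          omega
    subst hvw
    have hVW : V = W := by
      rw [← Finset.erase_insert (fun h => lt_irrefl _ (hV v h)), e1,
        Finset.erase_insert (fun h => lt_irrefl _ (hW v h))]
    subst hVW
    -- The two families can be read off from their union: `Q₁` consists of the blocks inside
    -- `Finset.range v`.
    have hfil : ∀ Q₁ Q₂ : Finset (Finset ℕ), IsBlocks (Finset.range v \ V) Q₁ →
        IsBlocks (Finset.Ico (v + 1) n) Q₂ →
        Q₁ = (Q₁ ∪ Q₂).filter (· ⊆ Finset.range v) ∧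
        Q₂ = (Q₁ ∪ Q₂).filter (¬ · ⊆ Finset.range v) := by
      intro Q₁ Q₂ h1 h2
      have a1 : ∀ X ∈ Q₁, X ⊆ Finset.range v := fun X hX =>
        (h1.2.1 X hX).trans Finset.sdiff_subset
      have a2 : ∀ X ∈ Q₂, ¬ X ⊆ Finset.range v := by
        intro X hX hXv
        obtain ⟨x, hx⟩ : X.Nonempty := Finset.nonempty_iff_ne_empty.2 fun h => h2.1 (h ▸ hX)
        have := Finset.mem_range.1 (hXv hx)
        have := Finset.mem_Ico.1 (h2.2.1 X hX hx)
        omega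
      constructor <;> ext X <;> simp only [Finset.mem_filter, Finset.mem_union]
      · exact ⟨fun h => ⟨Or.inl h, a1 X h⟩, fun h => h.1.resolve_right fun h' => a2 X h' h.2⟩
      · exact ⟨fun h => ⟨Or.inr h, a2 X h⟩, fun h => h.1.resolve_left fun h' => h.2 (a1 X h')⟩
    obtain ⟨f1, f2⟩ := hfil Q₁ Q₂ h.2.1.2.2.2.1 h.2.2.1
    obtain ⟨f1', f2'⟩ := hfil Q₁' Q₂' h'.2.1.2.2.2.1 h'.2.2.1
    rw [← e2, ← f1] at f1'
    rw [← e2, ← f2] at f2'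
    rw [f1', f2']
  · rintro ⟨V, Q⟩ h
    rw [mem_markedBlocks] at h
    obtain ⟨v, hv, V', Q₁, Q₂, h1, h2, h3, rfl, rfl⟩ := h.exists_split
    refine ⟨⟨v, (V', Q₁), Q₂⟩, ?_, rfl⟩
    simp only [Finset.mem_sigma, Finset.mem_product, Finset.mem_range, mem_markedBlocks,
      mem_ncBlocks]
    exact ⟨hv, h1, h2, h3⟩
  · rintro ⟨v, ⟨V, Q₁⟩, Q₂⟩ h
    simp only [Finset.mem_sigma, Finset.mem_product, Finset.mem_range, mem_markedBlocks,
      mem_ncBlocks] at h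
    rw [Finset.prod_union (disjoint_of_isBlocks h.2.1.2.2.2.1 h.2.2.1
      (disjoint_range_sdiff_Ico v n V))]

theorem markedSum_zero {R : Type*} [CommRing R] (u : ℕ → R) (n : ℕ) :
    markedSum u 0 n = if n = 0 then 1 else 0 := by
  split_ifs with hn
  · subst hn
    have : markedBlocks 0 0 = {(∅, ∅)} := by
      ext ⟨V, Q⟩
      rw [mem_markedBlocks, Finset.mem_singleton, Prod.mk.injEq]
      constructor
      · rintro ⟨h1, -, -, h4, -⟩
        simp only [Finset.range_zero, Finset.subset_empty, Finset.empty_sdiff] at h1 h4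
        have h4 := mem_blocksOf.2 h4
        rw [blocksOf_empty, Finset.mem_singleton] at h4
        exact ⟨h1, h4⟩
      · rintro ⟨rfl, rfl⟩
        refine ⟨by simp, by simp, by simp, ?_, ?_⟩
        · have : (∅ : Finset (Finset ℕ)) ∈ blocksOf (∅ : Finset ℕ) := by simp [blocksOf_empty]
          simpa using mem_blocksOf.1 this
        · intro a b c d _ _ _ V hV W hW ha
          simp only [insert_empty_eq, Finset.mem_singleton] at hV
          simp [hV] at ha
    simp [markedSum, this]
  · refine Finset.sum_eq_zero fun p hp => ?_
    obtain ⟨-, h2, h3, -⟩ := mem_markedBlocks.1 hp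
    have := h3 (Nat.pos_of_ne_zero hn)
    rw [Finset.card_eq_zero] at h2
    simp [h2] at this

/-- The generating function of the sums over non-crossing partitions. -/
noncomputable def ncSeries {R : Type*} [CommRing R] (u : ℕ → R) : PowerSeries R :=
  PowerSeries.mk fun n => ncSum u (Finset.range n)

/-- Each element of the marked block contributes a factor x for itself and a factor `ncSeries u` for
the gap that follows it. -/
theorem markedSum_eq_coeff {R : Type*} [CommRing R] (u : ℕ → R) (k : ℕ) :
    ∀ n, markedSum u k n = PowerSeries.coeff n ((PowerSeries.X * ncSeries u) ^ k) := by
  induction k with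
  | zero =>
    intro n
    rw [markedSum_zero, pow_zero, PowerSeries.coeff_one]
  | succ k ih =>
    intro n
    rw [markedSum_succ, pow_succ', mul_assoc, mul_comm (ncSeries u)]
    cases n with
    | zero => simp
    | succ n =>
      rw [PowerSeries.coeff_succ_X_mul, PowerSeries.coeff_mul,
        Finset.Nat.sum_antidiagonal_eq_sum_range_succ (fun i j =>
          PowerSeries.coeff i ((PowerSeries.X * ncSeries u) ^ k) *
          PowerSeries.coeff j (ncSeries u))]
      refine Finset.sum_congr rfl fun v hv => ?_
      rw [ih, ncSeries, PowerSeries.coeff_mk, Nat.add_sub_add_right]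

theorem ncSum_eq_sum_markedSum {R : Type*} [CommRing R] (u : ℕ → R) (n : ℕ) (hn : 1 ≤ n) :
    ncSum u (Finset.range n) = ∑ k ∈ Finset.range (n + 1), u k * markedSum u k n := by
  classical
  simp only [markedSum, Finset.mul_sum]
  rw [Finset.sum_sigma']
  symm
  have hcond : ∀ k V Q, IsMarked k n (V, Q) → V.Nonempty :=
    fun k V Q h => ⟨0, h.2.2.1 (by omega)⟩
  refine Finset.sum_bij (fun p _ => insert p.2.1 p.2.2) ?_ ?_ ?_ ?_
  · rintro ⟨k, V, Q⟩ h
    simp only [Finset.mem_sigma, mem_markedBlocks] at h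
    exact mem_ncBlocks.2 ⟨h.2.2.2.2.1.insert (hcond k V Q h.2) h.2.1, h.2.2.2.2.2⟩
  · rintro ⟨k, V, Q⟩ h ⟨l, W, Q'⟩ h' e
    simp only [Finset.mem_sigma, mem_markedBlocks] at h h' e
    have hP := h.2.2.2.2.1.insert (hcond k V Q h.2) h.2.1
    have hVW : V = W := by
      refine hP.eq_of_mem (x := 0) (Finset.mem_insert_self _ _) ?_ (h.2.2.2.1 hn) (h'.2.2.2.1 hn)
      rw [e]
      exact Finset.mem_insert_self _ _
    subst hVW
    have hk : k = l := h.2.2.1.symm.trans h'.2.2.1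
    subst hk
    have : Q = Q' := by
      rw [← Finset.erase_insert (a := V) (s := Q) (h.2.2.2.2.1.notMem_of_sdiff (hcond k V Q h.2)), e,
        Finset.erase_insert (h'.2.2.2.2.1.notMem_of_sdiff (hcond k V Q h.2))]
    rw [this]
  · intro P hP
    obtain ⟨h1, h2⟩ := mem_ncBlocks.1 hP
    obtain ⟨V, ⟨hV, h0⟩, -⟩ := h1.2.2 0 (Finset.mem_range.2 (by omega))
    refine ⟨⟨V.card, V, P.erase V⟩, ?_, Finset.insert_erase hV⟩
    simp only [Finset.mem_sigma, mem_markedBlocks, Finset.mem_range]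
    refine ⟨?_, h1.2.1 V hV, rfl, fun _ => h0, h1.erase hV, ?_⟩
    · have := Finset.card_le_card (h1.2.1 V hV)
      rw [Finset.card_range] at this
      omega
    · simp only [Finset.insert_erase hV]
      exact h2
  · rintro ⟨k, V, Q⟩ h
    simp only [Finset.mem_sigma, mem_markedBlocks] at h
    have := h.2.2.2.2.1.notMem_of_sdiff (hcond k V Q h.2)
    simp only
    rw [Finset.prod_insert this, show V.card = k from h.2.2.1]

/-- The functional equation `M = 1 + ∑_k u_k (x M)^k`. -/
theorem coeff_ncSeries {R : Type*} [CommRing R] (u : ℕ → R) (n : ℕ) (hn : 1 ≤ n) :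
    PowerSeries.coeff n (ncSeries u)
      = ∑ k ∈ Finset.range (n + 1),
        u k * PowerSeries.coeff n ((PowerSeries.X * ncSeries u) ^ k) := by
  conv_lhs => rw [ncSeries, PowerSeries.coeff_mk, ncSum_eq_sum_markedSum u n hn]
  simp only [markedSum_eq_coeff]

theorem coeff_zero_ncSeries {R : Type*} [CommRing R] (u : ℕ → R) :
    PowerSeries.coeff 0 (ncSeries u) = 1 := by
  rw [ncSeries, PowerSeries.coeff_mk, Finset.range_zero, ncSum_empty]

/-- A moment sequence is the sum over non-crossing partitions of its free cumulants. -/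
theorem moment_eq_ncSum (m : ℕ → ℝ) (n : ℕ) (hn : 1 ≤ n) :
    m n = ncSum (freeCumulantSeq m) (Finset.range n) := by
  classical
  have huniv : Finset.range n = (Finset.univ : Finset (Fin n)).map Fin.valEmbedding := by
    ext x
    simp only [Finset.mem_range, Finset.mem_map, Finset.mem_univ, true_and, Fin.valEmbedding_apply]
    exact ⟨fun h => ⟨⟨x, h⟩, rfl⟩, by rintro ⟨y, rfl⟩; exact y.2⟩
  rw [huniv, ncSum_map _ _ (by simp), moment_eq_sum_freeCumulantSeq m n hn, NC, Finset.sum_filter,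
    ncSum, ncBlocks, Finset.sum_filter, ← sum_finpartition]
  rfl

/-! ### Cycle counts and the genus inequality -/

open Equiv

/-- The setoid obtained from `r` by identifying `a` and `b`. -/
def joinPair {α : Type*} (r : Setoid α) (a b : α) : Setoid α where
  r x y := r x y ∨ (r x a ∧ r y b) ∨ (r x b ∧ r y a)
  iseqv := by
    refine ⟨fun x => Or.inl (r.refl x), ?_, ?_⟩
    · rintro x y (h | ⟨h1, h2⟩ | ⟨h1, h2⟩)
      · exact Or.inl (r.symm h)
      · exact Or.inr (Or.inr ⟨h2, h1⟩)
      · exact Or.inr (Or.inl ⟨h2, h1⟩)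
    · rintro x y z (h | ⟨h1, h2⟩ | ⟨h1, h2⟩) (h' | ⟨h1', h2'⟩ | ⟨h1', h2'⟩)
      · exact Or.inl (r.trans h h')
      · exact Or.inr (Or.inl ⟨r.trans h h1', h2'⟩)
      · exact Or.inr (Or.inr ⟨r.trans h h1', h2'⟩)
      · exact Or.inr (Or.inl ⟨h1, r.trans (r.symm h') h2⟩)
      · exact Or.inl (r.trans h1 (r.trans (r.trans (r.symm h1') h2) (r.symm h2')))
      · exact Or.inl (r.trans h1 (r.symm h2'))
      · exact Or.inr (Or.inr ⟨h1, r.trans (r.symm h') h2⟩)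
      · exact Or.inl (r.trans h1 (r.symm h2'))
      · exact Or.inl (r.trans h1 (r.trans (r.trans (r.symm h1') h2) (r.symm h2')))

theorem le_joinPair {α : Type*} (r : Setoid α) (a b : α) : r ≤ joinPair r a b :=
  fun _ _ h => Or.inl h

theorem joinPair_rel {α : Type*} (r : Setoid α) (a b : α) : joinPair r a b a b :=
  Or.inr (Or.inl ⟨r.refl a, r.refl b⟩)

theorem joinPair_le {α : Type*} {r s : Setoid α} {a b : α} (h : r ≤ s) (hab : s a b) :
    joinPair r a b ≤ s := by
  rintro x y (h' | ⟨h1, h2⟩ | ⟨h1, h2⟩)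
  · exact h h'
  · exact s.trans (h h1) (s.trans hab (s.symm (h h2)))
  · exact s.trans (h h1) (s.trans (s.symm hab) (s.symm (h h2)))

theorem joinPair_eq_self {α : Type*} {r : Setoid α} {a b : α} (h : r a b) : joinPair r a b = r :=
  le_antisymm (joinPair_le le_rfl h) (le_joinPair r a b)

theorem card_quotient_mono {α : Type*} [Finite α] {r s : Setoid α} (h : r ≤ s) :
    Nat.card (Quotient s) ≤ Nat.card (Quotient r) :=
  Nat.card_le_card_of_surjective (Quotient.map' id fun _ _ h' => h h')
    (by rintro ⟨x⟩; exact ⟨Quotient.mk'' x, rfl⟩)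

/-- The classes of the join correspond to the old classes other than that of `a`. -/
theorem card_quotient_joinPair {α : Type*} [Finite α] {r : Setoid α} {a b : α} (h : ¬ r a b) :
    Nat.card (Quotient (joinPair r a b)) + 1 = Nat.card (Quotient r) := by
  classical
  have e : {q : Quotient r // q ≠ Quotient.mk r a} ≃ Quotient (joinPair r a b) := by
    refine Equiv.ofBijective
      (fun q => Quotient.map' id (fun _ _ h' => le_joinPair r a b h') q.1) ⟨?_, ?_⟩
    · rintro ⟨⟨x⟩, hx⟩ ⟨⟨y⟩, hy⟩ hxy
      have hx : ¬ r x a := fun h => hx (Quotient.sound h)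
      have hy : ¬ r y a := fun h => hy (Quotient.sound h)
      have hxy : joinPair r a b x y := Quotient.exact hxy
      rcases hxy with h' | ⟨h1, -⟩ | ⟨-, h2⟩
      · exact Subtype.ext (Quotient.sound h')
      · exact absurd h1 hx
      · exact absurd h2 hy
    · rintro ⟨x⟩
      by_cases hx : r x a
      · refine ⟨⟨Quotient.mk r b, fun hb => h (r.symm (Quotient.exact hb))⟩, ?_⟩
        exact Quotient.sound (Or.inr (Or.inr ⟨r.refl b, hx⟩))
      · exact ⟨⟨Quotient.mk r x, fun hb => hx (Quotient.exact hb)⟩, rfl⟩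
  have := Fintype.ofFinite (Quotient r)
  rw [← Nat.card_congr e, Nat.card_eq_fintype_card, Nat.card_eq_fintype_card,
    Fintype.card_subtype_compl, Fintype.card_subtype_eq]
  have : 0 < Fintype.card (Quotient r) := Fintype.card_pos_iff.2 ⟨Quotient.mk r a⟩
  omega

theorem card_quotient_le_joinPair {α : Type*} [Finite α] (r : Setoid α) (a b : α) :
    Nat.card (Quotient r) ≤ Nat.card (Quotient (joinPair r a b)) + 1 := by
  by_cases h : r a b
  · rw [joinPair_eq_self h]
    omega
  · exact (card_quotient_joinPair h).ge

theorem sameCycle_setoid_le_iff {α : Type*} {σ : Perm α} {s : Setoid α} :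
    Perm.SameCycle.setoid σ ≤ s ↔ ∀ x, s x (σ x) := by
  constructor
  · intro h x
    exact h (show σ.SameCycle x (σ x) from ⟨1, by simp⟩)
  · rintro h x y ⟨i, rfl⟩
    have hn : ∀ (n : ℕ) x, s x ((σ ^ n) x) := by
      intro n
      induction n with
      | zero => intro x; exact s.refl x
      | succ n ih =>
        intro x
        rw [pow_succ', Perm.mul_apply]
        exact s.trans (ih x) (h _)
    rcases i with n | n
    · exact hn n x
    · have := hn (n + 1) ((σ ^ (Int.negSucc n)) x)
      rw [← Perm.mul_apply, zpow_negSucc, mul_inv_cancel, Perm.one_apply] at this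
      rw [zpow_negSucc]
      exact s.symm this

theorem sameCycle_setoid_apply {α : Type*} (σ : Perm α) (x : α) :
    Perm.SameCycle.setoid σ x (σ x) :=
  sameCycle_setoid_le_iff.1 le_rfl x

theorem setoid_swap_mul_le {α : Type*} [DecidableEq α] (σ : Perm α) (a b : α) :
    Perm.SameCycle.setoid (swap a b * σ) ≤ joinPair (Perm.SameCycle.setoid σ) a b := by
  rw [sameCycle_setoid_le_iff]
  intro x
  have h := le_joinPair _ a b (sameCycle_setoid_apply σ x)
  have hab := joinPair_rel (Perm.SameCycle.setoid σ) a b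
  rw [Perm.mul_apply]
  rcases eq_or_ne (σ x) a with ha | ha
  · rw [ha, swap_apply_left]
    exact Setoid.trans' _ (ha ▸ h) hab
  · rcases eq_or_ne (σ x) b with hb | hb
    · rw [hb, swap_apply_right]
      exact Setoid.trans' _ (hb ▸ h) (Setoid.symm' _ hab)
    · rwa [swap_apply_of_ne_of_ne ha hb]

theorem setoid_swap_mul {α : Type*} [DecidableEq α] [Finite α] {σ : Perm α} {a b : α}
    (h : ¬ σ.SameCycle a b) :
    Perm.SameCycle.setoid (swap a b * σ) = joinPair (Perm.SameCycle.setoid σ) a b := by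
  refine le_antisymm (setoid_swap_mul_le σ a b) ?_
  set s := Perm.SameCycle.setoid (swap a b * σ) with hs
  have hstep : ∀ x, s x (swap a b (σ x)) := fun x => sameCycle_setoid_apply (swap a b * σ) x
  have hpow : ∃ k : ℕ, 0 < k ∧ (σ ^ k) a = a :=
    ⟨orderOf σ, orderOf_pos σ, by rw [pow_orderOf_eq_one]; rfl⟩
  classical
  -- Follow σ from `a` until its first return. The path avoids `b`, so the swap changes only the
  -- last step, sending it to `b` instead of `a`.
  have hab : s a b := by
    obtain ⟨hk, hka⟩ := Nat.find_spec hpow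
    have hmin : ∀ j, 0 < j → j < Nat.find hpow → (σ ^ j) a ≠ a :=
      fun j hj hjk hja => Nat.find_min hpow hjk ⟨hj, hja⟩
    generalize Nat.find hpow = k at *
    have hb : ∀ j : ℕ, (σ ^ j) a ≠ b := fun j hj => h ⟨j, by simpa using hj⟩
    have hj : ∀ j < k, s a ((σ ^ j) a) := by
      intro j
      induction j with
      | zero => intro _; exact s.refl a
      | succ j ih =>
        intro hjk
        have h1 := hstep ((σ ^ j) a)
        rw [← Perm.mul_apply σ, ← pow_succ',
          swap_apply_of_ne_of_ne (hmin _ (Nat.succ_pos _) hjk) (hb _)] at h1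
        exact s.trans (ih (by omega)) h1
    have h1 := hstep ((σ ^ (k - 1)) a)
    rw [← Perm.mul_apply σ, ← pow_succ', Nat.sub_add_cancel hk, hka, swap_apply_left] at h1
    exact s.trans (hj (k - 1) (by omega)) h1
  refine joinPair_le (sameCycle_setoid_le_iff.2 fun x => ?_) hab
  have h1 := hstep x
  rcases eq_or_ne (σ x) a with ha | ha
  · rw [ha, swap_apply_left] at h1
    rw [ha]
    exact s.trans h1 (s.symm hab)
  · rcases eq_or_ne (σ x) b with hb | hb
    · rw [hb, swap_apply_right] at h1
      rw [hb]
      exact s.trans h1 hab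
    · rwa [swap_apply_of_ne_of_ne ha hb] at h1

/-- The number of cycles of a permutation of a finite type, fixed points included. -/
noncomputable def cycleCount {α : Type*} (σ : Perm α) : ℕ :=
  Nat.card (Quotient (Perm.SameCycle.setoid σ))

theorem cycleCount_swap_mul {α : Type*} [DecidableEq α] [Finite α] {σ : Perm α} {a b : α}
    (h : ¬ σ.SameCycle a b) : cycleCount (swap a b * σ) + 1 = cycleCount σ := by
  rw [cycleCount, setoid_swap_mul h]
  exact card_quotient_joinPair h

/-- Apply the comparison to `swap a b * σ`: multiplying by the swap again restores σ, and joining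
two classes loses at most one. -/
theorem cycleCount_swap_mul_le {α : Type*} [DecidableEq α] [Finite α] (σ : Perm α) (a b : α) :
    cycleCount (swap a b * σ) ≤ cycleCount σ + 1 := by
  have h := setoid_swap_mul_le (swap a b * σ) a b
  rw [← mul_assoc, swap_mul_self, one_mul] at h
  exact (card_quotient_le_joinPair _ a b).trans (Nat.add_le_add_right (card_quotient_mono h) 1)

/-- The setoid of orbits of the group generated by two permutations. -/
def orbitSetoid {α : Type*} (σ τ : Perm α) : Setoid α :=
  Perm.SameCycle.setoid σ ⊔ Perm.SameCycle.setoid τ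

theorem orbitSetoid_le_iff {α : Type*} {σ τ : Perm α} {s : Setoid α} :
    orbitSetoid σ τ ≤ s ↔ (∀ x, s x (σ x)) ∧ ∀ x, s x (τ x) := by
  rw [orbitSetoid, sup_le_iff, sameCycle_setoid_le_iff, sameCycle_setoid_le_iff]

theorem orbitSetoid_left {α : Type*} (σ τ : Perm α) (x : α) : orbitSetoid σ τ x (σ x) :=
  (orbitSetoid_le_iff.1 le_rfl).1 x

theorem orbitSetoid_right {α : Type*} (σ τ : Perm α) (x : α) : orbitSetoid σ τ x (τ x) :=
  (orbitSetoid_le_iff.1 le_rfl).2 x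

theorem setoid_mul_le_orbitSetoid {α : Type*} (σ τ : Perm α) :
    Perm.SameCycle.setoid (τ * σ) ≤ orbitSetoid σ τ :=
  sameCycle_setoid_le_iff.2 fun x =>
    Setoid.trans' _ (orbitSetoid_left σ τ x) (orbitSetoid_right σ τ (σ x))

theorem cycleCount_one {α : Type*} [Fintype α] :
    cycleCount (1 : Perm α) = Fintype.card α := by
  rw [← Nat.card_eq_fintype_card]
  refine Nat.card_congr (Equiv.ofBijective (Quotient.mk _) ⟨?_, ?_⟩).symm
  · intro x y h
    obtain ⟨i, hi⟩ : (1 : Perm α).SameCycle x y := Quotient.exact h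
    simpa using hi
  · rintro ⟨x⟩
    exact ⟨x, rfl⟩

/-- The genus inequality for a pair of permutations. -/
theorem genus_inequality {α : Type*} [DecidableEq α] [Fintype α] (σ τ : Perm α) :
    cycleCount σ + cycleCount τ + cycleCount (τ * σ)
      ≤ Fintype.card α + 2 * Nat.card (Quotient (orbitSetoid σ τ)) := by
  induction hn : τ.support.card using Nat.strong_induction_on generalizing τ with
  | _ n ih =>
  by_cases hτ : τ = 1
  · subst hτ
    have : orbitSetoid σ 1 = Perm.SameCycle.setoid σ :=
      le_antisymm (orbitSetoid_le_iff.2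
        ⟨fun x => sameCycle_setoid_apply σ x, fun x => Setoid.refl' _ x⟩) le_sup_left
    rw [this, cycleCount_one, one_mul, cycleCount]
    omega
  · obtain ⟨a, ha⟩ : ∃ a, τ a ≠ a := by
      by_contra! h
      exact hτ (Equiv.ext h)
    -- `τ₀` fixes `a`, so its support is smaller, and τ arises from it by merging the fixed point
    -- `a` into the cycle of `τ a`.
    set τ₀ := swap a (τ a) * τ with hτ₀
    have hlt : τ₀.support.card < n := hn ▸ Perm.card_support_swap_mul ha
    have key := ih _ hlt τ₀ rfl
    have hτeq : τ = swap a (τ a) * τ₀ := by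
      rw [hτ₀, ← mul_assoc, swap_mul_self, one_mul]
    have hfix : τ₀ a = a := by simp [hτ₀]
    generalize τ a = b at *
    have hns : ¬ τ₀.SameCycle a b := by
      rintro ⟨i, hi⟩
      rw [Perm.zpow_apply_eq_self_of_apply_eq_self hfix] at hi
      exact ha hi.symm
    have hc := cycleCount_swap_mul hns
    rw [← hτeq] at hc
    have hsc := setoid_swap_mul hns
    rw [← hτeq] at hsc
    have horb : orbitSetoid σ τ = joinPair (orbitSetoid σ τ₀) a b := by
      apply le_antisymm
      · refine sup_le (le_sup_left.trans (le_joinPair _ a b)) ?_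
        rw [hsc]
        exact joinPair_le (le_sup_right.trans (le_joinPair _ a b)) (joinPair_rel _ a b)
      · refine joinPair_le (sup_le le_sup_left (le_trans ?_ le_sup_right)) ?_
        · rw [hsc]
          exact le_joinPair _ a b
        · have : Perm.SameCycle.setoid τ a b := hsc ▸ joinPair_rel _ a b
          exact (le_sup_right : _ ≤ orbitSetoid σ τ) this
    have hprod : τ * σ = swap a b * (τ₀ * σ) := by rw [hτeq, mul_assoc]
    rw [horb, hprod]
    -- Passing from `τ₀` to τ costs one cycle of τ. Within one orbit the product gains at most one
    -- cycle. Across two orbits the product loses one as well, and the right-hand side drops by 2.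
    by_cases h : orbitSetoid σ τ₀ a b
    · rw [joinPair_eq_self h]
      have := cycleCount_swap_mul_le (τ₀ * σ) a b
      omega
    · have h1 := card_quotient_joinPair h
      have h2 : ¬ (τ₀ * σ).SameCycle a b := fun h' => h (setoid_mul_le_orbitSetoid σ τ₀ h')
      have h3 := cycleCount_swap_mul h2
      omega

/-- The group generated by `σ` and `τ` acts transitively. -/
def TransitivePair {α : Type*} (σ τ : Perm α) : Prop :=
  MulAction.IsPretransitive (Subgroup.closure ({σ, τ} : Set (Perm α))) α

theorem transitivePair_iff {α : Type*} {σ τ : Perm α} :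
    TransitivePair σ τ ↔ orbitSetoid σ τ = ⊤ := by
  constructor
  · intro h
    refine top_le_iff.1 fun x y _ => ?_
    obtain ⟨⟨g, hg⟩, hgx⟩ := h.exists_smul_eq x y
    rw [← hgx]
    have : ∀ x, orbitSetoid σ τ x (g x) := by
      clear hgx
      induction hg using Subgroup.closure_induction with
      | mem g hg =>
        rcases hg with rfl | rfl
        · exact orbitSetoid_left _ _
        · exact orbitSetoid_right _ _
      | one => exact fun x => Setoid.refl' _ x
      | mul g g' _ _ h h' => exact fun x => Setoid.trans' _ (h' x) (h (g' x))
      | inv g _ h =>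
        intro x
        have := h (g⁻¹ x)
        rw [← Perm.mul_apply, mul_inv_cancel, Perm.one_apply] at this
        exact Setoid.symm' _ this
    exact this x
  · intro h
    have hle : orbitSetoid σ τ ≤ MulAction.orbitRel (Subgroup.closure ({σ, τ} : Set (Perm α))) α := by
      refine orbitSetoid_le_iff.2 ⟨fun x => ?_, fun x => ?_⟩
      · exact Setoid.symm' _ ⟨⟨σ, Subgroup.subset_closure (by simp)⟩, rfl⟩
      · exact Setoid.symm' _ ⟨⟨τ, Subgroup.subset_closure (by simp)⟩, rfl⟩
    rw [h] at hle
    refine ⟨fun x y => ?_⟩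
    exact hle (show (⊤ : Setoid α) y x from trivial)

theorem card_quotient_top {α : Type*} [Nonempty α] : Nat.card (Quotient (⊤ : Setoid α)) = 1 := by
  rw [Nat.card_eq_one_iff_unique]
  refine ⟨⟨?_⟩, ⟨Quotient.mk _ (Classical.arbitrary α)⟩⟩
  rintro ⟨x⟩ ⟨y⟩
  exact Quotient.sound trivial

theorem cycleCount_pos {α : Type*} [Finite α] [Nonempty α] (σ : Perm α) : 0 < cycleCount σ := by
  have : Nonempty (Quotient (Perm.SameCycle.setoid σ)) := ⟨Quotient.mk _ (Classical.arbitrary α)⟩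
  exact Nat.card_pos

theorem TransitivePair.genus_le {α : Type*} [DecidableEq α] [Fintype α] [Nonempty α]
    {σ τ : Perm α} (h : TransitivePair σ τ) :
    cycleCount σ + cycleCount τ + cycleCount (τ * σ) ≤ Fintype.card α + 2 := by
  have := genus_inequality σ τ
  rwa [transitivePair_iff.1 h, card_quotient_top] at this

theorem TransitivePair.cycleCount_add_le {α : Type*} [DecidableEq α] [Fintype α] [Nonempty α]
    {σ τ : Perm α} (h : TransitivePair σ τ) :
    cycleCount σ + cycleCount τ ≤ Fintype.card α + 1 := by
  have := h.genus_le
  have := cycleCount_pos (τ * σ)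
  omega

/-! ### Cycle lengths -/

/-- The multiset of cycle lengths, fixed points included. -/
def cycleLengths {α : Type*} [DecidableEq α] [Fintype α] (σ : Perm α) : Multiset ℕ :=
  σ.partition.parts

theorem cycleLengths_eq {α : Type*} [DecidableEq α] [Fintype α] (σ : Perm α) :
    cycleLengths σ = σ.cycleType + Multiset.replicate (Fintype.card α - σ.support.card) 1 :=
  Perm.parts_partition

theorem sum_cycleLengths {α : Type*} [DecidableEq α] [Fintype α] (σ : Perm α) :
    (cycleLengths σ).sum = Fintype.card α :=
  σ.partition.parts_sum

theorem cycleType_permCongr {α β : Type*} [DecidableEq α] [Fintype α] [DecidableEq β] [Fintype β]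
    (e : α ≃ β) (σ : Perm α) : (e.permCongr σ).cycleType = σ.cycleType := by
  have : e.permCongr σ = σ.extendDomain (p := fun _ => True)
      (e.trans (Equiv.subtypeUnivEquiv (fun _ => trivial)).symm) := by
    ext x
    obtain ⟨y, rfl⟩ := e.surjective x
    rw [show e y = ((e.trans (Equiv.subtypeUnivEquiv (fun _ => trivial)).symm y :
      {_x : β // True}) : β) from rfl, Perm.extendDomain_apply_image]
    simp
  rw [this, Perm.cycleType_extendDomain]

theorem cycleLengths_permCongr {α β : Type*} [DecidableEq α] [Fintype α] [DecidableEq β]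
    [Fintype β] (e : α ≃ β) (σ : Perm α) : cycleLengths (e.permCongr σ) = cycleLengths σ := by
  rw [cycleLengths_eq, cycleLengths_eq, ← Perm.sum_cycleType, ← Perm.sum_cycleType,
    cycleType_permCongr, Fintype.card_congr e]

theorem cycleType_sumCongr_one {α β : Type*} [DecidableEq α] [Fintype α] [DecidableEq β]
    [Fintype β] (σ : Perm α) :
    (Perm.sumCongr σ (1 : Perm β)).cycleType = σ.cycleType := by
  have : Perm.sumCongr σ (1 : Perm β) = σ.extendDomain
      (Equiv.ofInjective (Sum.inl : α → α ⊕ β) Sum.inl_injective) := by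
    ext x
    rcases x with x | x
    · rw [show (Sum.inl x : α ⊕ β) = (Equiv.ofInjective (Sum.inl : α → α ⊕ β) Sum.inl_injective x)
        from rfl, Perm.extendDomain_apply_image]
      simp
    · rw [Perm.extendDomain_apply_not_subtype _ _ (by simp)]
      simp
  rw [this, Perm.cycleType_extendDomain]

theorem cycleType_one_sumCongr {α β : Type*} [DecidableEq α] [Fintype α] [DecidableEq β]
    [Fintype β] (τ : Perm β) :
    (Perm.sumCongr (1 : Perm α) τ).cycleType = τ.cycleType := by
  rw [← cycleType_sumCongr_one (β := α) τ, ← cycleType_permCongr (Equiv.sumComm β α)]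
  congr 1
  ext x
  rcases x with x | x <;> simp

theorem cycleType_sumCongr {α β : Type*} [DecidableEq α] [Fintype α] [DecidableEq β]
    [Fintype β] (σ : Perm α) (τ : Perm β) :
    (Perm.sumCongr σ τ).cycleType = σ.cycleType + τ.cycleType := by
  have h : Perm.sumCongr σ τ = Perm.sumCongr σ 1 * Perm.sumCongr 1 τ := by
    rw [Perm.sumCongr_mul, mul_one, one_mul]
  rw [h, Perm.Disjoint.cycleType_mul, cycleType_sumCongr_one, cycleType_one_sumCongr]
  intro x
  rcases x with x | x <;> simp

theorem cycleLengths_sumCongr {α β : Type*} [DecidableEq α] [Fintype α] [DecidableEq β]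
    [Fintype β] (σ : Perm α) (τ : Perm β) :
    cycleLengths (Perm.sumCongr σ τ) = cycleLengths σ + cycleLengths τ := by
  simp only [cycleLengths_eq, ← Perm.sum_cycleType, cycleType_sumCongr, Fintype.card_sum,
    Multiset.sum_add]
  have h1 := Perm.sum_cycleType_le σ
  have h2 := Perm.sum_cycleType_le τ
  rw [show Fintype.card α + Fintype.card β - (σ.cycleType.sum + τ.cycleType.sum)
    = (Fintype.card α - σ.cycleType.sum) + (Fintype.card β - τ.cycleType.sum) by omega,
    Multiset.replicate_add]
  abel

theorem card_cycleLengths {α : Type*} [DecidableEq α] [Fintype α] (σ : Perm α) :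
    Multiset.card (cycleLengths σ) = cycleCount σ := by
  classical
  -- A label for each cycle: the cycle factor through the point, or the point itself if it is fixed.
  -- Mathlib's `cycleType` omits fixed points, hence the two cases.
  set F : α → Perm α ⊕ α := fun x => if σ x = x then Sum.inr x else Sum.inl (σ.cycleOf x) with hF
  have hker : Perm.SameCycle.setoid σ = Setoid.ker F := by
    ext x y
    change σ.SameCycle x y ↔ F x = F y
    by_cases hx : σ x = x <;> by_cases hy : σ y = y
    · simp only [hF, if_pos hx, if_pos hy, Sum.inr.injEq]
      refine ⟨?_, fun h => h ▸ Perm.SameCycle.refl σ x⟩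
      rintro ⟨i, rfl⟩
      exact (Perm.zpow_apply_eq_self_of_apply_eq_self hx i).symm
    · simp only [hF, if_pos hx, if_neg hy, reduceCtorEq, iff_false]
      exact fun h => hy (h.apply_eq_self_iff.1 hx)
    · simp only [hF, if_neg hx, if_pos hy, reduceCtorEq, iff_false]
      exact fun h => hx (h.apply_eq_self_iff.2 hy)
    · simp only [hF, if_neg hx, if_neg hy, Sum.inl.injEq]
      exact Perm.sameCycle_iff_cycleOf_eq_of_mem_support (Perm.mem_support.2 hx)
        (Perm.mem_support.2 hy)
  have himg : Finset.univ.image F = σ.cycleFactorsFinset.disjSum σ.supportᶜ := by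
    ext y
    simp only [Finset.mem_image, Finset.mem_univ, true_and]
    rcases y with c | y
    · rw [Finset.inl_mem_disjSum]
      constructor
      · rintro ⟨x, hx⟩
        by_cases h : σ x = x
        · simp [hF, h] at hx
        · simp only [hF, if_neg h, Sum.inl.injEq] at hx
          rw [← hx]
          exact Perm.cycleOf_mem_cycleFactorsFinset_iff.2 (Perm.mem_support.2 h)
      · intro hc
        obtain ⟨x, hx⟩ := (Perm.mem_cycleFactorsFinset_iff.1 hc).1.nonempty_support
        have hx' : x ∈ σ.support := Perm.mem_cycleFactorsFinset_support_le hc hx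
        refine ⟨x, ?_⟩
        simp only [hF, if_neg (Perm.mem_support.1 hx'), Sum.inl.injEq]
        exact (Perm.cycle_is_cycleOf hx hc).symm
    · rw [Finset.inr_mem_disjSum, Finset.mem_compl, Perm.mem_support, not_not]
      constructor
      · rintro ⟨x, hx⟩
        by_cases h : σ x = x
        · simp only [hF, if_pos h, Sum.inr.injEq] at hx
          exact hx ▸ h
        · simp [hF, h] at hx
      · intro h
        exact ⟨y, by simp [hF, h]⟩
  have hcard : cycleCount σ = (Finset.univ.image F).card := by
    rw [cycleCount, hker, Nat.card_congr (Setoid.quotientKerEquivRange F), ← Set.image_univ,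
      ← Finset.coe_univ, ← Finset.coe_image, Nat.card_eq_card_toFinset, Finset.toFinset_coe]
  rw [hcard, himg, Finset.card_disjSum, Finset.card_compl, cycleLengths_eq, Multiset.card_add,
    Multiset.card_replicate, Perm.cycleType_def, Multiset.card_map, Finset.card_val]

theorem sign_eq_pow_cycleCount {α : Type*} [DecidableEq α] [Fintype α] (σ : Perm α) :
    Perm.sign σ = (-1) ^ (Fintype.card α + cycleCount σ) := by
  have h := Perm.sum_cycleType_le σ
  rw [Perm.sign_of_cycleType, ← card_cycleLengths, cycleLengths_eq, Multiset.card_add,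
    Multiset.card_replicate, ← Perm.sum_cycleType]
  have : Fintype.card α + (Multiset.card σ.cycleType + (Fintype.card α - σ.cycleType.sum))
      = (σ.cycleType.sum + Multiset.card σ.cycleType)
        + 2 * (Fintype.card α - σ.cycleType.sum) := by omega
  rw [this, pow_add _ _ (2 * _), pow_mul]
  simp

/-- Multiplicativity of the sign. Together with the genus inequality it determines the number of
cycles of the product. -/
theorem even_cycleCount {α : Type*} [DecidableEq α] [Fintype α] (σ τ : Perm α) :
    Even (Fintype.card α + cycleCount σ + cycleCount τ + cycleCount (τ * σ)) := by
  have h := Perm.sign_mul τ σ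
  simp only [sign_eq_pow_cycleCount] at h
  rw [← pow_add] at h
  by_contra hodd
  rw [Nat.not_even_iff_odd] at hodd
  rcases neg_one_pow_eq_or ℤˣ (Fintype.card α + cycleCount (τ * σ)) with h1 | h1
  · rw [h1] at h
    have e1 := (neg_one_pow_eq_one_iff_even (by decide : (-1 : ℤˣ) ≠ 1)).1 h1
    have e2 := (neg_one_pow_eq_one_iff_even (by decide : (-1 : ℤˣ) ≠ 1)).1 h.symm
    rw [Nat.even_iff] at e1 e2
    rw [Nat.odd_iff] at hodd
    omega
  · rw [h1] at h
    have e1 : Odd (Fintype.card α + cycleCount (τ * σ)) := by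
      by_contra hne
      rw [Nat.not_odd_iff_even] at hne
      rw [hne.neg_one_pow] at h1
      exact absurd h1 (by decide)
    have e2 : Odd (Fintype.card α + cycleCount τ + (Fintype.card α + cycleCount σ)) := by
      by_contra hne
      rw [Nat.not_odd_iff_even] at hne
      rw [hne.neg_one_pow] at h
      exact absurd h (by decide)
    rw [Nat.odd_iff] at e1 e2 hodd
    omega

/-! ### Decomposition of pairs of permutations into orbits -/

/-- A weight on pairs of permutations of finite types. -/
abbrev PairWeight : Type 1 := ∀ (α : Type) [DecidableEq α] [Fintype α], Perm α → Perm α → ℝ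

/-- The weight is invariant under relabelling and multiplicative on disjoint unions. -/
structure PairWeight.IsMultiplicative (W : PairWeight) : Prop where
  congr : ∀ (α β : Type) [DecidableEq α] [Fintype α] [DecidableEq β] [Fintype β] (e : α ≃ β)
    (σ τ : Perm α), W β (e.permCongr σ) (e.permCongr τ) = W α σ τ
  sum : ∀ (α β : Type) [DecidableEq α] [Fintype α] [DecidableEq β] [Fintype β]
    (σ τ : Perm α) (σ' τ' : Perm β),
    W (α ⊕ β) (Perm.sumCongr σ σ') (Perm.sumCongr τ τ') = W α σ τ * W β σ' τ'

/-- The sum of the weights of all pairs. -/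
noncomputable def pairSum (W : PairWeight) (α : Type) [DecidableEq α] [Fintype α] : ℝ :=
  ∑ p : Perm α × Perm α, W α p.1 p.2

open scoped Classical in
/-- The sum of the weights of all transitive pairs. -/
noncomputable def transSum (W : PairWeight) (α : Type) [DecidableEq α] [Fintype α] : ℝ :=
  ∑ p : Perm α × Perm α with TransitivePair p.1 p.2, W α p.1 p.2

theorem TransitivePair.permCongr {α β : Type*} (e : α ≃ β) {σ τ : Perm α}
    (h : TransitivePair σ τ) : TransitivePair (e.permCongr σ) (e.permCongr τ) := by
  rw [transitivePair_iff] at h ⊢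
  have hle : orbitSetoid σ τ ≤ (orbitSetoid (e.permCongr σ) (e.permCongr τ)).comap e := by
    refine orbitSetoid_le_iff.2 ⟨fun x => ?_, fun x => ?_⟩
    · have := orbitSetoid_left (e.permCongr σ) (e.permCongr τ) (e x)
      rw [Equiv.permCongr_apply, e.symm_apply_apply] at this
      exact this
    · have := orbitSetoid_right (e.permCongr σ) (e.permCongr τ) (e x)
      rw [Equiv.permCongr_apply, e.symm_apply_apply] at this
      exact this
  rw [h] at hle
  refine top_le_iff.1 fun x y _ => ?_
  have := hle (show (⊤ : Setoid α) (e.symm x) (e.symm y) from trivial)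
  rwa [Setoid.comap_rel, e.apply_symm_apply, e.apply_symm_apply] at this

theorem transitivePair_permCongr {α β : Type*} (e : α ≃ β) {σ τ : Perm α} :
    TransitivePair (e.permCongr σ) (e.permCongr τ) ↔ TransitivePair σ τ := by
  refine ⟨fun h => ?_, fun h => h.permCongr e⟩
  have := h.permCongr e.symm
  rw [← Equiv.permCongr_symm, Equiv.symm_apply_apply, Equiv.symm_apply_apply] at this
  exact this

theorem pairSum_congr {W : PairWeight} (hW : W.IsMultiplicative) {α β : Type} [DecidableEq α]
    [Fintype α] [DecidableEq β] [Fintype β] (e : α ≃ β) : pairSum W α = pairSum W β :=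
  Fintype.sum_equiv (e.permCongr.prodCongr e.permCongr) _ _ fun p => (hW.congr α β e p.1 p.2).symm

theorem transSum_congr {W : PairWeight} (hW : W.IsMultiplicative) {α β : Type} [DecidableEq α]
    [Fintype α] [DecidableEq β] [Fintype β] (e : α ≃ β) : transSum W α = transSum W β := by
  classical
  refine Finset.sum_equiv (e.permCongr.prodCongr e.permCongr) (fun p => ?_)
    fun p _ => (hW.congr α β e p.1 p.2).symm
  simp [transitivePair_permCongr]

open scoped Classical in
/-- The orbit of `x` under the group generated by two permutations. -/
noncomputable def orbitFinset {α : Type*} [Fintype α] (x : α) (p : Perm α × Perm α) : Finset α :=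
  Finset.univ.filter fun y => orbitSetoid p.1 p.2 x y

theorem mem_orbitFinset {α : Type*} [Fintype α] {x y : α} {p : Perm α × Perm α} :
    y ∈ orbitFinset x p ↔ orbitSetoid p.1 p.2 x y := by
  classical
  simp [orbitFinset]

/-- Glued permutations preserve `S`, so the orbit of `x` stays inside `S` and depends only on the
parts on `S`. -/
theorem orbitFinset_subtypeCongr {α : Type*} [Fintype α] [DecidableEq α] (S : Finset α) {x : α}
    (hx : x ∈ S) (σ τ : Perm {y // y ∈ S}) (σ' τ' : Perm {y // y ∉ S}) :
    orbitFinset x (Perm.subtypeCongr σ σ', Perm.subtypeCongr τ τ') = S ↔ TransitivePair σ τ := by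
  have e1 : ∀ (ρ : Perm {y // y ∈ S}) (ρ' : Perm {y // y ∉ S}) (y : α) (hy : y ∈ S),
      Perm.subtypeCongr ρ ρ' y = ρ ⟨y, hy⟩ := fun ρ ρ' y hy =>
    Perm.subtypeCongr.left_apply ρ ρ' hy
  have e2 : ∀ (ρ : Perm {y // y ∈ S}) (ρ' : Perm {y // y ∉ S}) (y : α) (hy : y ∉ S),
      Perm.subtypeCongr ρ ρ' y = ρ' ⟨y, hy⟩ := fun ρ ρ' y hy =>
    Perm.subtypeCongr.right_apply ρ ρ' hy
  set ρ₁ := Perm.subtypeCongr σ σ' with hρ₁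
  set ρ₂ := Perm.subtypeCongr τ τ' with hρ₂
  rw [transitivePair_iff]
  constructor
  · intro h
    -- The orbit relation on `S`, with the complement as one extra class. Both glued permutations
    -- preserve it, so it contains their orbits.
    let s : Setoid α :=
      { r := fun y z => (y ∈ S ↔ z ∈ S) ∧
          ∀ (hy : y ∈ S) (hz : z ∈ S), orbitSetoid σ τ ⟨y, hy⟩ ⟨z, hz⟩
        iseqv := by
          refine ⟨fun y => ⟨Iff.rfl, fun _ _ => Setoid.refl' _ _⟩, ?_, ?_⟩
          · rintro y z ⟨h1, h2⟩
            exact ⟨h1.symm, fun hz hy => Setoid.symm' _ (h2 hy hz)⟩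
          · rintro y z w ⟨h1, h2⟩ ⟨h1', h2'⟩
            exact ⟨h1.trans h1', fun hy hw =>
              Setoid.trans' _ (h2 hy (h1.1 hy)) (h2' (h1.1 hy) hw)⟩ }
    have hstep : ∀ (ρ : Perm {y // y ∈ S}) (ρ' : Perm {y // y ∉ S}),
        (∀ y, orbitSetoid σ τ y (ρ y)) → ∀ y, s y (Perm.subtypeCongr ρ ρ' y) := by
      intro ρ ρ' hρ y
      by_cases hy : y ∈ S
      · rw [e1 ρ ρ' y hy]
        exact ⟨⟨fun _ => (ρ ⟨y, hy⟩).2, fun _ => hy⟩, fun _ _ => hρ ⟨y, hy⟩⟩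
      · rw [e2 ρ ρ' y hy]
        exact ⟨⟨fun h => absurd h hy, fun h => absurd h (ρ' ⟨y, hy⟩).2⟩, fun h => absurd h hy⟩
    have hle : orbitSetoid ρ₁ ρ₂ ≤ s := orbitSetoid_le_iff.2
      ⟨hstep σ σ' (orbitSetoid_left σ τ), hstep τ τ' (orbitSetoid_right σ τ)⟩
    have hxy : ∀ y (hy : y ∈ S), orbitSetoid σ τ ⟨x, hx⟩ ⟨y, hy⟩ := by
      intro y hy
      have : y ∈ orbitFinset x (ρ₁, ρ₂) := by rw [h]; exact hy
      exact (hle (mem_orbitFinset.1 this)).2 hx hy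
    refine top_le_iff.1 fun y z _ => ?_
    exact Setoid.trans' _ (Setoid.symm' _ (hxy y y.2)) (hxy z z.2)
  · intro h
    ext y
    rw [mem_orbitFinset]
    constructor
    · intro hy
      have hle : orbitSetoid ρ₁ ρ₂ ≤ Setoid.ker (fun z => z ∈ S) := by
        have hstep : ∀ (ρ : Perm {y // y ∈ S}) (ρ' : Perm {y // y ∉ S}) (y : α),
            (y ∈ S) = (Perm.subtypeCongr ρ ρ' y ∈ S) := by
          intro ρ ρ' y
          by_cases hy : y ∈ S
          · rw [e1 ρ ρ' y hy]
            exact propext ⟨fun _ => (ρ ⟨y, hy⟩).2, fun _ => hy⟩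
          · rw [e2 ρ ρ' y hy]
            exact propext ⟨fun h => absurd h hy, fun h => absurd h (ρ' ⟨y, hy⟩).2⟩
        exact orbitSetoid_le_iff.2 ⟨hstep σ σ', hstep τ τ'⟩
      have := hle hy
      rw [Setoid.ker_def] at this
      exact this ▸ hx
    · intro hy
      have hle : orbitSetoid σ τ ≤ (orbitSetoid ρ₁ ρ₂).comap Subtype.val := by
        refine orbitSetoid_le_iff.2 ⟨fun z => ?_, fun z => ?_⟩
        · have := orbitSetoid_left ρ₁ ρ₂ z
          rw [hρ₁, e1 σ σ' z z.2] at this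
          exact this
        · have := orbitSetoid_right ρ₁ ρ₂ z
          rw [hρ₂, e1 τ τ' z z.2] at this
          exact this
      rw [h] at hle
      exact hle (show (⊤ : Setoid {y // y ∈ S}) ⟨x, hx⟩ ⟨y, hy⟩ from trivial)

theorem exists_subtypeCongr_of_orbitFinset {α : Type*} [Fintype α] [DecidableEq α] {S : Finset α}
    {x : α} {p : Perm α × Perm α} (h : orbitFinset x p = S) :
    ∃ (σ τ : Perm {y // y ∈ S}) (σ' τ' : Perm {y // y ∉ S}),
      p = (Perm.subtypeCongr σ σ', Perm.subtypeCongr τ τ') := by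
  have key : ∀ ρ : Perm α, (∀ y, y ∈ S ↔ ρ y ∈ S) →
      ∃ (σ : Perm {y // y ∈ S}) (σ' : Perm {y // y ∉ S}), ρ = Perm.subtypeCongr σ σ' := by
    intro ρ hρ
    refine ⟨ρ.subtypePerm fun y => (hρ y).symm, ρ.subtypePerm fun y => not_congr (hρ y).symm, ?_⟩
    ext y
    by_cases hy : y ∈ S
    · rw [Perm.subtypeCongr.left_apply _ _ hy]
      rfl
    · rw [Perm.subtypeCongr.right_apply _ _ hy]
      rfl
  obtain ⟨σ, σ', h1⟩ := key p.1 fun y => by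
    rw [← h, mem_orbitFinset, mem_orbitFinset]
    have := orbitSetoid_left p.1 p.2 y
    exact ⟨fun h => Setoid.trans' _ h this, fun h => Setoid.trans' _ h (Setoid.symm' _ this)⟩
  obtain ⟨τ, τ', h2⟩ := key p.2 fun y => by
    rw [← h, mem_orbitFinset, mem_orbitFinset]
    have := orbitSetoid_right p.1 p.2 y
    exact ⟨fun h => Setoid.trans' _ h this, fun h => Setoid.trans' _ h (Setoid.symm' _ this)⟩
  exact ⟨σ, τ, σ', τ', Prod.ext h1 h2⟩

/-- Pairs with orbit `S` are exactly a transitive pair on `S` glued to an arbitrary pair on the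
complement, and the weight factors accordingly. -/
theorem sum_orbitFinset_eq {W : PairWeight} (hW : W.IsMultiplicative) {α : Type} [DecidableEq α]
    [Fintype α] (S : Finset α) {x : α} (hx : x ∈ S) :
    ∑ p : Perm α × Perm α with orbitFinset x p = S, W α p.1 p.2
      = transSum W {y // y ∈ S} * pairSum W {y // y ∉ S} := by
  classical
  rw [transSum, pairSum, Finset.sum_mul_sum, ← Finset.sum_product']
  symm
  refine Finset.sum_bij
    (fun q _ => (Perm.subtypeCongr q.1.1 q.2.1, Perm.subtypeCongr q.1.2 q.2.2)) ?_ ?_ ?_ ?_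
  · rintro ⟨⟨σ, τ⟩, ⟨σ', τ'⟩⟩ h
    simp only [Finset.mem_product, Finset.mem_filter, Finset.mem_univ, true_and, and_true] at h ⊢
    exact (orbitFinset_subtypeCongr S hx σ τ σ' τ').2 h
  · rintro ⟨⟨σ, τ⟩, ⟨σ', τ'⟩⟩ _ ⟨⟨ρ, υ⟩, ⟨ρ', υ'⟩⟩ _ e
    simp only [Prod.mk.injEq] at e
    have h1 := Perm.subtypeCongrHom_injective (fun y => y ∈ S)
      (a₁ := (σ, σ')) (a₂ := (ρ, ρ')) e.1
    have h2 := Perm.subtypeCongrHom_injective (fun y => y ∈ S)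
      (a₁ := (τ, τ')) (a₂ := (υ, υ')) e.2
    simp only [Prod.mk.injEq] at h1 h2
    simp [h1, h2]
  · intro p hp
    have hp : orbitFinset x p = S := by simpa using hp
    obtain ⟨σ, τ, σ', τ', rfl⟩ := exists_subtypeCongr_of_orbitFinset hp
    refine ⟨((σ, τ), (σ', τ')), ?_, rfl⟩
    simp only [Finset.mem_product, Finset.mem_filter, Finset.mem_univ, true_and, and_true]
    exact (orbitFinset_subtypeCongr S hx σ τ σ' τ').1 hp
  · rintro ⟨⟨σ, τ⟩, ⟨σ', τ'⟩⟩ _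
    rw [Perm.subtypeCongr, Perm.subtypeCongr, hW.congr, hW.sum]

/-- The exponential formula for pairs of permutations. -/
theorem pairSum_succ {W : PairWeight} (hW : W.IsMultiplicative) (n : ℕ) :
    pairSum W (Fin (n + 1)) = ∑ j ∈ Finset.range (n + 1),
      (n.choose j : ℝ) * transSum W (Fin (j + 1)) * pairSum W (Fin (n - j)) := by
  classical
  -- Sort the pairs by the orbit of 0, recorded without 0 so that the index set is a full powerset.
  have hmaps : ∀ p ∈ (Finset.univ : Finset (Perm (Fin (n + 1)) × Perm (Fin (n + 1)))),
      (orbitFinset 0 p).erase 0 ∈ ((Finset.univ : Finset (Fin (n + 1))).erase 0).powerset :=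
    fun p _ => Finset.mem_powerset.2 (Finset.erase_subset_erase _ (Finset.subset_univ _))
  rw [pairSum, ← Finset.sum_fiberwise_of_maps_to hmaps]
  have hterm : ∀ T ∈ ((Finset.univ : Finset (Fin (n + 1))).erase 0).powerset,
      ∑ p : Perm (Fin (n + 1)) × Perm (Fin (n + 1)) with (orbitFinset 0 p).erase 0 = T,
        W (Fin (n + 1)) p.1 p.2
      = transSum W (Fin (T.card + 1)) * pairSum W (Fin (n - T.card)) := by
    intro T hT
    have h0T : (0 : Fin (n + 1)) ∉ T := fun h =>
      Finset.notMem_erase _ _ (Finset.mem_powerset.1 hT h)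
    have hfil : (Finset.univ.filter fun p : Perm (Fin (n + 1)) × Perm (Fin (n + 1)) =>
        (orbitFinset 0 p).erase 0 = T)
        = Finset.univ.filter fun p => orbitFinset 0 p = insert 0 T := by
      refine Finset.filter_congr fun p _ => ?_
      have h0 : (0 : Fin (n + 1)) ∈ orbitFinset 0 p := mem_orbitFinset.2 (Setoid.refl' _ _)
      constructor
      · rintro rfl
        exact (Finset.insert_erase h0).symm
      · intro h
        rw [h, Finset.erase_insert h0T]
    have hc : (insert 0 T).card = T.card + 1 := Finset.card_insert_of_notMem h0T
    rw [hfil, sum_orbitFinset_eq hW _ (Finset.mem_insert_self _ _)]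
    congr 1
    · refine transSum_congr hW (Fintype.equivFinOfCardEq ?_)
      rw [Fintype.card_coe, hc]
    · refine pairSum_congr hW (Fintype.equivFinOfCardEq ?_)
      rw [Fintype.card_subtype_compl, Fintype.card_coe, hc, Fintype.card_fin]
      omega
  rw [Finset.sum_congr rfl hterm, Finset.sum_powerset_apply_card
    (fun j => transSum W (Fin (j + 1)) * pairSum W (Fin (n - j))),
    Finset.card_erase_of_mem (Finset.mem_univ _), Finset.card_univ, Fintype.card_fin,
    Nat.add_sub_cancel]
  refine Finset.sum_congr rfl fun j _ => ?_
  rw [nsmul_eq_mul, mul_assoc]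

/-! ### Sums over permutations -/

/-- The product of `u_{|c|}` over the cycles of `σ`. -/
noncomputable def cycleWeight {R : Type*} [CommRing R] (u : ℕ → R) {α : Type*} [DecidableEq α] [Fintype α]
    (σ : Perm α) : R :=
  ((cycleLengths σ).map u).prod

theorem cycleWeight_permCongr {R : Type*} [CommRing R] (u : ℕ → R) {α β : Type*} [DecidableEq α] [Fintype α]
    [DecidableEq β] [Fintype β] (e : α ≃ β) (σ : Perm α) :
    cycleWeight u (e.permCongr σ) = cycleWeight u σ := by
  rw [cycleWeight, cycleLengths_permCongr, cycleWeight]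

theorem cycleWeight_sumCongr {R : Type*} [CommRing R] (u : ℕ → R) {α β : Type*} [DecidableEq α] [Fintype α]
    [DecidableEq β] [Fintype β] (σ : Perm α) (τ : Perm β) :
    cycleWeight u (Perm.sumCongr σ τ) = cycleWeight u σ * cycleWeight u τ := by
  rw [cycleWeight, cycleLengths_sumCongr, Multiset.map_add, Multiset.prod_add]
  rfl

theorem cycleWeight_const_mul {R : Type*} [CommRing R] (N : R) (u : ℕ → R) {α : Type*} [DecidableEq α]
    [Fintype α] (σ : Perm α) :
    cycleWeight (fun k => N * u k) σ = N ^ cycleCount σ * cycleWeight u σ := by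
  rw [cycleWeight, Multiset.prod_map_mul, Multiset.map_const', Multiset.prod_replicate,
    card_cycleLengths, cycleWeight]

/-- The sum of `u_σ` over all permutations of `n` elements. -/
noncomputable def permSum (u : ℕ → ℝ) (n : ℕ) : ℝ := ∑ σ : Perm (Fin n), cycleWeight u σ

/-- The weight `u_σ v_τ`. -/
noncomputable def productWeight (u v : ℕ → ℝ) : PairWeight :=
  fun _ _ _ σ τ => cycleWeight u σ * cycleWeight v τ

theorem isMultiplicative_productWeight (u v : ℕ → ℝ) : (productWeight u v).IsMultiplicative where
  congr α β _ _ _ _ e σ τ := by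
    simp only [productWeight, cycleWeight_permCongr]
  sum α β _ _ _ _ σ τ σ' τ' := by
    simp only [productWeight, cycleWeight_sumCongr]
    ring

theorem pairSum_productWeight (u v : ℕ → ℝ) (n : ℕ) :
    pairSum (productWeight u v) (Fin n) = permSum u n * permSum v n := by
  rw [pairSum, permSum, permSum, Finset.sum_mul_sum, ← Finset.sum_product']
  rfl

/-- The weight `u_σ` on pairs `(σ, 1)`. -/
noncomputable def singleWeight (u : ℕ → ℝ) : PairWeight :=
  fun _ _ _ σ τ => if τ = 1 then cycleWeight u σ else 0

theorem sumCongr_eq_one_iff {α β : Type*} (τ : Perm α) (τ' : Perm β) :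
    Perm.sumCongr τ τ' = 1 ↔ τ = 1 ∧ τ' = 1 := by
  constructor
  · intro h
    constructor
    · ext x
      simpa using congrArg (fun f : Perm (α ⊕ β) => f (Sum.inl x)) h
    · ext x
      simpa using congrArg (fun f : Perm (α ⊕ β) => f (Sum.inr x)) h
  · rintro ⟨rfl, rfl⟩
    exact Perm.sumCongr_one

theorem isMultiplicative_singleWeight (u : ℕ → ℝ) : (singleWeight u).IsMultiplicative where
  congr α β _ _ _ _ e σ τ := by
    have : e.permCongr τ = 1 ↔ τ = 1 := by
      constructor
      · intro h
        ext x
        simpa using congrArg (fun f : Perm β => e.symm (f (e x))) h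
      · rintro rfl
        ext x
        simp
    simp only [singleWeight, cycleWeight_permCongr, this]
  sum α β _ _ _ _ σ τ σ' τ' := by
    simp only [singleWeight, cycleWeight_sumCongr, sumCongr_eq_one_iff]
    by_cases h : τ = 1 <;> by_cases h' : τ' = 1 <;> simp [h, h']

theorem pairSum_singleWeight (u : ℕ → ℝ) (n : ℕ) :
    pairSum (singleWeight u) (Fin n) = permSum u n := by
  rw [pairSum, permSum, Fintype.sum_prod_type]
  refine Finset.sum_congr rfl fun σ _ => ?_
  simp [singleWeight]

theorem transitivePair_one_iff {α : Type*} [Finite α] [Nonempty α] {σ : Perm α} :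
    TransitivePair σ 1 ↔ cycleCount σ = 1 := by
  have h1 : orbitSetoid σ 1 = Perm.SameCycle.setoid σ :=
    le_antisymm (orbitSetoid_le_iff.2
      ⟨fun x => sameCycle_setoid_apply σ x, fun x => Setoid.refl' _ x⟩) le_sup_left
  rw [transitivePair_iff, h1, cycleCount]
  constructor
  · intro h
    rw [h, card_quotient_top]
  · intro h
    have := (Nat.card_eq_one_iff_unique.1 h).1
    exact top_le_iff.1 fun x y _ => Quotient.exact (Subsingleton.elim _ _)

/-- With the identity as second entry, transitivity means a single cycle, so this counts the
(n+1)-cycles. -/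
theorem transSum_singleWeight (u : ℕ → ℝ) (n : ℕ) :
    transSum (singleWeight u) (Fin (n + 1)) = n.factorial * u (n + 1) := by
  classical
  have key : ∀ u : ℕ → ℝ, transSum (singleWeight u) (Fin (n + 1))
      = u (n + 1) * transSum (singleWeight fun _ => 1) (Fin (n + 1)) := by
    intro u
    rw [transSum, transSum, Finset.mul_sum]
    refine Finset.sum_congr rfl ?_
    rintro ⟨σ, τ⟩ h
    simp only [Finset.mem_filter, Finset.mem_univ, true_and] at h
    simp only [singleWeight]
    split_ifs with hτ
    · subst hτ
      rw [transitivePair_one_iff, ← card_cycleLengths, Multiset.card_eq_one] at h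
      obtain ⟨a, ha⟩ := h
      have hs := sum_cycleLengths σ
      rw [ha, Multiset.sum_singleton, Fintype.card_fin] at hs
      simp [cycleWeight, ha, hs]
    · simp
  -- The number of full cycles comes from the exponential formula itself at constant weight 1. Each
  -- of the first n terms of (n+1)! equals n!, leaving n! for the last.
  have ht : ∀ n : ℕ, transSum (singleWeight fun _ => 1) (Fin (n + 1)) = n.factorial := by
    intro n
    have hall : ∀ m, pairSum (singleWeight fun _ => 1) (Fin m) = m.factorial := by
      intro m
      rw [pairSum_singleWeight, permSum]
      simp [cycleWeight, Fintype.card_perm]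
    induction n using Nat.strong_induction_on with
    | _ n ih =>
      have h := pairSum_succ (isMultiplicative_singleWeight fun _ => 1) n
      rw [hall, Finset.sum_range_succ, Finset.sum_congr rfl fun j hj => by
        rw [ih j (Finset.mem_range.1 hj), hall, mul_assoc, ← Nat.cast_mul, ← Nat.cast_mul,
          ← mul_assoc, Nat.choose_mul_factorial_mul_factorial (Finset.mem_range.1 hj).le]] at h
      rw [Finset.sum_const, Finset.card_range, Nat.choose_self, Nat.sub_self, hall,
        Nat.factorial_succ, nsmul_eq_mul] at h
      push_cast at h
      simp only [Nat.factorial_zero, Nat.cast_one, mul_one, one_mul] at h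
      linarith
  rw [key, ht, mul_comm]

theorem permSum_succ (u : ℕ → ℝ) (n : ℕ) :
    permSum u (n + 1) = ∑ j ∈ Finset.range (n + 1),
      (n.choose j : ℝ) * (j.factorial * u (j + 1)) * permSum u (n - j) := by
  rw [← pairSum_singleWeight, pairSum_succ (isMultiplicative_singleWeight u)]
  simp only [transSum_singleWeight, pairSum_singleWeight]

theorem permSum_zero (u : ℕ → ℝ) : permSum u 0 = 1 := by
  have : cycleLengths (1 : Perm (Fin 0)) = 0 := by
    simp [cycleLengths_eq]
  rw [permSum, Fintype.sum_unique]
  simp [cycleWeight, cycleLengths_eq]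

/-- The rising factorial as a sum over permutations. -/
theorem permSum_const_succ (N : ℝ) (n : ℕ) :
    permSum (fun _ => N) (n + 1) = (N + n) * permSum (fun _ => N) n := by
  -- The recursion becomes m! N times a partial sum of the same series; comparing two consecutive
  -- partial sums gives the factor N + n.
  have key : ∀ m, permSum (fun _ => N) (m + 1)
      = m.factorial * N * ∑ i ∈ Finset.range (m + 1), permSum (fun _ => N) i / i.factorial := by
    intro m
    rw [permSum_succ, ← Finset.sum_range_reflect, Finset.mul_sum]
    refine Finset.sum_congr rfl fun j hj => ?_
    have hj : j ≤ m := by simpa [Nat.lt_succ_iff] using hj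
    have e : m + 1 - 1 - j = m - j := by omega
    rw [e, Nat.sub_sub_self hj, Nat.choose_symm hj, Nat.cast_choose ℝ hj]
    have h1 : (j.factorial : ℝ) ≠ 0 := by positivity
    have h2 : ((m - j).factorial : ℝ) ≠ 0 := by positivity
    field_simp
  cases n with
  | zero => rw [key]; simp [permSum_zero]
  | succ n =>
    rw [key (n + 1), Finset.sum_range_succ, mul_add]
    have h := key n
    have h1 : (n.factorial : ℝ) ≠ 0 := by positivity
    have h2 : (n : ℝ) + 1 ≠ 0 := by positivity
    rw [Nat.factorial_succ]
    push_cast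
    generalize ∑ i ∈ Finset.range (n + 1), permSum (fun _ => N) i / (i.factorial : ℝ) = s at *
    rw [h]
    field_simp
    ring

/-! ### The deformed functional equation -/

theorem coeff_X_mul_derivative {R : Type*} [CommRing R] (f : PowerSeries R) (n : ℕ) :
    PowerSeries.coeff n (PowerSeries.X * PowerSeries.derivative R f)
      = n * PowerSeries.coeff n f := by
  cases n with
  | zero => simp
  | succ n =>
    rw [PowerSeries.coeff_succ_X_mul, PowerSeries.coeff_derivative, mul_comm]
    push_cast
    rfl

/-- A deformation of the powers of `M`: for `ε = 0` the term of index `j` is `M ^ j`. -/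
noncomputable def deformedPow {R : Type*} [CommRing R] (ε : R) (M : PowerSeries R) :
    ℕ → PowerSeries R
  | 0 => 1
  | j + 1 => M * deformedPow ε M j + PowerSeries.C ε *
      ((j : PowerSeries R) * deformedPow ε M j
        + PowerSeries.X * PowerSeries.derivative R (deformedPow ε M j))

theorem deformedPow_zero_left {R : Type*} [CommRing R] (M : PowerSeries R) (j : ℕ) :
    deformedPow 0 M j = M ^ j := by
  induction j with
  | zero => rw [deformedPow, pow_zero]
  | succ j ih => rw [deformedPow, ih, map_zero, zero_mul, add_zero, pow_succ']

theorem coeff_deformedPow_succ {R : Type*} [CommRing R] (ε : R) (M : PowerSeries R) (j n : ℕ) :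
    PowerSeries.coeff n (deformedPow ε M (j + 1))
      = ∑ p ∈ Finset.HasAntidiagonal.antidiagonal n, PowerSeries.coeff p.1 M
          * PowerSeries.coeff p.2 (deformedPow ε M j)
        + ε * ((j + n : ℕ) * PowerSeries.coeff n (deformedPow ε M j)) := by
  rw [deformedPow, map_add, PowerSeries.coeff_mul, PowerSeries.coeff_C_mul, map_add,
    coeff_X_mul_derivative, ← map_natCast (PowerSeries.C (R := R)), PowerSeries.coeff_C_mul]
  push_cast
  ring

theorem coeff_zero_deformedPow {R : Type*} [CommRing R] (ε : R) (M : PowerSeries R)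
    (hM : PowerSeries.coeff 0 M = 1) (j : ℕ) :
    PowerSeries.coeff 0 (deformedPow ε M j) = ∏ i ∈ Finset.range j, (1 + ε * i) := by
  induction j with
  | zero => simp [deformedPow]
  | succ j ih =>
    rw [coeff_deformedPow_succ, Finset.prod_range_succ, ih]
    simp only [Finset.HasAntidiagonal.antidiagonal_zero, Finset.sum_singleton, hM, ih, add_zero]
    ring

theorem map_deformedPow {R S : Type*} [CommRing R] [CommRing S] (f : R →+* S) (ε : R)
    (M : PowerSeries R) (j n : ℕ) :
    PowerSeries.coeff n (deformedPow (f ε) (PowerSeries.map f M) j)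
      = f (PowerSeries.coeff n (deformedPow ε M j)) := by
  induction j generalizing n with
  | zero =>
    rw [deformedPow, deformedPow, PowerSeries.coeff_one, PowerSeries.coeff_one]
    split_ifs <;> simp
  | succ j ih =>
    rw [coeff_deformedPow_succ, coeff_deformedPow_succ]
    simp [ih]

theorem coeff_deformedPow_mem {R : Type*} [CommRing R] (A : Subring R) {ε : R} (hε : ε ∈ A)
    {M : PowerSeries R} {n : ℕ} (hM : ∀ i ≤ n, PowerSeries.coeff i M ∈ A) (j : ℕ) :
    ∀ i ≤ n, PowerSeries.coeff i (deformedPow ε M j) ∈ A := by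
  induction j with
  | zero =>
    intro i _
    rw [deformedPow, PowerSeries.coeff_one]
    split_ifs
    exacts [A.one_mem, A.zero_mem]
  | succ j ih =>
    intro i hi
    rw [coeff_deformedPow_succ]
    refine A.add_mem (A.sum_mem fun p hp => ?_) (A.mul_mem hε (A.mul_mem (natCast_mem A _) (ih i hi)))
    have := Finset.HasAntidiagonal.mem_antidiagonal.1 hp
    exact A.mul_mem (hM _ (by omega)) (ih _ (by omega))

/-- The deformed functional equation `M = 1 + ∑_j κ_j x^j M_j`, where `M_j` is the deformed power. -/
def IsCumulantSystem {R : Type*} [CommRing R] (ε : R) (κ : ℕ → R) (M : PowerSeries R) : Prop :=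
  PowerSeries.coeff 0 M = 1 ∧ ∀ n, 1 ≤ n → PowerSeries.coeff n M
    = ∑ j ∈ Finset.range n, κ (j + 1) * PowerSeries.coeff (n - (j + 1)) (deformedPow ε M (j + 1))

/-- The equation for the n-th coefficient involves only earlier ones, so the solution stays in any
subring that contains the data. Applied to rings of convergent sequences, this is a limit theorem.
-/
theorem IsCumulantSystem.coeff_mem {R : Type*} [CommRing R] (A : Subring R) {ε : R} {κ : ℕ → R}
    {M : PowerSeries R} (h : IsCumulantSystem ε κ M) (hε : ε ∈ A) (hκ : ∀ j, κ j ∈ A) (n : ℕ) :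
    PowerSeries.coeff n M ∈ A := by
  induction n using Nat.strong_induction_on with
  | _ n ih =>
    rcases Nat.eq_zero_or_pos n with rfl | hn
    · rw [h.1]
      exact A.one_mem
    · rw [h.2 n hn]
      refine A.sum_mem fun j _ => A.mul_mem (hκ _) ?_
      refine coeff_deformedPow_mem A hε (n := n - 1) (fun i hi => ih i (by omega)) _ _ (by omega)

theorem isCumulantSystem_ncSeries {R : Type*} [CommRing R] (κ : ℕ → R) :
    IsCumulantSystem 0 κ (ncSeries κ) := by
  refine ⟨coeff_zero_ncSeries κ, fun n hn => ?_⟩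
  rw [coeff_ncSeries κ n hn, Finset.sum_range_succ', pow_zero, PowerSeries.coeff_one,
    if_neg (by omega), mul_zero, add_zero]
  refine Finset.sum_congr rfl fun j hj => ?_
  have hj := Finset.mem_range.1 hj
  rw [deformedPow_zero_left, mul_pow, PowerSeries.coeff_X_pow_mul', if_pos (by omega)]

open scoped Classical in
/-- The sum `∑ ε^{n+1-|σ|-|τ|} κ_σ` over transitive pairs. -/
noncomputable def transPoly {R : Type*} [CommRing R] (ε : R) (κ : ℕ → R) (n : ℕ) : R :=
  ∑ p : Perm (Fin n) × Perm (Fin n) with TransitivePair p.1 p.2,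
    ε ^ (n + 1 - (cycleCount p.1 + cycleCount p.2)) * cycleWeight κ p.1

theorem map_cycleWeight {R S : Type*} [CommRing R] [CommRing S] (f : R →+* S) (κ : ℕ → R)
    {α : Type*} [DecidableEq α] [Fintype α] (σ : Perm α) :
    cycleWeight (fun j => f (κ j)) σ = f (cycleWeight κ σ) := by
  rw [cycleWeight, cycleWeight, map_multiset_prod, Multiset.map_map]
  rfl

theorem map_transPoly {R S : Type*} [CommRing R] [CommRing S] (f : R →+* S) (ε : R) (κ : ℕ → R)
    (n : ℕ) : transPoly (f ε) (fun j => f (κ j)) n = f (transPoly ε κ n) := by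
  simp [transPoly, map_cycleWeight]

theorem map_ncSum {R S : Type*} [CommRing R] [CommRing S] (f : R →+* S) (κ : ℕ → R)
    {α : Type*} [LT α] (T : Finset α) : ncSum (fun j => f (κ j)) T = f (ncSum κ T) := by
  simp [ncSum]

theorem cycleWeight_mem {R : Type*} [CommRing R] (A : Subring R) {κ : ℕ → R} (hκ : ∀ j, κ j ∈ A)
    {α : Type*} [DecidableEq α] [Fintype α] (σ : Perm α) : cycleWeight κ σ ∈ A := by
  refine A.multiset_prod_mem _ fun x hx => ?_
  obtain ⟨j, -, rfl⟩ := Multiset.mem_map.1 hx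
  exact hκ j

theorem transPoly_mem {R : Type*} [CommRing R] (A : Subring R) {ε : R} {κ : ℕ → R} (hε : ε ∈ A)
    (hκ : ∀ j, κ j ∈ A) (n : ℕ) : transPoly ε κ n ∈ A :=
  A.sum_mem fun _ _ => A.mul_mem (A.pow_mem hε _) (cycleWeight_mem A hκ _)

theorem ncSum_mem {R : Type*} [CommRing R] (A : Subring R) {κ : ℕ → R} (hκ : ∀ j, κ j ∈ A)
    {α : Type*} [LT α] (T : Finset α) : ncSum κ T ∈ A :=
  A.sum_mem fun _ _ => A.prod_mem fun _ _ => hκ _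

/-- The weight N^{|σ|+|τ|} is rewritten in powers of 1/N. The genus bound ensures that the truncated
exponent in `transPoly` is the true difference. -/
theorem transSum_eq_transPoly (N : ℝ) (hN : N ≠ 0) (κ : ℕ → ℝ) (n : ℕ) (hn : 1 ≤ n) :
    transSum (productWeight (fun k => N * κ k) fun _ => N) (Fin n)
      = N ^ (n + 1) * transPoly N⁻¹ κ n := by
  classical
  have : Nonempty (Fin n) := ⟨⟨0, hn⟩⟩
  rw [transSum, transPoly, Finset.mul_sum]
  refine Finset.sum_congr rfl fun p hp => ?_
  have h := (Finset.mem_filter.1 hp).2.cycleCount_add_le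
  rw [Fintype.card_fin] at h
  have hτ : cycleWeight (fun _ => N) p.2 = N ^ cycleCount p.2 := by
    rw [cycleWeight, Multiset.map_const', Multiset.prod_replicate, card_cycleLengths]
  rw [productWeight, cycleWeight_const_mul, hτ, inv_pow, ← mul_assoc, ← pow_sub₀ N hN (by omega),
    Nat.sub_sub_self h, pow_add]
  ring

/-- The moments with finite free cumulants `κ` and parameter `N`. -/
noncomputable def momentSeries (κ : ℕ → ℝ) (N : ℝ) : PowerSeries ℝ :=
  PowerSeries.mk fun n => if n = 0 then 1 else transPoly N⁻¹ κ n / (n - 1).factorial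

theorem coeff_momentSeries (κ : ℕ → ℝ) (N : ℝ) (n : ℕ) :
    PowerSeries.coeff (n + 1) (momentSeries κ N) = transPoly N⁻¹ κ (n + 1) / n.factorial := by
  simp [momentSeries]

/-- The auxiliary series `∑_k N^{-(k+j)} N(N+1)⋯(N+k+j-1) c_k x^k / k!`. -/
noncomputable def risingSeries (κ : ℕ → ℝ) (N : ℝ) (j : ℕ) : PowerSeries ℝ :=
  PowerSeries.mk fun k => permSum (fun _ => N) (k + j) / N ^ (k + j)
    * permSum (fun i => N * κ i) k / k.factorial

theorem coeff_risingSeries (κ : ℕ → ℝ) (N : ℝ) (j k : ℕ) :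
    PowerSeries.coeff k (risingSeries κ N j) = permSum (fun _ => N) (k + j) / N ^ (k + j)
    * permSum (fun i => N * κ i) k / k.factorial :=
  PowerSeries.coeff_mk _ _

theorem coeff_zero_risingSeries (κ : ℕ → ℝ) (N : ℝ) :
    PowerSeries.coeff 0 (risingSeries κ N 0) = 1 := by
  simp [coeff_risingSeries, permSum_zero]

/-- Newton's identities. -/
theorem coeff_succ_risingSeries_newton (κ : ℕ → ℝ) (N : ℝ) (hN : N ≠ 0) (n : ℕ) :
    ((n + 1 : ℕ) : ℝ) * PowerSeries.coeff (n + 1) (risingSeries κ N 0)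
      = N * ∑ j ∈ Finset.range (n + 1), PowerSeries.coeff (j + 1) (momentSeries κ N)
        * PowerSeries.coeff (n - j) (risingSeries κ N 0) := by
  have h := pairSum_succ (isMultiplicative_productWeight (fun k => N * κ k) fun _ => N) n
  simp only [pairSum_productWeight] at h
  rw [Finset.sum_congr rfl fun j _ => by rw [transSum_eq_transPoly N hN κ (j + 1) (by omega)]] at h
  simp only [coeff_risingSeries, coeff_momentSeries, add_zero]
  have hl : ((n + 1 : ℕ) : ℝ) * (permSum (fun _ => N) (n + 1) / N ^ (n + 1)
      * permSum (fun i => N * κ i) (n + 1) / (n + 1).factorial)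
      = permSum (fun i => N * κ i) (n + 1) * permSum (fun _ => N) (n + 1)
        / (N ^ (n + 1) * n.factorial) := by
    rw [Nat.factorial_succ]
    push_cast
    have h1 : (n.factorial : ℝ) ≠ 0 := by positivity
    have h2 : (n : ℝ) + 1 ≠ 0 := by positivity
    field_simp
  rw [hl, h, Finset.sum_div, Finset.mul_sum]
  refine Finset.sum_congr rfl fun j hj => ?_
  have hj : j ≤ n := by simpa [Nat.lt_succ_iff] using hj
  obtain ⟨k, rfl⟩ := Nat.exists_eq_add_of_le hj
  rw [Nat.cast_choose ℝ hj, Nat.add_sub_cancel_left]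
  have h1 : (j.factorial : ℝ) ≠ 0 := by positivity
  have h2 : (k.factorial : ℝ) ≠ 0 := by positivity
  have h3 : ((j + k).factorial : ℝ) ≠ 0 := by positivity
  field_simp
  ring

/-- For N = -d this is x F' = -d (M - 1) F, the logarithmic derivative of ∏ (1 - λ_i x). -/
theorem X_mul_derivative_risingSeries (κ : ℕ → ℝ) (N : ℝ) (hN : N ≠ 0) :
    PowerSeries.X * PowerSeries.derivative ℝ (risingSeries κ N 0)
      = PowerSeries.C N * ((momentSeries κ N - 1) * risingSeries κ N 0) := by
  ext n
  rw [coeff_X_mul_derivative, PowerSeries.coeff_C_mul]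
  cases n with
  | zero => simp [momentSeries]
  | succ n =>
    rw [coeff_succ_risingSeries_newton κ N hN, PowerSeries.coeff_mul,
      Finset.Nat.sum_antidiagonal_eq_sum_range_succ (fun i j =>
        PowerSeries.coeff i (momentSeries κ N - 1) * PowerSeries.coeff j (risingSeries κ N 0)),
      Finset.sum_range_succ' _ (n + 1)]
    congr 1
    have h0 : PowerSeries.coeff 0 (momentSeries κ N - 1) = 0 := by simp [momentSeries]
    rw [h0, zero_mul, add_zero]
    refine Finset.sum_congr rfl fun j _ => ?_
    rw [map_sub, PowerSeries.coeff_one, if_neg (by omega), sub_zero, Nat.add_sub_add_right]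

/-- The next rising factorial has the extra factor (N + k + j)/N = 1 + (j + k)/N, and k acts on the
coefficient of x^k as x d/dx. -/
theorem risingSeries_succ (κ : ℕ → ℝ) (N : ℝ) (hN : N ≠ 0) (j : ℕ) :
    risingSeries κ N (j + 1) = risingSeries κ N j + PowerSeries.C N⁻¹ *
      ((j : PowerSeries ℝ) * risingSeries κ N j
        + PowerSeries.X * PowerSeries.derivative ℝ (risingSeries κ N j)) := by
  ext k
  rw [map_add, PowerSeries.coeff_C_mul, map_add, coeff_X_mul_derivative,
    ← map_natCast (PowerSeries.C (R := ℝ)), PowerSeries.coeff_C_mul]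
  simp only [coeff_risingSeries]
  rw [← add_assoc k j 1, permSum_const_succ, pow_succ]
  push_cast
  field_simp
  ring

/-- This explains the form of `deformedPow`: in the recursion for the rising series, differentiating
the factor `risingSeries κ N 0` yields M - 1, which combines with the undifferentiated term into
multiplication by M. -/
theorem risingSeries_eq (κ : ℕ → ℝ) (N : ℝ) (hN : N ≠ 0) (j : ℕ) :
    risingSeries κ N j = deformedPow N⁻¹ (momentSeries κ N) j * risingSeries κ N 0 := by
  induction j with
  | zero => rw [deformedPow, one_mul]
  | succ j ih =>
    have hX := X_mul_derivative_risingSeries κ N hN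
    have hC : PowerSeries.C N⁻¹ * PowerSeries.C N = (1 : PowerSeries ℝ) := by
      rw [← map_mul, inv_mul_cancel₀ hN, map_one]
    rw [risingSeries_succ κ N hN, ih, deformedPow]
    simp only [Derivation.leibniz, smul_eq_mul]
    generalize risingSeries κ N 0 = F at *
    generalize momentSeries κ N = M at *
    generalize deformedPow N⁻¹ M j = g at *
    linear_combination PowerSeries.C N⁻¹ * g * hX + g * (M - 1) * F * hC

/-- A second formula for x F', obtained by removing the cycle of one point from σ only. The rising
factorial keeps its order, hence the index `j + 1` of the rising series. -/
theorem coeff_succ_risingSeries_cumulant (κ : ℕ → ℝ) (N : ℝ) (n : ℕ) :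
    ((n + 1 : ℕ) : ℝ) * PowerSeries.coeff (n + 1) (risingSeries κ N 0)
      = N * ∑ j ∈ Finset.range (n + 1), κ (j + 1)
        * PowerSeries.coeff (n - j) (risingSeries κ N (j + 1)) := by
  simp only [coeff_risingSeries, add_zero]
  rw [permSum_succ (fun i => N * κ i) n, Finset.mul_sum, Finset.mul_sum, Finset.sum_div,
    Finset.mul_sum]
  refine Finset.sum_congr rfl fun j hj => ?_
  have hj : j ≤ n := by simpa [Nat.lt_succ_iff] using hj
  have e : n - j + (j + 1) = n + 1 := by omega
  rw [e, Nat.cast_choose ℝ hj, Nat.factorial_succ n]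
  push_cast
  have h1 : (n.factorial : ℝ) ≠ 0 := by positivity
  have h2 : (n : ℝ) + 1 ≠ 0 := by positivity
  have h3 : (j.factorial : ℝ) ≠ 0 := by positivity
  have h4 : ((n - j).factorial : ℝ) ≠ 0 := by positivity
  field_simp

/-- Two formulas for x F', one from transitive pairs and one from single cycles; dividing both by N
F gives the functional equation. -/
theorem isCumulantSystem_momentSeries (κ : ℕ → ℝ) (N : ℝ) (hN : N ≠ 0) :
    IsCumulantSystem N⁻¹ κ (momentSeries κ N) := by
  refine ⟨by simp [momentSeries], fun n hn => ?_⟩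
  set M := momentSeries κ N with hM
  set F := risingSeries κ N 0 with hF
  set B : PowerSeries ℝ := ∑ j ∈ Finset.range n,
    PowerSeries.C (κ (j + 1)) * (PowerSeries.X ^ (j + 1) * deformedPow N⁻¹ M (j + 1)) with hB
  -- `B` keeps only finitely many cumulants, so the comparison is made modulo x^{n+1}; `F` has
  -- constant term 1 and can be cancelled.
  have hdvd : PowerSeries.X ^ (n + 1) ∣ (M - 1 - B) * F := by
    rw [PowerSeries.X_pow_dvd_iff]
    intro i hi
    have h1 : PowerSeries.coeff i ((M - 1) * F)
        = N⁻¹ * PowerSeries.coeff i (PowerSeries.X * PowerSeries.derivative ℝ F) := by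
      rw [hF, X_mul_derivative_risingSeries κ N hN, PowerSeries.coeff_C_mul,
        inv_mul_cancel_left₀ hN]
    have h2 : PowerSeries.coeff i (B * F) = ∑ j ∈ Finset.range n, κ (j + 1) *
        PowerSeries.coeff i (PowerSeries.X ^ (j + 1) * risingSeries κ N (j + 1)) := by
      rw [hB, Finset.sum_mul, map_sum]
      refine Finset.sum_congr rfl fun j _ => ?_
      rw [mul_assoc, PowerSeries.coeff_C_mul, mul_assoc, risingSeries_eq κ N hN (j + 1)]
    rw [sub_mul, map_sub, h1, h2, coeff_X_mul_derivative, sub_eq_zero]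
    simp only [PowerSeries.coeff_X_pow_mul']
    cases i with
    | zero => simp
    | succ i =>
      rw [coeff_succ_risingSeries_cumulant, inv_mul_cancel_left₀ hN]
      rw [← Finset.sum_subset (Finset.range_subset_range.2 (show i + 1 ≤ n by omega))]
      · refine Finset.sum_congr rfl fun j hj => ?_
        have := Finset.mem_range.1 hj
        rw [if_pos (by omega), Nat.add_sub_add_right]
      · intro j _ hj
        rw [Finset.mem_range] at hj
        rw [if_neg (by omega), mul_zero]
  have hunit : IsUnit F := by
    rw [PowerSeries.isUnit_iff_constantCoeff, ← PowerSeries.coeff_zero_eq_constantCoeff_apply,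
      hF, coeff_zero_risingSeries]
    exact isUnit_one
  have h0 := PowerSeries.X_pow_dvd_iff.1 (hunit.dvd_mul_right.1 hdvd) n (Nat.lt_succ_self n)
  rw [map_sub, map_sub, PowerSeries.coeff_one, if_neg (by omega), sub_zero, sub_eq_zero] at h0
  rw [h0, hB, map_sum]
  refine Finset.sum_congr rfl fun j hj => ?_
  have := Finset.mem_range.1 hj
  rw [PowerSeries.coeff_C_mul, PowerSeries.coeff_X_pow_mul', if_pos (by omega)]

/-! ### Rings of convergent sequences -/

/-- Sequences together with their limits. -/
def limitSubring : Subring ((ℕ → ℝ) × ℝ) where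
  carrier := {p | Tendsto p.1 atTop (𝓝 p.2)}
  mul_mem' h h' := Filter.Tendsto.mul h h'
  one_mem' := tendsto_const_nhds
  add_mem' h h' := Filter.Tendsto.add h h'
  zero_mem' := tendsto_const_nhds
  neg_mem' h := Filter.Tendsto.neg h

/-- The power series over a product ring with given components. -/
noncomputable def pairSeries {R S : Type*} [CommRing R] [CommRing S] (M : ℕ → PowerSeries R)
    (M' : PowerSeries S) : PowerSeries ((ℕ → R) × S) :=
  PowerSeries.mk fun n => (fun d => PowerSeries.coeff n (M d), PowerSeries.coeff n M')

theorem map_fst_pairSeries {R S : Type*} [CommRing R] [CommRing S] (M : ℕ → PowerSeries R)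
    (M' : PowerSeries S) (d : ℕ) :
    PowerSeries.map ((Pi.evalRingHom (fun _ : ℕ => R) d).comp (RingHom.fst (ℕ → R) S))
      (pairSeries M M') = M d := by
  ext n
  simp [pairSeries]

theorem map_snd_pairSeries {R S : Type*} [CommRing R] [CommRing S] (M : ℕ → PowerSeries R)
    (M' : PowerSeries S) :
    PowerSeries.map (RingHom.snd (ℕ → R) S) (pairSeries M M') = M' := by
  ext n
  simp [pairSeries]

/-- Polynomial expressions in a product ring are evaluated componentwise, because every projection
is a ring homomorphism. -/
theorem coeff_deformedPow_pairSeries {R S : Type*} [CommRing R] [CommRing S] (ε : ℕ → R) (ε' : S)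
    (M : ℕ → PowerSeries R) (M' : PowerSeries S) (j n : ℕ) :
    PowerSeries.coeff n (deformedPow (ε, ε') (pairSeries M M') j)
      = (fun d => PowerSeries.coeff n (deformedPow (ε d) (M d) j),
        PowerSeries.coeff n (deformedPow ε' M' j)) := by
  refine Prod.ext (funext fun d => ?_) ?_
  · have := map_deformedPow ((Pi.evalRingHom (fun _ : ℕ => R) d).comp (RingHom.fst (ℕ → R) S))
      (ε, ε') (pairSeries M M') j n
    rw [map_fst_pairSeries] at this
    exact this.symm
  · have := map_deformedPow (RingHom.snd (ℕ → R) S) (ε, ε') (pairSeries M M') j n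
    rw [map_snd_pairSeries] at this
    exact this.symm

theorem IsCumulantSystem.pair {R S : Type*} [CommRing R] [CommRing S] {ε : ℕ → R} {ε' : S}
    {κ : ℕ → ℕ → R} {κ' : ℕ → S} {M : ℕ → PowerSeries R} {M' : PowerSeries S}
    (h : ∀ d, IsCumulantSystem (ε d) (κ d) (M d)) (h' : IsCumulantSystem ε' κ' M') :
    IsCumulantSystem (ε, ε') (fun j => (fun d => κ d j, κ' j)) (pairSeries M M') := by
  constructor
  · refine Prod.ext (funext fun d => ?_) ?_
    · simpa [pairSeries] using (h d).1
    · simpa [pairSeries] using h'.1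
  · intro n hn
    simp only [coeff_deformedPow_pairSeries]
    refine Prod.ext (funext fun d => ?_) ?_
    · simp only [pairSeries, PowerSeries.coeff_mk, Prod.fst_sum, Prod.fst_mul, Finset.sum_apply,
        Pi.mul_apply]
      exact (h d).2 n hn
    · simp only [pairSeries, PowerSeries.coeff_mk, Prod.snd_sum, Prod.snd_mul]
      exact h'.2 n hn

theorem transPoly_pair {R S : Type*} [CommRing R] [CommRing S] (ε : ℕ → R) (ε' : S)
    (κ : ℕ → ℕ → R) (κ' : ℕ → S) (n : ℕ) :
    transPoly ((ε, ε') : (ℕ → R) × S) (fun j => (fun d => κ d j, κ' j)) n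
      = (fun d => transPoly (ε d) (κ d) n, transPoly ε' κ' n) := by
  refine Prod.ext (funext fun d => ?_) ?_
  · exact (map_transPoly ((Pi.evalRingHom (fun _ : ℕ => R) d).comp (RingHom.fst (ℕ → R) S))
      (ε, ε') (fun j => (fun d => κ d j, κ' j)) n).symm
  · exact (map_transPoly (RingHom.snd (ℕ → R) S) (ε, ε') (fun j => (fun d => κ d j, κ' j)) n).symm

theorem ncSum_pair {R S : Type*} [CommRing R] [CommRing S]
    (κ : ℕ → ℕ → R) (κ' : ℕ → S) {α : Type*} [LT α] (T : Finset α) :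
    ncSum (fun j => ((fun d => κ d j, κ' j) : (ℕ → R) × S)) T
      = (fun d => ncSum (κ d) T, ncSum κ' T) := by
  refine Prod.ext (funext fun d => ?_) ?_
  · exact (map_ncSum ((Pi.evalRingHom (fun _ : ℕ => R) d).comp (RingHom.fst (ℕ → R) S))
      (fun j => (fun d => κ d j, κ' j)) T).symm
  · exact (map_ncSum (RingHom.snd (ℕ → R) S) (fun j => (fun d => κ d j, κ' j)) T).symm

/-- The transitive pairs of maximal cycle count enumerate the non-crossing partitions. -/
theorem transPoly_zero (κ : ℕ → ℝ) (n : ℕ) :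
    transPoly 0 κ (n + 1) = n.factorial * ncSum κ (Finset.range (n + 1)) := by
  -- Any non-zero sequence tending to infinity would do. The same coefficients converge once through
  -- the functional equation and once as polynomials in 1/N, so the limits agree.
  set N : ℕ → ℝ := fun d => (d : ℝ) + 1 with hN
  have hN0 : ∀ d, N d ≠ 0 := fun d => by positivity
  have hε : ((fun d => (N d)⁻¹, 0) : (ℕ → ℝ) × ℝ) ∈ limitSubring := by
    change Tendsto (fun d : ℕ => ((d : ℝ) + 1)⁻¹) atTop (𝓝 0)
    simpa using tendsto_one_div_add_atTop_nhds_zero_nat (𝕜 := ℝ)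
  have hκ : ∀ j, ((fun _ => κ j, κ j) : (ℕ → ℝ) × ℝ) ∈ limitSubring :=
    fun j => tendsto_const_nhds
  have h1 := (IsCumulantSystem.pair (fun d => isCumulantSystem_momentSeries κ (N d) (hN0 d))
    (isCumulantSystem_ncSeries κ)).coeff_mem limitSubring hε hκ (n + 1)
  have h2 := transPoly_mem limitSubring hε hκ (n + 1)
  rw [transPoly_pair (fun d => (N d)⁻¹) 0 (fun _ => κ) κ] at h2
  have h1 : Tendsto (fun d => PowerSeries.coeff (n + 1) (momentSeries κ (N d))) atTop
      (𝓝 (PowerSeries.coeff (n + 1) (ncSeries κ))) := by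
    rw [pairSeries, PowerSeries.coeff_mk] at h1
    exact h1
  have h2 : Tendsto (fun d => transPoly (N d)⁻¹ κ (n + 1)) atTop (𝓝 (transPoly 0 κ (n + 1))) := h2
  simp only [coeff_momentSeries] at h1
  have h3 := h1.const_mul (n.factorial : ℝ)
  have hf : (n.factorial : ℝ) ≠ 0 := by positivity
  simp only [mul_div_cancel₀ _ hf] at h3
  rw [tendsto_nhds_unique h2 h3, ncSeries, PowerSeries.coeff_mk]

/-! ### Annular non-crossing permutations and transitive pairs -/

theorem cycleCount_permCongr {α β : Type*} [DecidableEq α] [Fintype α] [DecidableEq β] [Fintype β]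
    (e : α ≃ β) (σ : Perm α) : cycleCount (e.permCongr σ) = cycleCount σ := by
  rw [← card_cycleLengths, ← card_cycleLengths, cycleLengths_permCongr]

theorem permCongr_inv_mul {α β : Type*} (e : α ≃ β) (σ γ : Perm α) :
    (e.permCongr σ)⁻¹ * e.permCongr γ = e.permCongr (σ⁻¹ * γ) := by
  rw [inv_mul_eq_iff_eq_mul]
  ext x
  simp

theorem TransitivePair.symm {α : Type*} {σ τ : Perm α} (h : TransitivePair σ τ) :
    TransitivePair τ σ := by
  rw [transitivePair_iff] at h ⊢
  rw [← h, orbitSetoid, orbitSetoid, sup_comm]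

theorem transitivePair_mul_iff {α : Type*} {σ τ : Perm α} :
    TransitivePair σ (σ * τ) ↔ TransitivePair σ τ := by
  have h1 : orbitSetoid σ (σ * τ) ≤ orbitSetoid σ τ :=
    orbitSetoid_le_iff.2 ⟨orbitSetoid_left σ τ, fun x =>
      Setoid.trans' _ (orbitSetoid_right σ τ x) (orbitSetoid_left σ τ (τ x))⟩
  have h2 : orbitSetoid σ τ ≤ orbitSetoid σ (σ * τ) :=
    orbitSetoid_le_iff.2 ⟨orbitSetoid_left _ _, fun x =>
      Setoid.trans' _ (orbitSetoid_right σ (σ * τ) x)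
        (Setoid.symm' _ (orbitSetoid_left σ (σ * τ) (τ x)))⟩
  rw [transitivePair_iff, transitivePair_iff, le_antisymm h1 h2]

open scoped Classical in
/-- The sum of `κ_σ` over the `σ` that are annular non-crossing relative to `γ`. -/
noncomputable def annularSum (κ : ℕ → ℝ) {α : Type*} [DecidableEq α] [Fintype α] (γ : Perm α) : ℝ :=
  ∑ σ : Perm α with TransitivePair σ γ ∧ cycleCount σ + cycleCount (σ⁻¹ * γ) = Fintype.card α,
    cycleWeight κ σ

theorem annularSum_permCongr (κ : ℕ → ℝ) {α β : Type*} [DecidableEq α] [Fintype α] [DecidableEq β]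
    [Fintype β] (e : α ≃ β) (γ : Perm α) : annularSum κ (e.permCongr γ) = annularSum κ γ := by
  classical
  symm
  refine Finset.sum_equiv e.permCongr (fun σ => ?_) fun σ _ => (cycleWeight_permCongr κ e σ).symm
  simp only [Finset.mem_filter, Finset.mem_univ, true_and, transitivePair_permCongr,
    permCongr_inv_mul, cycleCount_permCongr, Fintype.card_congr e]

/-- Equal cycle lengths mean conjugate permutations, and conjugation is a relabelling. Hence the
standard `annularGamma t s` represents all γ of its type. -/
theorem annularSum_eq_of_cycleLengths (κ : ℕ → ℝ) {α : Type*} [DecidableEq α] [Fintype α]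
    {γ γ' : Perm α} (h : cycleLengths γ = cycleLengths γ') : annularSum κ γ = annularSum κ γ' := by
  obtain ⟨g, rfl⟩ := isConj_iff.1 (Perm.partition_eq_of_isConj.2 (Nat.Partition.ext h))
  rw [← Equiv.permCongr_eq_mul, annularSum_permCongr]

-- The bijection is (σ, τ) ↦ (στ, σ). From |σ| + |τ| = n the genus bound gives |στ| ≤ 2, parity
-- makes |στ| even, and it is positive, so it is 2.
open scoped Classical in
theorem sum_transitivePair_eq_annularSum (κ : ℕ → ℝ) (n : ℕ) (hn : 1 ≤ n) :
    ∑ p : Perm (Fin n) × Perm (Fin n) with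
        TransitivePair p.1 p.2 ∧ cycleCount p.1 + cycleCount p.2 = n, cycleWeight κ p.1
      = ∑ γ : Perm (Fin n) with cycleCount γ = 2, annularSum κ γ := by
  have : Nonempty (Fin n) := ⟨⟨0, hn⟩⟩
  simp only [annularSum]
  rw [Finset.sum_sigma']
  refine Finset.sum_bij' (fun p _ => ⟨p.1 * p.2, p.1⟩) (fun q _ => (q.2, q.2⁻¹ * q.1))
    ?_ ?_ ?_ ?_ ?_
  · rintro ⟨σ, τ⟩ h
    simp only [Finset.mem_filter, Finset.mem_univ, true_and, Finset.mem_sigma,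
      Fintype.card_fin, inv_mul_cancel_left, transitivePair_mul_iff] at h ⊢
    refine ⟨?_, h⟩
    have h1 := h.1.symm.genus_le
    have h2 := even_cycleCount τ σ
    have h3 := cycleCount_pos (σ * τ)
    rw [Fintype.card_fin] at h1 h2
    rw [Nat.even_iff] at h2
    omega
  · rintro ⟨γ, σ⟩ h
    simp only [Finset.mem_filter, Finset.mem_univ, true_and, Finset.mem_sigma,
      Fintype.card_fin] at h ⊢
    refine ⟨?_, h.2.2⟩
    rw [← transitivePair_mul_iff, mul_inv_cancel_left]
    exact h.2.1
  · rintro ⟨σ, τ⟩ _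
    simp
  · rintro ⟨γ, σ⟩ _
    simp
  · rintro ⟨σ, τ⟩ _
    rfl

theorem cycleLengths_finRotate (t : ℕ) (ht : 1 ≤ t) : cycleLengths (finRotate t) = {t} := by
  rw [cycleLengths_eq, ← Perm.sum_cycleType]
  rcases Nat.lt_or_ge t 2 with h | h
  · obtain rfl : t = 1 := by omega
    have : finRotate 1 = 1 := Subsingleton.elim _ _
    simp [this]
  · simp [cycleType_finRotate_of_le h]

theorem cycleLengths_annularGamma (t s : ℕ) (ht : 1 ≤ t) (hs : 1 ≤ s) :
    cycleLengths (annularGamma t s) = {t, s} := by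
  have := cycleLengths_sumCongr (finRotate t) (finRotate s)
  rw [cycleLengths_finRotate t ht, cycleLengths_finRotate s hs] at this
  rw [annularGamma, cycleLengths_permCongr, this]
  rfl

theorem annularSum_annularGamma (κ : ℕ → ℝ) (t s : ℕ) :
    annularSum κ (annularGamma t s) = ∑ σ ∈ annularNC t s, cycleProd κ σ := by
  classical
  have hnum : ∀ σ : Perm (Fin (t + s)), cycleCount σ = numCycles σ :=
    fun σ => (card_cycleLengths σ).symm
  rw [annularSum, annularNC]
  refine Finset.sum_congr (Finset.filter_congr fun σ _ => ?_) fun σ _ => rfl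
  rw [IsAnnularNonCrossing, hnum, hnum, Fintype.card_fin]
  rfl

/-- The size of a conjugacy class as n! over the order of the centralizer; when t = s the two cycles
may also be exchanged. -/
theorem mul_card_cycleLengths_eq (n t s : ℕ) (ht : 1 ≤ t) (hs : 1 ≤ s) (hts : t + s = n) :
    (Finset.univ.filter fun γ : Perm (Fin n) => cycleLengths γ = {t, s}).card
      * ((if t = s then 2 else 1) * (t * s)) = n.factorial := by
  classical
  subst hts
  have hg := cycleLengths_annularGamma t s ht hs
  set g := annularGamma t s with hgdef
  have hct : g.cycleType = Multiset.filter (fun n => 2 ≤ n) {t, s} := by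
    rw [← hg]
    exact Perm.filter_parts_partition_eq_cycleType.symm
  have h := Perm.card_isConj_mul_eq g
  have hcard : Nat.card {h : Perm (Fin (t + s)) | IsConj g h}
      = (Finset.univ.filter fun γ : Perm (Fin (t + s)) => cycleLengths γ = {t, s}).card := by
    rw [Nat.card_eq_card_toFinset]
    congr 1
    ext γ
    simp only [Set.mem_toFinset, Set.mem_ofPred_eq, Finset.mem_filter, Finset.mem_univ, true_and]
    rw [Perm.partition_eq_of_isConj, Nat.Partition.ext_iff, ← hg, eq_comm]
    rfl
  rw [hcard, Fintype.card_fin] at h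
  rw [← h]
  congr 1
  rw [hct]
  simp only [Multiset.insert_eq_cons]
  -- `cycleType` omits fixed points, so the cases t = 1 and s = 1 are separate.
  rcases Nat.lt_or_ge t 2 with h1 | h1 <;> rcases Nat.lt_or_ge s 2 with h2 | h2
  · obtain rfl : t = 1 := by omega
    obtain rfl : s = 1 := by omega
    decide
  · obtain rfl : t = 1 := by omega
    rw [Multiset.filter_cons_of_neg _ (by omega), Multiset.filter_singleton, if_pos h2]
    have : 1 ≠ s := by omega
    simp [this]
  · obtain rfl : s = 1 := by omega
    rw [Multiset.filter_cons_of_pos (p := fun n => 2 ≤ n) _ h1, Multiset.filter_singleton, if_neg (by omega)]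
    simp
  · rw [Multiset.filter_cons_of_pos (p := fun n => 2 ≤ n) _ h1, Multiset.filter_singleton, if_pos h2]
    by_cases hts : t = s
    · subst hts
      simp
      ring
    · have hts' : s ≠ t := fun h => hts h.symm
      rw [Multiset.toFinset_cons, Multiset.toFinset_singleton, Finset.prod_insert (by simpa using hts)]
      simp [hts, hts', Multiset.count_cons, Multiset.count_singleton]

/-- A class function summed over the permutations with two cycles. -/
theorem sum_cycleCount_eq_two (n : ℕ) (f : Perm (Fin n) → ℝ) (F : ℕ → ℕ → ℝ)
    (hF : ∀ γ t s, cycleLengths γ = {t, s} → f γ = F t s) :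
    ∑ γ : Perm (Fin n) with cycleCount γ = 2, f γ
      = (n.factorial : ℝ) / 2 * ∑ ts ∈ (Finset.HasAntidiagonal.antidiagonal n).filter
        (fun ts => 1 ≤ ts.1 ∧ 1 ≤ ts.2), F ts.1 ts.2 / ((ts.1 : ℝ) * (ts.2 : ℝ)) := by
  classical
  set D := (Finset.HasAntidiagonal.antidiagonal n).filter
    (fun ts : ℕ × ℕ => 1 ≤ ts.1 ∧ 1 ≤ ts.2) with hD
  -- A permutation with distinct cycle lengths is met by two ordered pairs (t, s). The weight 1/2
  -- compensates for this, so the weights over each γ add up to 1.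
  set c : ℕ × ℕ → ℝ := fun ts => if ts.1 = ts.2 then 1 else 1 / 2 with hc
  have hmemD : ∀ ts, ts ∈ D ↔ ts.1 + ts.2 = n ∧ 1 ≤ ts.1 ∧ 1 ≤ ts.2 := by
    intro ts
    rw [hD, Finset.mem_filter, Finset.HasAntidiagonal.mem_antidiagonal]
  have hterm : ∀ ts ∈ D, (n.factorial : ℝ) / 2 * (F ts.1 ts.2 / ((ts.1 : ℝ) * (ts.2 : ℝ)))
      = ∑ γ : Perm (Fin n) with cycleLengths γ = {ts.1, ts.2}, c ts * f γ := by
    rintro ⟨t, s⟩ hts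
    obtain ⟨h1, h2, h3⟩ := (hmemD _).1 hts
    simp only at h1 h2 h3 ⊢
    rw [Finset.sum_congr rfl fun γ hγ => by rw [hF γ t s (Finset.mem_filter.1 hγ).2],
      Finset.sum_const, nsmul_eq_mul, ← mul_card_cycleLengths_eq n t s h2 h3 h1]
    have ht : (t : ℝ) ≠ 0 := by positivity
    have hs : (s : ℝ) ≠ 0 := by positivity
    simp only [hc]
    push_cast
    split_ifs <;> field_simp
  have hweight : ∀ γ : Perm (Fin n), ∑ ts ∈ D with cycleLengths γ = {ts.1, ts.2}, c ts
      = if cycleCount γ = 2 then 1 else 0 := by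
    intro γ
    split_ifs with hγ
    · rw [← card_cycleLengths, Multiset.card_eq_two] at hγ
      obtain ⟨a, b, hab⟩ := hγ
      have hsum := sum_cycleLengths γ
      have hpos : ∀ x ∈ cycleLengths γ, 0 < x := fun x hx => γ.partition.parts_pos hx
      rw [hab] at hsum hpos
      have ha : 1 ≤ a := hpos a (by simp)
      have hb : 1 ≤ b := hpos b (by simp)
      simp only [Multiset.insert_eq_cons, Multiset.sum_cons, Multiset.sum_singleton,
        Fintype.card_fin] at hsum
      have hfil : D.filter (fun ts : ℕ × ℕ => cycleLengths γ = {ts.1, ts.2}) = {(a, b), (b, a)} := by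
        ext ⟨t, s⟩
        rw [Finset.mem_filter, hmemD, hab, Finset.mem_insert, Finset.mem_singleton,
          Prod.mk.injEq, Prod.mk.injEq]
        simp only [Multiset.insert_eq_cons]
        constructor
        · rintro ⟨-, h⟩
          rw [Multiset.cons_eq_cons] at h
          rcases h with ⟨rfl, h⟩ | ⟨-, cs, h1, h2⟩
          · left
            exact ⟨rfl, (Multiset.singleton_inj.1 h).symm⟩
          · right
            have e1 := congrArg Multiset.card h1
            simp only [Multiset.card_singleton, Multiset.card_cons] at e1
            have e2 : cs = 0 := Multiset.card_eq_zero.1 (by omega)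
            subst e2
            rw [Multiset.cons_zero, Multiset.singleton_inj] at h1 h2
            exact ⟨h1.symm, h2⟩
        · rintro (⟨rfl, rfl⟩ | ⟨rfl, rfl⟩)
          · exact ⟨⟨hsum, ha, hb⟩, rfl⟩
          · exact ⟨⟨by omega, hb, ha⟩, Multiset.pair_comm _ _⟩
      rw [hfil]
      by_cases h : a = b
      · subst h
        simp [hc]
      · have h' : b ≠ a := fun e => h e.symm
        rw [Finset.sum_pair (by simp [h])]
        simp only [hc, if_neg h, if_neg h']
        norm_num
    · refine Finset.sum_eq_zero fun ts hts => ?_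
      refine absurd ?_ hγ
      rw [← card_cycleLengths, (Finset.mem_filter.1 hts).2]
      rfl
  rw [Finset.mul_sum, Finset.sum_congr rfl hterm]
  simp only [Finset.sum_filter (s := (Finset.univ : Finset (Perm (Fin n))))]
  rw [Finset.sum_comm]
  refine Finset.sum_congr rfl fun γ _ => ?_
  rw [← Finset.sum_filter, ← Finset.sum_mul, hweight]
  split_ifs <;> simp

/-- The annular sum that defines `h_n`, for a general sequence of cumulants. -/
noncomputable def annularCoeff (κ : ℕ → ℝ) (n : ℕ) : ℝ :=
  (n : ℝ) / 2 * ∑ ts ∈ (Finset.HasAntidiagonal.antidiagonal n).filter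
      (fun ts => 1 ≤ ts.1 ∧ 1 ≤ ts.2),
    ∑ σ ∈ annularNC ts.1 ts.2, cycleProd κ σ / ((ts.1 : ℝ) * (ts.2 : ℝ))

theorem cycleProd_congr {κ κ' : ℕ → ℝ} (h : ∀ j, 1 ≤ j → κ j = κ' j) {n : ℕ}
    (σ : Perm (Fin n)) : cycleProd κ σ = cycleProd κ' σ := by
  rw [cycleProd, cycleProd]
  congr 1
  exact Multiset.map_congr rfl fun x hx => h x (σ.partition.parts_pos hx)

theorem annularCoeff_congr {κ κ' : ℕ → ℝ} (h : ∀ j, 1 ≤ j → κ j = κ' j) (n : ℕ) :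
    annularCoeff κ n = annularCoeff κ' n := by
  simp only [annularCoeff, cycleProd_congr h]

open scoped Classical in
/-- The transitive pairs whose cycle count is one less than maximal enumerate the annular
non-crossing permutations. -/
theorem sum_transitivePair_eq_annularCoeff (κ : ℕ → ℝ) (n : ℕ) :
    ∑ p : Perm (Fin (n + 1)) × Perm (Fin (n + 1)) with
        TransitivePair p.1 p.2 ∧ cycleCount p.1 + cycleCount p.2 = n + 1, cycleWeight κ p.1
      = n.factorial * annularCoeff κ (n + 1) := by
  rw [sum_transitivePair_eq_annularSum κ (n + 1) (by omega),
    sum_cycleCount_eq_two (n + 1) _ fun t s => ∑ σ ∈ annularNC t s, cycleProd κ σ]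
  · rw [annularCoeff, Nat.factorial_succ]
    simp only [Finset.sum_div]
    push_cast
    ring
  · intro γ t s h
    have hsum := sum_cycleLengths γ
    have ht : 0 < t := γ.partition.parts_pos (show t ∈ cycleLengths γ by rw [h]; simp)
    have hs : 0 < s := γ.partition.parts_pos (show s ∈ cycleLengths γ by rw [h]; simp)
    rw [h] at hsum
    simp only [Multiset.insert_eq_cons, Multiset.sum_cons, Multiset.sum_singleton,
      Fintype.card_fin] at hsum
    rw [← annularSum_annularGamma, ← annularSum_permCongr κ (finCongr hsum)]
    refine annularSum_eq_of_cycleLengths κ ?_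
    rw [cycleLengths_permCongr, cycleLengths_annularGamma t s ht hs, h]

/-! ### Root moments and finite free cumulants -/

theorem exists_fin_map_eq {α : Type*} (s : Multiset α) :
    ∃ f : Fin (Multiset.card s) → α, Multiset.map f Finset.univ.val = s := by
  induction s using Quotient.inductionOn with
  | _ l =>
    refine ⟨l.get, ?_⟩
    change Multiset.map l.get (Finset.univ : Finset (Fin l.length)).val = (l : Multiset α)
    rw [Fin.univ_val_map, List.ofFn_get]

/-- Newton's identities for a multiset. -/
theorem newton_multiset (s : Multiset ℝ) (n : ℕ) :
    ((n + 1 : ℕ) : ℝ) * ((-1) ^ (n + 1) * s.esymm (n + 1))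
      = -∑ j ∈ Finset.range (n + 1), (s.map fun x => x ^ (j + 1)).sum
        * ((-1) ^ (n - j) * s.esymm (n - j)) := by
  obtain ⟨f, hf⟩ := exists_fin_map_eq s
  have h := congrArg (MvPolynomial.aeval f)
    (MvPolynomial.mul_esymm_eq_sum (Fin (Multiset.card s)) ℝ (n + 1))
  have hp : ∀ k, MvPolynomial.aeval f (MvPolynomial.psum (Fin (Multiset.card s)) ℝ k)
      = (s.map fun x => x ^ k).sum := by
    intro k
    rw [MvPolynomial.psum, map_sum]
    conv_rhs => rw [← hf, Multiset.map_map]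
    simp [List.sum_ofFn]
  simp only [map_mul, map_natCast, map_pow, map_neg, map_one, map_sum,
    MvPolynomial.aeval_esymm_eq_multiset_esymm, hf, hp] at h
  rw [Finset.sum_filter, Finset.Nat.sum_antidiagonal_eq_sum_range_succ (fun i j =>
    if i < n + 1 then (-1) ^ i * s.esymm i * (s.map fun x => x ^ j).sum else 0),
    Finset.sum_range_succ, if_neg (lt_irrefl _), add_zero, ← Finset.sum_range_reflect] at h
  rw [mul_left_comm, h, ← mul_assoc, ← pow_add,
    show n + 1 + (n + 1 + 1) = 2 * (n + 1) + 1 by ring, pow_succ, pow_mul]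
  simp only [even_two, Even.neg_pow, one_pow, one_mul, neg_mul]
  congr 1
  refine Finset.sum_congr rfl fun j hj => ?_
  have := Finset.mem_range.1 hj
  rw [if_pos (by omega), show n + 1 - 1 - j = n - j by omega,
    show n + 1 - (n - j) = j + 1 by omega]
  ring

theorem newton_polynomial {d : ℕ} {p : Polynomial ℝ} (hp : IsMonicRealRooted d p) (hd : 1 ≤ d)
    (n : ℕ) (hn : n + 1 ≤ d) :
    ((n + 1 : ℕ) : ℝ) * p.coeff (d - (n + 1))
      = -(d : ℝ) * ∑ j ∈ Finset.range (n + 1), rootMoment p (j + 1) * p.coeff (d - (n - j)) := by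
  obtain ⟨hm, hdeg, hs⟩ := hp
  have hcard : Multiset.card p.roots = p.natDegree := hs.natDegree_eq_card_roots.symm
  have hc : ∀ k ≤ d, p.coeff (d - k) = (-1) ^ k * p.roots.esymm k := by
    intro k hk
    rw [Polynomial.coeff_eq_esymm_roots_of_card hcard (by omega), hm.leadingCoeff, one_mul, hdeg,
      Nat.sub_sub_self hk]
  rw [hc _ hn, newton_multiset, neg_mul, Finset.mul_sum]
  congr 1
  refine Finset.sum_congr rfl fun j _ => ?_
  have hd' : (d : ℝ) ≠ 0 := by positivity
  rw [hc _ (by omega), rootMoment, hdeg]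
  field_simp

theorem finiteFreeCumulant_succ (p : Polynomial ℝ) (n : ℕ) :
    finiteFreeCumulant p (n + 1) = (-(p.natDegree : ℝ)) ^ n / n.factorial *
      blockSum (normCoeff p) (fun m => (-1) ^ (m - 1) * ((m - 1).factorial : ℝ))
        (Finset.univ : Finset (Fin (n + 1))) := by
  rw [finiteFreeCumulant, sum_finpartition (fun P => (-1) ^ (P.card - 1) *
    ((P.card - 1).factorial : ℝ) * ∏ V ∈ P, normCoeff p V.card)]
  rfl

/-- `blockSum_log_inversion` and the recursion for `permSum` are the same recursion once the powers
of -d and the factorials are distributed. -/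
theorem permSum_finiteFreeCumulant (p : Polynomial ℝ) (hm : p.Monic) (n : ℕ) :
    permSum (fun k => -(p.natDegree : ℝ) * finiteFreeCumulant p k) n
      = (-(p.natDegree : ℝ)) ^ n * normCoeff p n := by
  have h0 : normCoeff p 0 = 1 := by
    simp [normCoeff, hm.coeff_natDegree]
  induction n using Nat.strong_induction_on with
  | _ n ih =>
    cases n with
    | zero => simp [permSum_zero, h0]
    | succ n =>
      rw [permSum_succ, blockSum_log_inversion (normCoeff p)
        (fun m => (-1) ^ (m - 1) * ((m - 1).factorial : ℝ)) (fun m => by simp) (normCoeff p) h0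
        (fun _ _ => rfl) n, Finset.mul_sum]
      refine Finset.sum_congr rfl fun j hj => ?_
      have hj : j ≤ n := by simpa [Nat.lt_succ_iff] using hj
      rw [ih (n - j) (by omega), finiteFreeCumulant_succ]
      have h1 : (j.factorial : ℝ) ≠ 0 := by positivity
      have e : (-(p.natDegree : ℝ)) ^ (n + 1)
          = (-(p.natDegree : ℝ)) ^ (n - j) * ((-(p.natDegree : ℝ)) ^ j * -(p.natDegree : ℝ)) := by
        rw [← pow_succ, ← pow_add]
        congr 1
        omega
      rw [e]
      field_simp

theorem permSum_neg_natCast (d k : ℕ) :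
    permSum (fun _ => -(d : ℝ)) k = (-1) ^ k * (d.descFactorial k : ℝ) := by
  induction k with
  | zero => simp [permSum_zero]
  | succ k ih =>
    rw [permSum_const_succ, ih, Nat.descFactorial_succ]
    rcases Nat.lt_or_ge d k with h | h
    · rw [Nat.descFactorial_eq_zero_iff_lt.2 h]
      simp
    · push_cast [Nat.cast_sub h]
      ring

/-- At N = -d the rising factorial is (-1)^k k! times a binomial coefficient, which undoes the
normalization of the a_k. The bound k ≤ d keeps that binomial coefficient non-zero. -/
theorem coeff_risingSeries_finiteFreeCumulant {d : ℕ} {p : Polynomial ℝ}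
    (hp : IsMonicRealRooted d p) (hd : 1 ≤ d) (k : ℕ) (hk : k ≤ d) :
    PowerSeries.coeff k (risingSeries (finiteFreeCumulant p) (-(d : ℝ)) 0) = p.coeff (d - k) := by
  have hN : (-(d : ℝ)) ^ k ≠ 0 := pow_ne_zero _ (neg_ne_zero.2 (by positivity))
  have h := permSum_finiteFreeCumulant p hp.1 k
  rw [hp.2.1] at h
  rw [coeff_risingSeries, add_zero, h, permSum_neg_natCast, normCoeff, hp.2.1,
    Nat.descFactorial_eq_factorial_mul_choose]
  have h1 : (k.factorial : ℝ) ≠ 0 := by positivity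
  have h2 : (d.choose k : ℝ) ≠ 0 := by
    exact_mod_cast (Nat.choose_pos hk).ne'
  have h3 : ((-1 : ℝ) ^ k) * (-1) ^ k = 1 := by rw [← mul_pow]; simp
  push_cast
  field_simp
  linear_combination p.coeff (d - k) * h3

/-- The root moments are the moments attached to the finite free cumulants. -/
theorem rootMoment_eq_coeff_momentSeries {d : ℕ} {p : Polynomial ℝ}
    (hp : IsMonicRealRooted d p) (hd : 1 ≤ d) (n : ℕ) (hn : n + 1 ≤ d) :
    rootMoment p (n + 1)
      = PowerSeries.coeff (n + 1) (momentSeries (finiteFreeCumulant p) (-(d : ℝ))) := by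
  have hN : -(d : ℝ) ≠ 0 := neg_ne_zero.2 (by positivity)
  induction n using Nat.strong_induction_on with
  | _ n ih =>
    have h1 := newton_polynomial hp hd n hn
    have h2 := coeff_succ_risingSeries_newton (finiteFreeCumulant p) (-(d : ℝ)) hN n
    rw [coeff_risingSeries_finiteFreeCumulant hp hd (n + 1) hn, h1] at h2
    have h3 := mul_left_cancel₀ hN h2
    rw [Finset.sum_range_succ, Finset.sum_range_succ, Nat.sub_self, Nat.sub_zero,
      coeff_zero_risingSeries, mul_one, ← hp.2.1, hp.1.coeff_natDegree, mul_one, hp.2.1] at h3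
    rw [Finset.sum_congr rfl fun j hj => by
      rw [ih j (Finset.mem_range.1 hj) (by have := Finset.mem_range.1 hj; omega),
        ← coeff_risingSeries_finiteFreeCumulant hp hd (n - j) (by omega)]] at h3
    exact add_left_cancel h3

/-! ### First-order expansions and dual numbers -/

/-- Sequences together with their first-order expansion `x_d = a + b / d + o(1 / d)`, encoded as the
dual number `a + b ε`. -/
def expansionSubring : Subring ((ℕ → ℝ) × DualNumber ℝ) where
  carrier := {p | Tendsto p.1 atTop (𝓝 p.2.fst) ∧
    Tendsto (fun d : ℕ => (d : ℝ) * (p.1 d - p.2.fst)) atTop (𝓝 p.2.snd)}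
  mul_mem' := by
    rintro ⟨x, a⟩ ⟨y, b⟩ ⟨hx, hx'⟩ ⟨hy, hy'⟩
    refine ⟨hx.mul hy, ?_⟩
    have := (hx'.mul hy).add (hy'.const_mul a.fst)
    simp only [Prod.mk_mul_mk, TrivSqZeroExt.fst_mul, TrivSqZeroExt.snd_mul, Pi.mul_apply,
      smul_eq_mul, MulOpposite.smul_eq_mul_unop, MulOpposite.unop_op] at this ⊢
    rw [add_comm, mul_comm a.snd] at *
    refine (this.congr fun d => by ring).trans (le_of_eq ?_)
    congr 1
    ring
  one_mem' := by
    refine ⟨tendsto_const_nhds, ?_⟩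
    simp
  add_mem' := by
    rintro ⟨x, a⟩ ⟨y, b⟩ ⟨hx, hx'⟩ ⟨hy, hy'⟩
    refine ⟨hx.add hy, (hx'.add hy').congr fun d => ?_⟩
    simp only [Prod.mk_add_mk, TrivSqZeroExt.fst_add, Pi.add_apply]
    ring
  zero_mem' := by
    refine ⟨tendsto_const_nhds, ?_⟩
    simp
  neg_mem' := by
    rintro ⟨x, a⟩ ⟨hx, hx'⟩
    refine ⟨hx.neg, hx'.neg.congr fun d => ?_⟩
    simp only [Prod.neg_mk, TrivSqZeroExt.fst_neg, Pi.neg_apply]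
    ring

theorem mem_expansionSubring {x : ℕ → ℝ} {z : DualNumber ℝ} :
    (x, z) ∈ expansionSubring ↔ Tendsto x atTop (𝓝 z.fst) ∧
      Tendsto (fun d : ℕ => (d : ℝ) * (x d - z.fst)) atTop (𝓝 z.snd) :=
  Iff.rfl

theorem expansion_unique {x : ℕ → ℝ} {z w : DualNumber ℝ} (h : (x, z) ∈ expansionSubring)
    (h' : (x, w) ∈ expansionSubring) : z = w := by
  rw [mem_expansionSubring] at h h'
  have h1 := tendsto_nhds_unique h.1 h'.1
  rw [h1] at h
  exact TrivSqZeroExt.ext h1 (tendsto_nhds_unique h.2 h'.2)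

theorem expansion_congr {x y : ℕ → ℝ} {z : DualNumber ℝ} (h : (x, z) ∈ expansionSubring)
    (hxy : x =ᶠ[atTop] y) : (y, z) ∈ expansionSubring := by
  rw [mem_expansionSubring] at h ⊢
  exact ⟨h.1.congr' hxy, h.2.congr' (hxy.mono fun d hd => by simp only [hd])⟩

theorem expansion_const (a : ℝ) :
    ((fun _ => a, TrivSqZeroExt.inl a) : (ℕ → ℝ) × DualNumber ℝ) ∈ expansionSubring := by
  rw [mem_expansionSubring]
  simp

theorem exists_expansion_inv {x : ℕ → ℝ} {z : DualNumber ℝ} (h : (x, z) ∈ expansionSubring)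
    (hz : z.fst ≠ 0) : ∃ w, ((fun d => (x d)⁻¹), w) ∈ expansionSubring := by
  rw [mem_expansionSubring] at h
  -- The inverse of a + bε, namely 1/a - (b/a²) ε.
  refine ⟨TrivSqZeroExt.inl z.fst⁻¹ + TrivSqZeroExt.inr (-z.snd * (z.fst⁻¹ * z.fst⁻¹)), ?_⟩
  rw [mem_expansionSubring]
  simp only [TrivSqZeroExt.fst_add, TrivSqZeroExt.snd_add, TrivSqZeroExt.fst_inl,
    TrivSqZeroExt.fst_inr, TrivSqZeroExt.snd_inl, TrivSqZeroExt.snd_inr, add_zero, zero_add]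
  have h1 := h.1.inv₀ hz
  refine ⟨h1, ?_⟩
  refine (h.2.neg.mul (h1.mul_const z.fst⁻¹)).congr' ?_
  filter_upwards [h.1.eventually_ne hz] with d hd
  field_simp
  ring

theorem expansion_eps :
    ((fun d : ℕ => (-(d : ℝ))⁻¹, -DualNumber.eps) : (ℕ → ℝ) × DualNumber ℝ) ∈ expansionSubring := by
  rw [mem_expansionSubring]
  have h0 : (-DualNumber.eps : DualNumber ℝ).fst = 0 := by simp
  have h1 : (-DualNumber.eps : DualNumber ℝ).snd = -1 := by simp
  rw [h0, h1]
  constructor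
  · simp only [inv_neg]
    simpa using (tendsto_inv_atTop_nhds_zero_nat (𝕜 := ℝ)).neg
  · refine tendsto_const_nhds.congr' ?_
    filter_upwards [eventually_ge_atTop 1] with d hd
    have : (d : ℝ) ≠ 0 := by positivity
    field_simp
    ring

/-- Every dual number is the expansion of some sequence. -/
theorem exists_expansion (z : DualNumber ℝ) :
    ((fun d : ℕ => z.fst + -(-(d : ℝ))⁻¹ * z.snd, z) : (ℕ → ℝ) × DualNumber ℝ)
      ∈ expansionSubring := by
  have h := expansionSubring.add_mem (expansion_const z.fst)
    (expansionSubring.mul_mem (expansionSubring.neg_mem expansion_eps) (expansion_const z.snd))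
  have e : TrivSqZeroExt.inl z.fst + -(-DualNumber.eps) * TrivSqZeroExt.inl z.snd = z := by
    refine TrivSqZeroExt.ext ?_ ?_ <;> simp
  have : ((fun d : ℕ => z.fst + -(-(d : ℝ))⁻¹ * z.snd, z) : (ℕ → ℝ) × DualNumber ℝ)
      = (fun _ => z.fst, TrivSqZeroExt.inl z.fst)
        + -(fun d : ℕ => (-(d : ℝ))⁻¹, -DualNumber.eps)
          * (fun _ => z.snd, TrivSqZeroExt.inl z.snd) := by
    refine Prod.ext rfl e.symm
  rw [this]
  exact h

/-- Choose real sequences with expansions `κ j`, apply the real identity for each d, and compare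
expansions. -/
theorem transPoly_zero_dual (κ : ℕ → DualNumber ℝ) (n : ℕ) :
    transPoly 0 κ (n + 1)
      = (n.factorial : DualNumber ℝ) * ncSum κ (Finset.range (n + 1)) := by
  set x : ℕ → ℕ → ℝ := fun d j => (κ j).fst + -(-(d : ℝ))⁻¹ * (κ j).snd with hx
  have hκ : ∀ j, ((fun d => x d j, κ j) : (ℕ → ℝ) × DualNumber ℝ) ∈ expansionSubring :=
    fun j => exists_expansion (κ j)
  have h1 := transPoly_mem expansionSubring expansionSubring.zero_mem hκ (n + 1)
  have h2 := expansionSubring.mul_mem (natCast_mem expansionSubring n.factorial)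
    (ncSum_mem expansionSubring hκ (Finset.range (n + 1)))
  rw [show (0 : (ℕ → ℝ) × DualNumber ℝ) = ((fun _ => 0), 0) from rfl,
    transPoly_pair (fun _ => 0) 0 x κ] at h1
  rw [ncSum_pair x κ] at h2
  refine expansion_unique h1 ?_
  convert h2 using 1
  refine Prod.ext (funext fun d => ?_) rfl
  exact transPoly_zero (x d) n

theorem eps_mul_pow (k : ℕ) (hk : 2 ≤ k) : (-DualNumber.eps : DualNumber ℝ) ^ k = 0 := by
  obtain ⟨j, rfl⟩ := Nat.exists_eq_add_of_le hk
  rw [pow_add, pow_two, neg_mul_neg, DualNumber.eps_mul_eps, zero_mul]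

theorem transPoly_eps (κ : ℕ → DualNumber ℝ) (n : ℕ) :
    transPoly (-DualNumber.eps) κ (n + 1)
      = (n.factorial : DualNumber ℝ) * (ncSum κ (Finset.range (n + 1))
        - TrivSqZeroExt.inr (annularCoeff (fun j => (κ j).fst) (n + 1))) := by
  classical
  -- Since ε² = 0, only exponents 0 and 1 survive; on n + 1 points these are the cycle totals n + 2
  -- and n + 1.
  have hsplit : transPoly (-DualNumber.eps) κ (n + 1) = transPoly 0 κ (n + 1)
      + -DualNumber.eps * ∑ p : Perm (Fin (n + 1)) × Perm (Fin (n + 1)) with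
        TransitivePair p.1 p.2 ∧ cycleCount p.1 + cycleCount p.2 = n + 1, cycleWeight κ p.1 := by
    rw [← Finset.filter_filter, Finset.sum_filter (fun p : Perm (Fin (n + 1)) × Perm (Fin (n + 1)) =>
      cycleCount p.1 + cycleCount p.2 = n + 1), Finset.mul_sum, transPoly, transPoly,
      ← Finset.sum_add_distrib]
    refine Finset.sum_congr rfl fun p hp => ?_
    have h := (Finset.mem_filter.1 hp).2.cycleCount_add_le
    rw [Fintype.card_fin] at h
    rcases eq_or_ne (cycleCount p.1 + cycleCount p.2) (n + 1) with h1 | h1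
    · rw [if_pos h1, h1]
      simp
    · rw [if_neg h1, mul_zero, add_zero]
      rcases eq_or_ne (cycleCount p.1 + cycleCount p.2) (n + 2) with h2 | h2
      · rw [h2]
        simp
      · rw [eps_mul_pow _ (by omega), zero_pow (by omega)]
  have hann : (-DualNumber.eps : DualNumber ℝ) * ∑ p : Perm (Fin (n + 1)) × Perm (Fin (n + 1)) with
        TransitivePair p.1 p.2 ∧ cycleCount p.1 + cycleCount p.2 = n + 1, cycleWeight κ p.1
      = -TrivSqZeroExt.inr (n.factorial * annularCoeff (fun j => (κ j).fst) (n + 1)) := by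
    have hfst : ∀ w : DualNumber ℝ, -DualNumber.eps * w = -TrivSqZeroExt.inr w.fst := by
      intro w
      refine TrivSqZeroExt.ext ?_ ?_ <;> simp
    rw [hfst, ← sum_transitivePair_eq_annularCoeff]
    congr 2
    change TrivSqZeroExt.fstHom ℝ ℝ ℝ _ = _
    rw [map_sum]
    exact Finset.sum_congr rfl fun p _ =>
      (map_cycleWeight ((TrivSqZeroExt.fstHom ℝ ℝ ℝ : DualNumber ℝ →ₐ[ℝ] ℝ) : DualNumber ℝ →+* ℝ)
        κ p.1).symm
  have hnat : ∀ a : ℝ, ((n.factorial : ℕ) : DualNumber ℝ) * TrivSqZeroExt.inr a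
      = TrivSqZeroExt.inr ((n.factorial : ℝ) * a) := by
    intro a
    refine TrivSqZeroExt.ext ?_ ?_ <;> simp [mul_comm]
  rw [hsplit, transPoly_zero_dual, hann, mul_sub, hnat, sub_eq_add_neg]

/-! ### Cumulants are determined by their non-crossing sums -/

/-- Equal non-crossing sums give the same series M, and then the functional equation is triangular
in the cumulants with diagonal entry 1. -/
theorem eq_of_ncSum_eq {u v : ℕ → ℝ}
    (h : ∀ n, ncSum u (Finset.range (n + 1)) = ncSum v (Finset.range (n + 1))) (n : ℕ) :
    u (n + 1) = v (n + 1) := by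
  have hM : ncSeries u = ncSeries v := by
    ext n
    cases n with
    | zero => rw [coeff_zero_ncSeries, coeff_zero_ncSeries]
    | succ n => simp only [ncSeries, PowerSeries.coeff_mk, h]
  have hu := isCumulantSystem_ncSeries u
  have hv := isCumulantSystem_ncSeries v
  rw [← hM] at hv
  induction n using Nat.strong_induction_on with
  | _ n ih =>
    have h1 := (hu.2 (n + 1) (by omega)).symm.trans (hv.2 (n + 1) (by omega))
    rw [Finset.sum_range_succ, Finset.sum_range_succ, Finset.sum_congr rfl fun j hj => by
      rw [ih j (Finset.mem_range.1 hj)], Nat.sub_self, coeff_zero_deformedPow _ _ hu.1] at h1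
    simpa using h1

/-! ### The derivative of the functional equation -/

theorem coeff_pow_eq_zero {R : Type*} [CommRing R] (M : PowerSeries R) {n k : ℕ} (h : n < k) :
    PowerSeries.coeff n ((PowerSeries.X * M) ^ k) = 0 := by
  rw [mul_pow, PowerSeries.coeff_X_pow_mul', if_neg (by omega)]

theorem coeff_subst_X_mul (M f : PowerSeries ℝ) (n : ℕ) :
    PowerSeries.coeff n (f.subst (PowerSeries.X * M) : PowerSeries ℝ)
      = ∑ k ∈ Finset.range (n + 1), PowerSeries.coeff k f
        * PowerSeries.coeff n ((PowerSeries.X * M) ^ k) := by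
  rw [PowerSeries.coeff_subst' (PowerSeries.HasSubst.of_constantCoeff_zero' (by simp)),
    finsum_eq_sum_of_support_subset]
  · rfl
  · intro k hk
    rw [Finset.coe_range, Set.mem_Iio]
    by_contra hlt
    refine hk ?_
    simp only
    rw [coeff_pow_eq_zero M (by omega), smul_zero]

theorem coeff_subst_X_mul_mul (M f W : PowerSeries ℝ) (n : ℕ) :
    PowerSeries.coeff n ((f.subst (PowerSeries.X * M) : PowerSeries ℝ) * W)
      = ∑ k ∈ Finset.range (n + 1), PowerSeries.coeff k f
        * PowerSeries.coeff n ((PowerSeries.X * M) ^ k * W) := by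
  simp only [PowerSeries.coeff_mul, Finset.mul_sum]
  rw [Finset.sum_comm]
  refine Finset.sum_congr rfl fun p hp => ?_
  have hp := Finset.HasAntidiagonal.mem_antidiagonal.1 hp
  rw [coeff_subst_X_mul, Finset.sum_mul]
  rw [← Finset.sum_subset (Finset.range_subset_range.2 (show p.1 + 1 ≤ n + 1 by omega))]
  · exact Finset.sum_congr rfl fun k _ => by ring
  · intro k _ hk
    rw [Finset.mem_range] at hk
    rw [coeff_pow_eq_zero M (by omega), zero_mul, mul_zero]

theorem add_mul_pow_of_sq_zero {R : Type*} [CommRing R] {e : R} (he : e * e = 0) (a b : R)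
    (k : ℕ) : (a + e * b) ^ k = a ^ k + e * (k * a ^ (k - 1) * b) := by
  induction k with
  | zero => simp
  | succ k ih =>
    rw [pow_succ, ih]
    cases k with
    | zero => simp
    | succ k =>
      simp only [Nat.add_sub_cancel]
      push_cast
      linear_combination ((k + 1) * a ^ k * b * b) * he

/-- The first-order part of the generating function of non-crossing sums over the dual numbers. -/
theorem ncSeries_derivative (κ : ℕ → DualNumber ℝ) :
    (PowerSeries.mk fun n => (PowerSeries.coeff n (ncSeries κ)).snd)
      = PowerSeries.X *
        ((PowerSeries.mk fun n => (κ (n + 1)).snd).subst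
          (PowerSeries.X * ncSeries fun j => (κ j).fst) : PowerSeries ℝ)
        * PowerSeries.derivative ℝ (PowerSeries.X * ncSeries fun j => (κ j).fst) := by
  set M : PowerSeries ℝ := ncSeries fun j => (κ j).fst with hM
  set M₁ : PowerSeries ℝ := PowerSeries.mk fun n => (PowerSeries.coeff n (ncSeries κ)).snd with hM₁
  set G : PowerSeries ℝ := PowerSeries.X * M with hG
  have hGs : PowerSeries.HasSubst G := PowerSeries.HasSubst.of_constantCoeff_zero' (by simp [hG])
  have hfst : ∀ n, (PowerSeries.coeff n (ncSeries κ)).fst = PowerSeries.coeff n M := by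
    intro n
    rw [hM, ncSeries, ncSeries, PowerSeries.coeff_mk, PowerSeries.coeff_mk]
    exact (map_ncSum ((TrivSqZeroExt.fstHom ℝ ℝ ℝ : DualNumber ℝ →ₐ[ℝ] ℝ) : DualNumber ℝ →+* ℝ)
      κ _).symm
  set ι : ℝ →+* DualNumber ℝ := TrivSqZeroExt.inlHom ℝ ℝ with hι
  set e : PowerSeries (DualNumber ℝ) := PowerSeries.C DualNumber.eps with he
  have hee : e * e = 0 := by rw [he, ← map_mul, DualNumber.eps_mul_eps, map_zero]
  have hdec : PowerSeries.X * ncSeries κ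
      = PowerSeries.map ι G + e * PowerSeries.map ι (PowerSeries.X * M₁) := by
    have h1 : ncSeries κ = PowerSeries.map ι M + e * PowerSeries.map ι M₁ := by
      refine PowerSeries.ext fun n => ?_
      rw [map_add, he, PowerSeries.coeff_C_mul, PowerSeries.coeff_map, PowerSeries.coeff_map,
        ← hfst n, hM₁, PowerSeries.coeff_mk]
      refine TrivSqZeroExt.ext ?_ ?_ <;> simp [hι]
    rw [h1, hG, map_mul, map_mul, PowerSeries.map_X]
    ring
  have hpow : ∀ k n : ℕ, PowerSeries.coeff n ((PowerSeries.X * ncSeries κ) ^ k)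
      = ι (PowerSeries.coeff n (G ^ k))
        + DualNumber.eps * ι (PowerSeries.coeff n ((k : PowerSeries ℝ) * G ^ (k - 1) * (PowerSeries.X * M₁))) := by
    intro k n
    rw [hdec, add_mul_pow_of_sq_zero hee, ← PowerSeries.coeff_map, ← PowerSeries.coeff_map,
      ← PowerSeries.coeff_C_mul, ← he, ← map_add]
    simp only [map_mul (PowerSeries.map ι), map_natCast, map_pow (PowerSeries.map ι)]
  -- The value κ 0 is meaningless and is replaced by 0, so that the functional equation reads M = 1
  -- + C(xM).
  set C : PowerSeries ℝ := PowerSeries.mk fun k => if k = 0 then 0 else (κ k).fst with hC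
  set R : PowerSeries ℝ := PowerSeries.mk fun n => (κ (n + 1)).snd with hR
  have hFE : M = 1 + C.subst G := by
    ext n
    rw [map_add, hG, coeff_subst_X_mul, PowerSeries.coeff_one, ← hG]
    rcases Nat.eq_zero_or_pos n with rfl | hn
    · simp [hM, coeff_zero_ncSeries, hC]
    · rw [hM, coeff_ncSeries _ n hn, ← hM, ← hG, if_neg hn.ne', zero_add]
      refine Finset.sum_congr rfl fun k _ => ?_
      rw [hC, PowerSeries.coeff_mk]
      split_ifs with hk
      · rw [hk, pow_zero, PowerSeries.coeff_one, if_neg hn.ne', mul_zero, mul_zero]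
      · rfl
  -- The ε-part of the functional equation: one term from varying the cumulants, one from varying M.
  have hFE₁ : M₁ = G * R.subst G
      + (PowerSeries.derivative ℝ C).subst G * (PowerSeries.X * M₁) := by
    have hXR : G * R.subst G = (PowerSeries.X * R).subst G := by
      rw [PowerSeries.subst_mul hGs, PowerSeries.subst_X hGs]
    ext n
    rw [hXR, map_add, hG, coeff_subst_X_mul, coeff_subst_X_mul_mul, ← hG]
    rcases Nat.eq_zero_or_pos n with rfl | hn
    · simp [hM₁, coeff_zero_ncSeries]
    · rw [hM₁, PowerSeries.coeff_mk, coeff_ncSeries _ n hn, ← hM₁]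
      have hsnd : ∀ k, (κ k * PowerSeries.coeff n ((PowerSeries.X * ncSeries κ) ^ k)).snd
          = (κ k).snd * PowerSeries.coeff n (G ^ k)
            + (κ k).fst * PowerSeries.coeff n ((k : PowerSeries ℝ) * G ^ (k - 1)
              * (PowerSeries.X * M₁)) := by
        intro k
        rw [hpow]
        simp [hι]
        ring
      have hsum : ∀ (s : Finset ℕ) (f : ℕ → DualNumber ℝ), (∑ k ∈ s, f k).snd
          = ∑ k ∈ s, (f k).snd := fun s f => map_sum (TrivSqZeroExt.sndHom ℝ ℝ) f s
      rw [hsum, Finset.sum_congr rfl fun k _ => hsnd k, Finset.sum_add_distrib]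
      congr 1
      · refine Finset.sum_congr rfl fun k _ => ?_
        cases k with
        | zero => simp [PowerSeries.coeff_one, hn.ne']
        | succ k => rw [PowerSeries.coeff_succ_X_mul, hR, PowerSeries.coeff_mk]
      · rw [Finset.sum_range_succ', Finset.sum_range_succ]
        -- Differentiating C shifts the index and leaves one extra top term, which vanishes because
        -- its order in x exceeds n.
        have hlast : PowerSeries.coeff n (G ^ n * (PowerSeries.X * M₁)) = 0 := by
          rw [hG, show (PowerSeries.X * M) ^ n * (PowerSeries.X * M₁)
            = PowerSeries.X ^ (n + 1) * (M ^ n * M₁) by ring, PowerSeries.coeff_X_pow_mul',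
            if_neg (by omega)]
        rw [hlast]
        simp only [Nat.cast_zero, zero_mul, map_zero, mul_zero, add_zero]
        refine Finset.sum_congr rfl fun k _ => ?_
        rw [PowerSeries.coeff_derivative, hC, PowerSeries.coeff_mk, if_neg (by omega),
          Nat.add_sub_cancel, mul_assoc, ← map_natCast (PowerSeries.C (R := ℝ)),
          PowerSeries.coeff_C_mul]
        push_cast
        ring
  have hD : PowerSeries.derivative ℝ M
      = (PowerSeries.derivative ℝ C).subst G * PowerSeries.derivative ℝ G := by
    conv_lhs => rw [hFE]
    rw [map_add, PowerSeries.derivative_one, zero_add, PowerSeries.derivative_subst hGs]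
  have hDG : PowerSeries.derivative ℝ G = M + PowerSeries.X * PowerSeries.derivative ℝ M := by
    rw [hG, Derivation.leibniz, PowerSeries.derivative_X, smul_eq_mul, smul_eq_mul, mul_one]
    ring
  have hM0 : M ≠ 0 := by
    intro h
    have := coeff_zero_ncSeries fun j => (κ j).fst
    rw [← hM, h] at this
    simp at this
  -- Multiply `hFE₁` by G' and eliminate C'(G) through M' = C'(G) G'. Since G' - xM' = M and G = xM,
  -- a common factor M remains to be cancelled.
  refine mul_right_cancel₀ hM0 ?_
  linear_combination PowerSeries.derivative ℝ G * hFE₁ - M₁ * hDG - PowerSeries.X * M₁ * hD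
    + PowerSeries.derivative ℝ G * R.subst G * hG

/-! ### Expansion of the finite-free cumulants -/

/-- The index 0 carries no meaning; an expansion there allows the cumulants to be treated as one
sequence over all of ℕ. -/
theorem exists_finiteFreeCumulant_zero_expansion (p : ℕ → Polynomial ℝ) :
    ∃ z, ((fun d => finiteFreeCumulant (p d) 0), z) ∈ expansionSubring := by
  have h : (fun d => finiteFreeCumulant (p d) 0)
      = fun _ => ((Finset.univ : Finset (SetPartition 0)).card : ℝ) := by
    funext d
    have hπ : ∀ π : SetPartition 0, π.parts = ∅ := by
      intro π
      refine Finset.eq_empty_of_forall_notMem fun V hV => ?_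
      obtain ⟨a, -⟩ := π.nonempty_of_mem_parts hV
      exact a.elim0
    simp [finiteFreeCumulant, hπ]
  rw [h]
  exact ⟨_, expansion_const _⟩

/-- The expansion of the moments of the root distributions. -/
noncomputable def momentExpansion (μ : Measure ℝ) (μ' : Polynomial ℝ →ₗ[ℝ] ℝ) :
    PowerSeries (DualNumber ℝ) :=
  PowerSeries.mk fun n => if n = 0 then 1 else
    TrivSqZeroExt.inl (measMoment μ n) + TrivSqZeroExt.inr (μ' (Polynomial.X ^ n))

variable {p : ℕ → Polynomial ℝ} {μ : Measure ℝ} {μ' : Polynomial ℝ →ₗ[ℝ] ℝ}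

theorem HasInfinitesimalDistribution.coeff_momentSeries_expansion
    (h : HasInfinitesimalDistribution p μ μ') (n : ℕ) :
    ((fun d : ℕ => PowerSeries.coeff n (momentSeries (finiteFreeCumulant (p d)) (-(d : ℝ)))),
      PowerSeries.coeff n (momentExpansion μ μ')) ∈ expansionSubring := by
  cases n with
  | zero =>
    have e : (fun d : ℕ => PowerSeries.coeff 0
        (momentSeries (finiteFreeCumulant (p d)) (-(d : ℝ)))) = 1 := by
      funext d
      simp [momentSeries]
    rw [e, momentExpansion, PowerSeries.coeff_mk, if_pos rfl]
    exact expansionSubring.one_mem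
  | succ n =>
    rw [momentExpansion, PowerSeries.coeff_mk, if_neg (Nat.succ_ne_zero n)]
    refine expansion_congr (x := fun d => rootMoment (p d) (n + 1)) ?_ ?_
    · rw [mem_expansionSubring]
      simpa using ⟨h.tendsto_moment (n + 1), h.tendsto_infinitesimal (n + 1)⟩
    · filter_upwards [eventually_ge_atTop (n + 1)] with d hd
      exact rootMoment_eq_coeff_momentSeries (h.realRooted d (by omega)) (by omega) n hd

theorem HasInfinitesimalDistribution.coeff_deformedPow_expansion
    (h : HasInfinitesimalDistribution p μ μ') (j n : ℕ) :
    ((fun d : ℕ => PowerSeries.coeff n (deformedPow (-(d : ℝ))⁻¹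
        (momentSeries (finiteFreeCumulant (p d)) (-(d : ℝ))) j)),
      PowerSeries.coeff n (deformedPow (-DualNumber.eps) (momentExpansion μ μ') j))
        ∈ expansionSubring := by
  rw [← coeff_deformedPow_pairSeries]
  refine coeff_deformedPow_mem expansionSubring expansion_eps (n := n) (fun i _ => ?_) j n le_rfl
  rw [pairSeries, PowerSeries.coeff_mk]
  exact h.coeff_momentSeries_expansion i

theorem HasInfinitesimalDistribution.exists_finiteFreeCumulant_expansion
    (h : HasInfinitesimalDistribution p μ μ') (n : ℕ) :
    ∃ z, ((fun d => finiteFreeCumulant (p d) n), z) ∈ expansionSubring := by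
  induction n using Nat.strong_induction_on with
  | _ n ih =>
    cases n with
    | zero => exact exists_finiteFreeCumulant_zero_expansion p
    | succ n =>
      have hM0 : PowerSeries.coeff 0 (momentExpansion μ μ') = 1 := by simp [momentExpansion]
      -- The highest cumulant enters the equation with coefficient ∏_{i ≤ n} (1 - i/d). It tends to
      -- 1 and is non-zero for d > n, so the equation can be solved for that cumulant.
      have hfst : (PowerSeries.coeff 0 (deformedPow (-DualNumber.eps)
          (momentExpansion μ μ') (n + 1))).fst = 1 := by
        rw [coeff_zero_deformedPow _ _ hM0]
        change TrivSqZeroExt.fstHom ℝ ℝ ℝ _ = _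
        rw [map_prod]
        refine Finset.prod_eq_one fun i _ => ?_
        simp
      obtain ⟨w, hw⟩ := exists_expansion_inv (h.coeff_deformedPow_expansion (n + 1) 0)
        (by rw [hfst]; exact one_ne_zero)
      choose! z hz using ih
      have hsum := expansionSubring.sum_mem (t := Finset.range n) fun j hj =>
        expansionSubring.mul_mem (hz (j + 1) (by have := Finset.mem_range.1 hj; omega))
          (h.coeff_deformedPow_expansion (j + 1) (n - j))
      have hall := expansionSubring.mul_mem
        (expansionSubring.sub_mem (h.coeff_momentSeries_expansion (n + 1)) hsum) hw
      refine ⟨_, expansion_congr hall ?_⟩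
      filter_upwards [eventually_ge_atTop (n + 1)] with d hd
      have hd0 : (d : ℝ) ≠ 0 := by
        have : 0 < d := by omega
        positivity
      have hsys := isCumulantSystem_momentSeries (finiteFreeCumulant (p d)) (-(d : ℝ))
        (neg_ne_zero.2 hd0)
      have hne : PowerSeries.coeff 0 (deformedPow (-(d : ℝ))⁻¹
          (momentSeries (finiteFreeCumulant (p d)) (-(d : ℝ))) (n + 1)) ≠ 0 := by
        rw [coeff_zero_deformedPow _ _ hsys.1, Finset.prod_ne_zero_iff]
        intro i hi h0
        have hi : (i : ℝ) < d := by
          have := Finset.mem_range.1 hi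
          exact_mod_cast (by omega : i < d)
        field_simp at h0
        linarith
      have h1 := hsys.2 (n + 1) (by omega)
      rw [Finset.sum_range_succ, Nat.sub_self] at h1
      simp only [Nat.add_sub_add_right] at h1
      simp only [Prod.fst_mul, Prod.fst_sub, Prod.fst_sum, Pi.mul_apply, Pi.sub_apply,
        Finset.sum_apply]
      rw [h1, add_sub_cancel_left, mul_inv_cancel_right₀ hne]

theorem HasInfinitesimalDistribution.measMoment_zero
    (h : HasInfinitesimalDistribution p μ μ') : measMoment μ 0 = 1 := by
  have := h.isProbabilityMeasure
  simp [measMoment]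

theorem HasInfinitesimalDistribution.map_one
    (h : HasInfinitesimalDistribution p μ μ') : μ' 1 = 0 := by
  rw [← pow_zero (Polynomial.X : Polynomial ℝ)]
  refine tendsto_nhds_unique (h.tendsto_infinitesimal 0) (tendsto_const_nhds.congr' ?_)
  filter_upwards [eventually_ge_atTop 1] with d hd
  obtain ⟨-, hdeg, hs⟩ := h.realRooted d hd
  have hc := hs.natDegree_eq_card_roots
  have hd0 : (d : ℝ) ≠ 0 := by positivity
  rw [h.measMoment_zero, rootMoment]
  simp [← hc, hdeg, hd0]

/-- The first-order moment-cumulant formula. -/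
theorem HasInfinitesimalDistribution.moment_expansion_eq
    (h : HasInfinitesimalDistribution p μ μ') {κ : ℕ → DualNumber ℝ}
    (hκ : ∀ n, ((fun d => finiteFreeCumulant (p d) n), κ n) ∈ expansionSubring) (n : ℕ) :
    TrivSqZeroExt.inl (measMoment μ (n + 1)) + TrivSqZeroExt.inr (μ' (Polynomial.X ^ (n + 1)))
      = ncSum κ (Finset.range (n + 1))
        - TrivSqZeroExt.inr (annularCoeff (fun j => (κ j).fst) (n + 1)) := by
  have h1 := transPoly_mem expansionSubring expansion_eps hκ (n + 1)
  rw [transPoly_pair (fun d : ℕ => (-(d : ℝ))⁻¹) (-DualNumber.eps)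
    (fun d => finiteFreeCumulant (p d)) κ] at h1
  have h2 := expansionSubring.mul_mem (natCast_mem expansionSubring n.factorial)
    (h.coeff_momentSeries_expansion (n + 1))
  have hf : (n.factorial : ℝ) ≠ 0 := by positivity
  -- The same sequence is expanded as a polynomial in the cumulants and as a multiple of the root
  -- moments.
  have h3 := expansion_unique h1 (expansion_congr h2 (Eventually.of_forall fun d => by
    simp only [Prod.fst_natCast, Pi.mul_apply, Pi.natCast_apply, coeff_momentSeries]
    exact mul_div_cancel₀ _ hf))
  rw [transPoly_eps, momentExpansion, PowerSeries.coeff_mk, if_neg (Nat.succ_ne_zero n)] at h3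
  have hu : IsUnit (n.factorial : DualNumber ℝ) := by
    rw [← map_natCast (algebraMap ℝ (DualNumber ℝ))]
    exact (IsUnit.mk0 _ hf).map _
  exact (hu.mul_left_cancel h3).symm

theorem HasInfinitesimalDistribution.fst_expansion_eq_freeCumulant
    (h : HasInfinitesimalDistribution p μ μ') {κ : ℕ → DualNumber ℝ}
    (hκ : ∀ n, ((fun d => finiteFreeCumulant (p d) n), κ n) ∈ expansionSubring) (n : ℕ)
    (hn : 1 ≤ n) : (κ n).fst = freeCumulant μ n := by
  obtain ⟨n, rfl⟩ := Nat.exists_eq_add_of_le' hn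
  refine eq_of_ncSum_eq (u := fun j => (κ j).fst) (v := freeCumulant μ) (fun n => ?_) n
  have h1 := congrArg TrivSqZeroExt.fst (h.moment_expansion_eq hκ n)
  simp only [TrivSqZeroExt.fst_add, TrivSqZeroExt.fst_sub, TrivSqZeroExt.fst_inl,
    TrivSqZeroExt.fst_inr, add_zero, sub_zero] at h1
  refine (map_ncSum ((TrivSqZeroExt.fstHom ℝ ℝ ℝ : DualNumber ℝ →ₐ[ℝ] ℝ) : DualNumber ℝ →+* ℝ)
    κ _).trans (h1.symm.trans ?_)
  exact moment_eq_ncSum (measMoment μ) (n + 1) (by omega)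

theorem annularCoeff_one (κ : ℕ → ℝ) : annularCoeff κ 1 = 0 := by
  rw [annularCoeff, Finset.filter_eq_empty_iff.2, Finset.sum_empty, mul_zero]
  intro ts hts
  have := Finset.HasAntidiagonal.mem_antidiagonal.1 hts
  omega

end FiniteFree

/-! ### Assembly of the expansion and the functional equation -/

theorem mainTheorem5 (p : ℕ → Polynomial ℝ) (μ : MeasureTheory.Measure ℝ)
    (μ' : Polynomial ℝ →ₗ[ℝ] ℝ) (h : FiniteFree.HasInfinitesimalDistribution p μ μ') :
    (∀ n : ℕ, 1 ≤ n →
      (fun d : ℕ => FiniteFree.finiteFreeCumulant (p d) n - FiniteFree.freeCumulant μ n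
          - (1 / (d : ℝ)) * FiniteFree.cumulantFluctuation p μ n)
        =o[Filter.atTop] fun d : ℕ => 1 / (d : ℝ)) ∧
    FiniteFree.infCauchyTransform μ' =
      -(PowerSeries.subst (FiniteFree.cauchyTransform μ) (FiniteFree.fluctuationTransform p μ)
          : PowerSeries ℝ) * FiniteFree.derivZ (FiniteFree.cauchyTransform μ)
        - FiniteFree.hTransform μ := by
  open FiniteFree in
  choose κ hκ using h.exists_finiteFreeCumulant_expansion
  have hr := h.fst_expansion_eq_freeCumulant hκ
  have hlim : ∀ n, 1 ≤ n → Tendsto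
      (fun d : ℕ => (d : ℝ) * (finiteFreeCumulant (p d) n - freeCumulant μ n)) atTop
      (𝓝 (κ n).snd) := fun n hn => by
    rw [← hr n hn]
    exact (mem_expansionSubring.1 (hκ n)).2
  have hfl : ∀ n, 1 ≤ n → cumulantFluctuation p μ n = (κ n).snd :=
    fun n hn => (hlim n hn).limUnder_eq
  constructor
  · intro n hn
    rw [hfl n hn, isLittleO_iff_tendsto']
    · have h0 := (hlim n hn).sub_const (κ n).snd
      rw [sub_self] at h0
      refine h0.congr' ?_
      filter_upwards [eventually_ge_atTop 1] with d hd
      have hd0 : (d : ℝ) ≠ 0 := by positivity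
      field_simp
    · filter_upwards [eventually_ge_atTop 1] with d hd h0
      have hd0 : (d : ℝ) ≠ 0 := by positivity
      exact absurd h0 (one_div_ne_zero hd0)
  · have hG : cauchyTransform μ = PowerSeries.X * ncSeries fun j => (κ j).fst := by
      rw [cauchyTransform, cauchySeries]
      congr 1
      ext n
      cases n with
      | zero => rw [coeff_zero_ncSeries, PowerSeries.coeff_mk, h.measMoment_zero]
      | succ n =>
        have h1 := congrArg TrivSqZeroExt.fst (h.moment_expansion_eq hκ n)
        simp only [TrivSqZeroExt.fst_add, TrivSqZeroExt.fst_sub, TrivSqZeroExt.fst_inl,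
          TrivSqZeroExt.fst_inr, add_zero, sub_zero] at h1
        rw [PowerSeries.coeff_mk, ncSeries, PowerSeries.coeff_mk, h1]
        exact (map_ncSum ((TrivSqZeroExt.fstHom ℝ ℝ ℝ : DualNumber ℝ →ₐ[ℝ] ℝ) :
          DualNumber ℝ →+* ℝ) κ _).symm
    have hR : fluctuationTransform p μ = PowerSeries.mk fun n => (κ (n + 1)).snd := by
      ext n
      rw [fluctuationTransform, PowerSeries.coeff_mk, PowerSeries.coeff_mk, hfl _ (by omega)]
    have hI : infCauchyTransform μ' = PowerSeries.X *
        (PowerSeries.mk fun n => (PowerSeries.coeff n (ncSeries κ)).snd) - hTransform μ := by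
      rw [infCauchyTransform, hTransform, cauchySeries, cauchySeries, ← mul_sub]
      congr 1
      ext n
      rw [map_sub, PowerSeries.coeff_mk, PowerSeries.coeff_mk, PowerSeries.coeff_mk]
      cases n with
      | zero => simp [h.map_one, coeff_zero_ncSeries]
      | succ n =>
        have h1 := congrArg TrivSqZeroExt.snd (h.moment_expansion_eq hκ n)
        simp only [TrivSqZeroExt.snd_add, TrivSqZeroExt.snd_sub, TrivSqZeroExt.snd_inl,
          TrivSqZeroExt.snd_inr, zero_add, annularCoeff_congr hr] at h1
        rw [ncSeries, PowerSeries.coeff_mk, h1]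
        congr 1
        split_ifs with hn
        · rfl
        -- The H-transform starts in degree 2; nothing is lost, because there are no t, s ≥ 1 with t
        -- + s = 1.
        · obtain rfl : n = 0 := by omega
          exact annularCoeff_one _
    -- The two minus signs cancel, since `derivZ` is -w² d/dw; one factor w comes from the Cauchy
    -- series and the other from `ncSeries_derivative`.
    rw [hI, ncSeries_derivative, ← hG, ← hR, derivZ]
    ring
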